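/- For a nonincreasing sequence $d=(d_1,\dots,d_n)$ of positive integers let $\sum d=\sum_{i=1}^n d_i$ and let $\omega_1$ be the number of indices $i$ with $d_i=1$. Let $\mathcal D$ be the family of all such sequences (of any length $n$) for which $\sum d$ is even and $2n\le \sum d\le 4n-6-2\omega_1$. A simple graph $G$ on the vertices $v_1,\dots,v_n$ is a realization of $d$ if $\deg_G(v_i)=d_i$ for all $i$. For a linear order of the vertices (along the spine of a book), a set of edges fits on one page if no two of its edges $ab$ and $ce$ satisfy $a<c<b<e$ in this order. The graph $G$ is outerplanar (equivalently, 1-page book embeddable) if for some linear order of its vertices all its edges fit on one page; a 2-page book embedding of $G$ is a linear order of its vertices together with a partition $E(G)=E_1\cup E_2$ such that each of $E_1$, $E_2$ fits on one page for this order. The sequence $d$ is outerplanaric if it has an outerplanar realization. Theorem. There is a deterministic polynomial-time algorithm (a program for a unit-cost random access machine with addition and subtraction that, for some polynomial $p$, halts within $p(n)$ steps on every $d\in\mathcal D$ of length $n$) that, given any $d\in\mathcal D$, either answers "$d$ is not outerplanaric", in which case $d$ is indeed not outerplanaric, or returns a realization of $d$ together with a 2-page book embedding of it. Consequently, if $\mathcal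 D_{NOP}$ and $\mathcal D_{2PBE}$ denote the sets of those $d\in\mathcal D$ for which the first, respectively the second, outcome occurs, then $\mathcal D=\mathcal D_{NOP}\cup\mathcal D_{2PBE}$ is a partition into disjoint subfamilies, no sequence in $\mathcal D_{NOP}$ is outerplanaric, every sequence in $\mathcal D_{2PBE}$ has a realization with a 2-page book embedding, and every outerplanaric sequence in $\mathcal D$ lies in $\mathcal D_{2PBE}$. -/

import Mathlib

/-! ### The family of degree sequences -/

/-- The multiplicity `ω_x` of the degree `x` in the sequence `d`. -/
def multiplicity_in {n : ℕ} (d : Fin n → ℕ) (x : ℕ) : ℕ :=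
  (Finset.univ.filter fun i => d i = x).card

/-- The sequences of length `n` in the family `𝒟`: nonincreasing sequences of `n` positive integers
with even sum and `2n ≤ ∑ d ≤ 4n - 6 - 2ω₁` (the upper bound is written without subtraction). -/
def familyD (n : ℕ) : Set (Fin n → ℕ) :=
  {d | Antitone d ∧ (∀ i, 0 < d i) ∧ Even (∑ i, d i) ∧
    2 * n ≤ ∑ i, d i ∧ (∑ i, d i) + 6 + 2 * multiplicity_in d 1 ≤ 4 * n}

/-! ### Realizations, outerplanar graphs, book embeddings -/

/-- `G` realizes `d`: for every `v`, vertex `v` has degree `d v`. -/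
def Realizes {n : ℕ} (G : SimpleGraph (Fin n)) (d : Fin n → ℕ) : Prop :=
  ∀ v, (G.neighborSet v).ncard = d v

/-- With vertex `v` placed at position `pos v` of the spine, all edges of `G` can be drawn in one
page (half-plane) without crossings: no two edges have interleaving endpoints. -/
def IsPage {n : ℕ} (pos : Equiv.Perm (Fin n)) (G : SimpleGraph (Fin n)) : Prop :=
  ∀ a b c e, G.Adj a b → G.Adj c e → ¬ (pos a < pos c ∧ pos c < pos b ∧ pos b < pos e)

/-- Outerplanar, i.e. 1-page book embeddable. -/
def IsOuterplanar {n : ℕ} (G : SimpleGraph (Fin n)) : Prop :=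
  ∃ pos, IsPage pos G

/-- `d` is outerplanaric: it has an outerplanar realization. -/
def IsOuterplanaric {n : ℕ} (d : Fin n → ℕ) : Prop :=
  ∃ G : SimpleGraph (Fin n), IsOuterplanar G ∧ Realizes G d

/-- The graph with edge set `E₁ ∪ E₂` realizes `d`, and `(pos, G₁, G₂)` is a 2-page book embedding
of it: `E₁`, `E₂` are disjoint, and each is drawn in its page without crossings, for the same order
of the vertices on the spine. -/
structure IsTwoPageRealization {n : ℕ} (d : Fin n → ℕ) (pos : Equiv.Perm (Fin n))
    (G₁ G₂ : SimpleGraph (Fin n)) : Prop where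
  realizes : Realizes (G₁ ⊔ G₂) d
  disjoint : Disjoint G₁ G₂
  page₁ : IsPage pos G₁
  page₂ : IsPage pos G₂

/-! ### The machine model

A random access machine with unit cost, addition and truncated subtraction (no multiplication,
so that its running time is polynomially related to that of Turing machines), programmed by
structured programs. -/

namespace RAM

/-- The memory: `s a i` is cell `i` of array `a`. A program names only finitely many arrays. -/
abbrev State := ℕ → ℕ → ℕ

/-- Expressions: constants, reading a cell of an array at a computed index, `+`, and `-`. -/
inductive Expr where
  | const (k : ℕ)
  | read (a : ℕ) (i : Expr)
  | add (x y : Expr)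
  | sub (x y : Expr)

/-- The value of an expression. -/
def Expr.eval (s : State) : Expr → ℕ
  | .const k => k
  | .read a i => s a (i.eval s)
  | .add x y => x.eval s + y.eval s
  | .sub x y => x.eval s - y.eval s

/-- The number of steps for evaluating an expression: one for each operation. -/
def Expr.cost : Expr → ℕ
  | .const _ => 1
  | .read _ i => i.cost + 1
  | .add x y => x.cost + y.cost + 1
  | .sub x y => x.cost + y.cost + 1

/-- Programs. `write a i e` stores `e` in cell `i` of array `a`; conditions are true if nonzero. -/
inductive Prog where
  | skip
  | write (a : ℕ) (i e : Expr)
  | seq (p q : Prog)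
  | branch (e : Expr) (p q : Prog)
  | loop (e : Expr) (p : Prog)

/-- `Exec p s t s'`: started in memory `s`, the program `p` halts after exactly `t` steps with
memory `s'`. -/
inductive Exec : Prog → State → ℕ → State → Prop where
  | skip (s : State) : Exec .skip s 1 s
  | write (a : ℕ) (i e : Expr) (s : State) :
      Exec (.write a i e) s (i.cost + e.cost + 1)
        (Function.update s a (Function.update (s a) (i.eval s) (e.eval s)))
  | seq {p q : Prog} {s s₁ s₂ : State} {t₁ t₂ : ℕ} (h₁ : Exec p s t₁ s₁) (h₂ : Exec q s₁ t₂ s₂) :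
      Exec (.seq p q) s (t₁ + t₂) s₂
  | branch_true {e : Expr} {p q : Prog} {s s₁ : State} {t : ℕ} (h : e.eval s ≠ 0)
      (h₁ : Exec p s t s₁) : Exec (.branch e p q) s (e.cost + 1 + t) s₁
  | branch_false {e : Expr} {p q : Prog} {s s₁ : State} {t : ℕ} (h : e.eval s = 0)
      (h₁ : Exec q s t s₁) : Exec (.branch e p q) s (e.cost + 1 + t) s₁
  | loop_done {e : Expr} {p : Prog} {s : State} (h : e.eval s = 0) :
      Exec (.loop e p) s (e.cost + 1) s
  | loop_step {e : Expr} {p : Prog} {s s₁ s₂ : State} {t₁ t₂ : ℕ} (h : e.eval s ≠ 0)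
      (h₁ : Exec p s t₁ s₁) (h₂ : Exec (.loop e p) s₁ t₂ s₂) :
      Exec (.loop e p) s (e.cost + 1 + t₁ + t₂) s₂

/-! ### Input and output -/

/-- The initial memory for the input `d`: array `0` holds `n` (in cell `0`), array `1` holds
`d`, everything else is `0`. -/
def input {n : ℕ} (d : Fin n → ℕ) : State := fun a i =>
  if a = 0 ∧ i = 0 then n
  else if a = 1 then (if h : i < n then d ⟨i, h⟩ else 0)
  else 0

/-- The final memory `s` means the answer that the sequence is not outerplanaric. -/
def AnswersNo (s : State) : Prop := s 2 0 = 0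

/-- The first `s c 0` entries of the arrays `a` and `b` of `s` list (the two endpoints of) the
edges of `G`, each edge in one or the other orientation. -/
def ListsEdges {n : ℕ} (s : State) (c a b : ℕ) (G : SimpleGraph (Fin n)) : Prop :=
  (∀ k < s c 0, ∃ u v : Fin n, G.Adj u v ∧ s a k = u ∧ s b k = v) ∧
  (∀ u v : Fin n, G.Adj u v →
    ∃ k < s c 0, (s a k = u ∧ s b k = v) ∨ (s a k = v ∧ s b k = u))

/-- The final memory `s` means a positive answer, together with a realization of `d` and a
2-page book embedding of it: the positions of the vertices on the spine are in array `3`, the edges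
of the first page in the arrays `5`, `6` (their number in array `4`), and those of the
second page in the arrays `8`, `9` (their number in array `7`). -/
def Returns2PBE {n : ℕ} (s : State) (d : Fin n → ℕ) : Prop :=
  s 2 0 ≠ 0 ∧ ∃ (pos : Equiv.Perm (Fin n)) (G₁ G₂ : SimpleGraph (Fin n)),
    (∀ v : Fin n, s 3 v = pos v) ∧ ListsEdges s 4 5 6 G₁ ∧ ListsEdges s 7 8 9 G₂ ∧
    IsTwoPageRealization d pos G₁ G₂

end RAM

/-- The sequences of length `n` in `𝒟` that the program `P` rejects as not outerplanaric. -/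
def familyNOP (P : RAM.Prog) (n : ℕ) : Set (Fin n → ℕ) :=
  {d | d ∈ familyD n ∧ ∃ t s, RAM.Exec P (RAM.input d) t s ∧ RAM.AnswersNo s}

/-- The sequences of length `n` in `𝒟` for which `P` returns a 2-page book embedded realization. -/
def family2PBE (P : RAM.Prog) (n : ℕ) : Set (Fin n → ℕ) :=
  {d | d ∈ familyD n ∧ ∃ t s, RAM.Exec P (RAM.input d) t s ∧ RAM.Returns2PBE s d}

/-! The only obstruction that is ever tested is `d₁ ≥ n`, which no simple graph can realize. Every
other sequence of the family has a realization with a 2-page book embedding, and the program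
constructs one. Outerplanarity plays no role beyond this: an outerplanaric sequence is graphic and
hence never rejected.

Call `d i - 2` (truncated) the excess of vertex `i`, let `F` be its sum, `h` the number of vertices
of degree at least 3 and `w` the number of vertices of degree 1. The conditions on the sum become `w
≤ F`, `F + w` even and `F + w + 6 ≤ 2n`. Some vertices of small degree are set aside as tokens, and
the other vertices, the core, are joined in a Hamiltonian cycle. This leaves each core vertex with
exactly its excess to be used up, in two ways. First, by tokens: a pendant token takes one unit, and
a doubled token, of degree 2, takes one unit at each of two core vertices. Second, by the edges of a
forest on the high vertices. After the pendant vertices are served an even amount `2 * half`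
remains; the forest takes at most `h - 1` edges and doubled tokens absorb the rest. If one vertex
has more than about half of the whole excess, pairs of adjacent vertices of degree 2, both hanging
on that vertex, serve as additional pendant tokens (`pseudo`). The bound on the sum ensures that the
core keeps at least three vertices and contains all high ones (`Params.good_mk'`).

How much of each excess goes to tokens is decided greedily, with caps (`share`,
`Feasible.le_sum_capacity`): no vertex gets more half-edges than there are tokens, and except when
the forest is a mere matching every high vertex keeps one unit for the forest. The forest degrees
that remain are those of a caterpillar with some disjoint edges (`Feasible.forest_balance`). A
caterpillar can be drawn without crossings between two parallel lines (`ForestState`,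
`CoreKeys.nonCrossing_forestEdges`). The cycle runs through one line and back through the other,
with a separating vertex at each turn, so that forest edges are never cycle edges. If there are not
two core vertices of forest degree zero to serve as separators, two leaves of the forest take this
role and are joined to each other on the second page; there are no doubled tokens in that case
(`Feasible.doubled_eq_zero`).

For the tokens, list the half-edges in the order of the cycle, one block for each core vertex, and
add one dummy half-edge for every pendant token at the end. There are `2K` of them for `K` tokens,
and no block has more than `K`. Hence they can be paired without crossings and without a pair inside
a block: cut at both ends of the block in the middle, and match the three segments with each other
in nested families (`token_separated`, `token_nonCrossing`). Each token is put on the spine at the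
place of its first half-edge, directly after the owner of that half-edge. Its first edge then passes
over no core vertex and goes to page one, together with the cycle and the forest; its second edge
goes to page two, where the nested pairing prevents crossings (`Drawing.nonCrossing_pageOne`,
`Drawing.nonCrossing_pageTwo`).

The program is written in a language with `for` loops of at most `2n` rounds. Compilation to the
machine yields a polynomial time bound once and for all (`Cmd.exec_compile`), so that only the
effect of the programs remains to be verified. -/

namespace RAM

/-! ### Programs with bounded loops -/

/-- The memory `s` with `x` stored in cell `i` of array `a`. -/
def State.set (s : State) (a i x : ℕ) : State :=
  Function.update s a (Function.update (s a) i x)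

theorem State.set_apply (s : State) (a i x b j : ℕ) :
    s.set a i x b j = if b = a ∧ j = i then x else s b j := by
  unfold State.set
  by_cases hb : b = a
  · subst hb
    by_cases hj : j = i <;> simp [hj]
  · simp [hb]

theorem State.set_of_ne (s : State) {a b : ℕ} (i x : ℕ) (h : b ≠ a) : s.set a i x b = s b := by
  funext j
  simp [State.set_apply, h]

/-- The arrays read by an expression. -/
def Expr.reads : Expr → List ℕ
  | .const _ => []
  | .read a i => a :: i.reads
  | .add x y => x.reads ++ y.reads
  | .sub x y => x.reads ++ y.reads

theorem Expr.eval_congr {s t : State} {e : Expr} (h : ∀ a ∈ e.reads, s a = t a) :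
    e.eval s = e.eval t := by
  induction e with
  | const k => rfl
  | read a i ih =>
    simp only [Expr.reads, List.mem_cons, forall_eq_or_imp] at h
    simp only [Expr.eval, h.1, ih h.2]
  | add x y ihx ihy =>
    simp only [Expr.reads, List.mem_append] at h
    simp only [Expr.eval, ihx fun a ha => h a (.inl ha), ihy fun a ha => h a (.inr ha)]
  | sub x y ihx ihy =>
    simp only [Expr.reads, List.mem_append] at h
    simp only [Expr.eval, ihx fun a ha => h a (.inl ha), ihy fun a ha => h a (.inr ha)]

/-- Programs whose only loops are `for` loops: `loop c b p` runs `p` with cell `0` of array `c`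
set to `0, 1, …` in turn, `min b (2n)` times, where `n` is cell `0` of array `0`. -/
inductive Cmd where
  | skip
  | write (a : ℕ) (i e : Expr)
  | seq (p q : Cmd)
  | branch (e : Expr) (p q : Cmd)
  | loop (c : ℕ) (b : Expr) (p : Cmd)

/-- The first `m` rounds of a `for` loop with counter array `c` and body `f`. -/
def iter (c : ℕ) (f : State → State) : ℕ → State → State
  | 0, s => s
  | m + 1, s => f ((iter c f m s).set c 0 m)

/-- The effect of a program on the memory. -/
def Cmd.run : Cmd → State → State
  | .skip, s => s
  | .write a i e, s => s.set a (i.eval s) (e.eval s)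
  | .seq p q, s => q.run (p.run s)
  | .branch e p q, s => if e.eval s ≠ 0 then p.run s else q.run s
  | .loop c b p, s =>
      (iter c p.run (min (b.eval s) (2 * s 0 0)) s).set c 0 (min (b.eval s) (2 * s 0 0))

/-- The arrays written by a program. -/
def Cmd.writes : Cmd → List ℕ
  | .skip => []
  | .write a _ _ => [a]
  | .seq p q => p.writes ++ q.writes
  | .branch _ p q => p.writes ++ q.writes
  | .loop c _ p => c :: p.writes

/-- The bodies of the loops change neither the counter nor the bound of the loop. -/
def Cmd.ok : Cmd → Bool
  | .skip => true
  | .write a _ _ => a ≠ 0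
  | .seq p q => p.ok && q.ok
  | .branch _ p q => p.ok && q.ok
  | .loop c b p => p.ok && c ≠ 0 && c ∉ b.reads && c ∉ p.writes && b.reads.all (· ∉ p.writes)

/-- The expression for `min x y`. -/
def Expr.min (x y : Expr) : Expr := .sub x (.sub x y)

theorem Expr.eval_min (x y : Expr) (s : State) :
    (Expr.min x y).eval s = Min.min (x.eval s) (y.eval s) := by
  simp only [Expr.min, Expr.eval]
  omega

/-- Cell `0` of array `a`. -/
def Expr.var (a : ℕ) : Expr := .read a (.const 0)

@[simp] theorem Expr.eval_var (a : ℕ) (s : State) : (Expr.var a).eval s = s a 0 := rfl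

/-- The number of rounds that remain for a loop with counter `c` and bound `b`. -/
def Expr.left (c : ℕ) (b : Expr) : Expr :=
  .sub (Expr.min b (.add (.var 0) (.var 0))) (.var c)

/-- The program for the machine. -/
def Cmd.compile : Cmd → Prog
  | .skip => .skip
  | .write a i e => .write a i e
  | .seq p q => .seq p.compile q.compile
  | .branch e p q => .branch e p.compile q.compile
  | .loop c b p => .seq (.write c (.const 0) (.const 0))
      (.loop (Expr.left c b)
        (.seq p.compile (.write c (.const 0) (.add (.var c) (.const 1)))))

open Polynomial in
/-- A bound for the running time, as a polynomial in `n`. -/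
noncomputable def Cmd.time : Cmd → ℕ[X]
  | .skip => 1
  | .write _ i e => C (i.cost + e.cost + 1)
  | .seq p q => p.time + q.time
  | .branch e p q => C (e.cost + 1) + (p.time + q.time)
  | .loop c b p => C 3 + (C ((Expr.left c b).cost + 1) +
      2 * X * (C ((Expr.left c b).cost + 1) + (p.time + C 6)))

theorem iter_frame {c a : ℕ} {f : State → State} (hc : a ≠ c) (hf : ∀ s, f s a = s a) (m : ℕ)
    (s : State) : iter c f m s a = s a := by
  induction m with
  | zero => rfl
  | succ m ih => rw [iter, hf, State.set_of_ne _ _ _ hc, ih]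

/-- A program changes only the arrays that it writes. -/
theorem Cmd.run_frame {a : ℕ} : ∀ (p : Cmd), a ∉ p.writes → ∀ s, p.run s a = s a
  | .skip, _, _ => rfl
  | .write b i e, h, s => State.set_of_ne _ _ _ (by simpa [Cmd.writes] using h)
  | .seq p q, h, s => by
    simp only [Cmd.writes, List.mem_append, not_or] at h
    rw [Cmd.run, q.run_frame h.2, p.run_frame h.1]
  | .branch e p q, h, s => by
    simp only [Cmd.writes, List.mem_append, not_or] at h
    rw [Cmd.run]
    split
    · exact p.run_frame h.1 s
    · exact q.run_frame h.2 s
  | .loop c b p, h, s => by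
    simp only [Cmd.writes, List.mem_cons, not_or] at h
    rw [Cmd.run, State.set_of_ne _ _ _ h.1, iter_frame h.1 (p.run_frame h.2)]

/-- Array `0` holds `n`, which bounds the loops and is the argument of the time polynomial, so it
has to stay constant during the run. -/
theorem Cmd.zero_notMem_writes : ∀ (p : Cmd), p.ok → 0 ∉ p.writes
  | .skip, _ => by simp [Cmd.writes]
  | .write a i e, h => by
    simp only [Cmd.ok, ne_eq, decide_not, Bool.not_eq_eq_eq_not, Bool.not_true,
      decide_eq_false_iff_not] at h
    simpa [Cmd.writes, eq_comm] using h
  | .seq p q, h => by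
    simp only [Cmd.ok, Bool.and_eq_true] at h
    simp [Cmd.writes, p.zero_notMem_writes h.1, q.zero_notMem_writes h.2]
  | .branch e p q, h => by
    simp only [Cmd.ok, Bool.and_eq_true] at h
    simp [Cmd.writes, p.zero_notMem_writes h.1, q.zero_notMem_writes h.2]
  | .loop c b p, h => by
    simp only [Cmd.ok, Bool.and_eq_true, decide_eq_true_eq] at h
    simp [Cmd.writes, p.zero_notMem_writes h.1.1.1.1, Ne.symm h.1.1.1.2]

/-- The machine runs the compiled program in polynomial time. -/
theorem Cmd.exec_compile : ∀ (p : Cmd), p.ok → ∀ s,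
    ∃ t ≤ p.time.eval (s 0 0), Exec p.compile s t (p.run s)
  | .skip, _, s => ⟨1, by simp [Cmd.time], .skip s⟩
  | .write a i e, _, s => ⟨_, by simp [Cmd.time], .write a i e s⟩
  | .seq p q, h, s => by
    simp only [Cmd.ok, Bool.and_eq_true] at h
    obtain ⟨t₁, h₁, e₁⟩ := p.exec_compile h.1 s
    obtain ⟨t₂, h₂, e₂⟩ := q.exec_compile h.2 (p.run s)
    rw [p.run_frame (p.zero_notMem_writes h.1)] at h₂
    exact ⟨t₁ + t₂, by simp only [Cmd.time, Polynomial.eval_add]; omega, .seq e₁ e₂⟩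
  | .branch e p q, h, s => by
    simp only [Cmd.ok, Bool.and_eq_true] at h
    by_cases he : e.eval s ≠ 0
    · obtain ⟨t, ht, ex⟩ := p.exec_compile h.1 s
      refine ⟨_, ?_, by rw [Cmd.run, if_pos he]; exact .branch_true he ex⟩
      simp only [Cmd.time, Polynomial.eval_add, Polynomial.eval_C]
      omega
    · obtain ⟨t, ht, ex⟩ := q.exec_compile h.2 s
      refine ⟨_, ?_, by rw [Cmd.run, if_neg he]; exact .branch_false (not_not.1 he) ex⟩
      simp only [Cmd.time, Polynomial.eval_add, Polynomial.eval_C]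
      omega
  | .loop c b p, h, s => by
    simp only [Cmd.ok, Bool.and_eq_true, decide_eq_true_eq, List.all_eq_true] at h
    obtain ⟨⟨⟨⟨hp, hc⟩, hcb⟩, hcp⟩, hb⟩ := h
    have h0 := p.zero_notMem_writes hp
    set m := min (b.eval s) (2 * s 0 0) with hm
    -- The condition of the compiled loop is evaluated afresh in every round. It counts the rounds
    -- to go because the body touches neither the bound, nor the counter, nor `n`.
    have hev : ∀ k, (Expr.left c b).eval ((iter c p.run k s).set c 0 k) = m - k := by
      intro k
      have h1 : b.eval ((iter c p.run k s).set c 0 k) = b.eval s := by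
        refine Expr.eval_congr fun a ha => ?_
        have hac : a ≠ c := fun e => hcb (e ▸ ha)
        rw [State.set_of_ne _ _ _ hac, iter_frame hac (p.run_frame (hb a ha))]
      have h2 : ((iter c p.run k s).set c 0 k) 0 0 = s 0 0 := by
        rw [State.set_of_ne _ _ _ hc.symm, iter_frame hc.symm (p.run_frame h0)]
      have h3 : ((iter c p.run k s).set c 0 k) c 0 = k := by simp [State.set_apply]
      simp only [Expr.left, Expr.eval, Expr.eval_min, Expr.eval_var, h1, h2, h3]
      rw [hm, two_mul]
    -- Induction on the number `i` of rounds still to be run, that is, backwards from the final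
    -- memory.
    have main : ∀ i, i ≤ m → ∃ t ≤ ((Expr.left c b).cost + 1) +
        i * (((Expr.left c b).cost + 1) + (p.time.eval (s 0 0) + 6)),
        Exec (.loop (Expr.left c b)
          (.seq p.compile (.write c (.const 0) (.add (.var c) (.const 1)))))
          ((iter c p.run (m - i) s).set c 0 (m - i)) t ((iter c p.run m s).set c 0 m) := by
      intro i
      induction i with
      | zero =>
        intro _
        exact ⟨_, by simp, .loop_done (by rw [Nat.sub_zero, hev]; omega)⟩
      | succ i ih =>
        intro hi
        obtain ⟨t, ht, ex⟩ := ih (by omega)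
        obtain ⟨t', ht', ex'⟩ := p.exec_compile hp ((iter c p.run (m - (i + 1)) s).set c 0 (m - (i + 1)))
        have h2 : ((iter c p.run (m - (i + 1)) s).set c 0 (m - (i + 1))) 0 0 = s 0 0 := by
          rw [State.set_of_ne _ _ _ hc.symm, iter_frame hc.symm (p.run_frame h0)]
        rw [h2] at ht'
        have hw := Exec.write c (.const 0) (.add (.var c) (.const 1))
          (p.run ((iter c p.run (m - (i + 1)) s).set c 0 (m - (i + 1))))
        have hval : (Expr.add (.var c) (.const 1)).eval
            (p.run ((iter c p.run (m - (i + 1)) s).set c 0 (m - (i + 1)))) = m - i := by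
          simp only [Expr.eval, Expr.eval_var]
          rw [p.run_frame hcp, State.set_apply]
          simp only [and_self, if_true]
          omega
        have hst : Function.update (p.run ((iter c p.run (m - (i + 1)) s).set c 0 (m - (i + 1)))) c
            (Function.update (p.run ((iter c p.run (m - (i + 1)) s).set c 0 (m - (i + 1))) c)
              ((Expr.const 0).eval (p.run ((iter c p.run (m - (i + 1)) s).set c 0 (m - (i + 1)))))
              ((Expr.add (.var c) (.const 1)).eval
                (p.run ((iter c p.run (m - (i + 1)) s).set c 0 (m - (i + 1)))))) =
            (iter c p.run (m - i) s).set c 0 (m - i) := by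
          rw [hval]
          have : m - i = (m - (i + 1)) + 1 := by omega
          conv_rhs => rw [this, iter, ← this]
          rfl
        rw [hst] at hw
        refine ⟨_, ?_, .loop_step (by rw [hev]; omega) (.seq ex' hw) ex⟩
        -- The `6` in the time bound is the cost of incrementing the counter; the `3` below is that
        -- of resetting it.
        simp only [Expr.cost, Expr.var]
        nlinarith
    obtain ⟨t, ht, ex⟩ := main m le_rfl
    rw [Nat.sub_self] at ex
    refine ⟨_, ?_, .seq (.write c (.const 0) (.const 0) s) ex⟩
    simp only [Cmd.time, Polynomial.eval_add, Polynomial.eval_C, Polynomial.eval_mul,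
      Polynomial.eval_X, Expr.cost, Polynomial.eval_ofNat]
    have hm2 : m ≤ 2 * s 0 0 := min_le_right _ _
    have := Nat.mul_le_mul_right (((Expr.left c b).cost + 1) + (p.time.eval (s 0 0) + 6)) hm2
    omega

/-- The step may use that all arrays outside the loop still have their initial contents, so
invariants need not mention them. -/
theorem iter_induction {c : ℕ} {p : Cmd} {I : ℕ → State → Prop} {s : State} {m : ℕ}
    (h0 : I 0 s) (hs : ∀ i < m, ∀ t, (∀ a ∉ c :: p.writes, t a = s a) → I i t →
      I (i + 1) (p.run (t.set c 0 i))) : I m (iter c p.run m s) := by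
  induction m with
  | zero => exact h0
  | succ m ih =>
    refine hs m (Nat.lt_succ_self m) _ (fun a ha => ?_) (ih fun i hi => hs i (by omega))
    simp only [List.mem_cons, not_or] at ha
    exact iter_frame ha.1 (p.run_frame ha.2) m s

/-- The rule for loops: `I i t` is to hold in the memory `t` after `i` rounds, and must not depend
on the counter. -/
theorem Cmd.loop_induction {c : ℕ} {b : Expr} {p : Cmd} {s : State} (m : ℕ) (hm : b.eval s = m)
    (hm2 : m ≤ 2 * s 0 0) (I : ℕ → State → Prop) (h0 : I 0 s)
    (hs : ∀ i < m, ∀ t, (∀ a ∉ c :: p.writes, t a = s a) → I i t →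
      I (i + 1) (p.run (t.set c 0 i)))
    (hc : ∀ t, I m t → I m (t.set c 0 m)) : I m ((Cmd.loop c b p).run s) := by
  have : min (b.eval s) (2 * s 0 0) = m := by omega
  rw [Cmd.run, this]
  exact hc _ (iter_induction h0 hs)

end RAM

/-! ### Graphs given by lists of edges -/

/-- The number of occurrences of `v` as an endpoint of a pair in the list. -/
def edgeDegree (l : List (ℕ × ℕ)) (v : ℕ) : ℕ :=
  (l.map fun x => (if x.1 = v then 1 else 0) + (if x.2 = v then 1 else 0)).sum

@[simp] theorem edgeDegree_nil (v : ℕ) : edgeDegree [] v = 0 := rfl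

@[simp] theorem edgeDegree_cons (x : ℕ × ℕ) (l : List (ℕ × ℕ)) (v : ℕ) :
    edgeDegree (x :: l) v =
      (if x.1 = v then 1 else 0) + (if x.2 = v then 1 else 0) + edgeDegree l v := by
  simp [edgeDegree]

@[simp] theorem edgeDegree_append (l l' : List (ℕ × ℕ)) (v : ℕ) :
    edgeDegree (l ++ l') v = edgeDegree l v + edgeDegree l' v := by
  simp [edgeDegree]

theorem edgeDegree_map_range (m : ℕ) (g : ℕ → ℕ × ℕ) (v : ℕ) :
    edgeDegree ((List.range m).map g) v =
      ∑ k ∈ Finset.range m, ((if (g k).1 = v then 1 else 0) + (if (g k).2 = v then 1 else 0)) := by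
  induction m with
  | zero => rfl
  | succ m ih => simp [List.range_succ, Finset.sum_range_succ, ih]

/-- The graph whose edges are the pairs in the list. -/
def graphOfList (n : ℕ) (l : List (ℕ × ℕ)) : SimpleGraph (Fin n) :=
  SimpleGraph.fromRel fun u v => ((u : ℕ), (v : ℕ)) ∈ l

/-- All pairs are increasing for `key`. -/
def KeyIncreasing (key : ℕ → ℕ) (l : List (ℕ × ℕ)) : Prop := ∀ x ∈ l, key x.1 < key x.2

/-- No two pairs interleave for `key`. -/
def NonCrossing (key : ℕ → ℕ) (l : List (ℕ × ℕ)) : Prop :=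
  ∀ x ∈ l, ∀ y ∈ l, ¬ (key x.1 < key y.1 ∧ key y.1 < key x.2 ∧ key x.2 < key y.2)

theorem graphOfList_adj {n : ℕ} {l : List (ℕ × ℕ)} {key : ℕ → ℕ} (h : KeyIncreasing key l)
    (u v : Fin n) : (graphOfList n l).Adj u v ↔ ((u : ℕ), (v : ℕ)) ∈ l ∨ ((v : ℕ), (u : ℕ)) ∈ l := by
  rw [graphOfList, SimpleGraph.fromRel_adj]
  refine ⟨fun h => h.2, fun h' => ⟨?_, h'⟩⟩
  rintro rfl
  rcases h' with h' | h' <;> exact absurd (h _ h') (lt_irrefl _)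

/-- Every pair at `v` contributes a different neighbour: pairs are not repeated, and being
increasing for `key` excludes both loops and a second copy in the other orientation. -/
theorem card_filter_edgeDegree {n : ℕ} {key : ℕ → ℕ} (v : Fin n) (l : List (ℕ × ℕ))
    (h : KeyIncreasing key l) (hn : ∀ x ∈ l, x.1 < n ∧ x.2 < n) (hd : l.Nodup) :
    (Finset.univ.filter fun u : Fin n =>
      ((u : ℕ), (v : ℕ)) ∈ l ∨ ((v : ℕ), (u : ℕ)) ∈ l).card = edgeDegree l v := by
  induction l with
  | nil => simp
  | cons x l ih =>
    obtain ⟨a, b⟩ := x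
    have hab : key a < key b := h (a, b) (by simp)
    have hn' := hn (a, b) (by simp)
    have hnot : (a, b) ∉ l := (List.nodup_cons.1 hd).1
    have hnot' : (b, a) ∉ l := fun hm => by
      have := h (b, a) (by simp [hm])
      simp only at this
      omega
    have ih' := ih (fun x hx => h x (by simp [hx])) (fun x hx => hn x (by simp [hx]))
      (List.nodup_cons.1 hd).2
    have hne : a ≠ b := by rintro rfl; omega
    rw [edgeDegree_cons, ← ih']
    by_cases hav : a = v
    · have hbv : b ≠ v := fun e => hne (hav.trans e.symm)
      simp only [hav, hbv, if_true, if_false, add_zero]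
      rw [add_comm, ← Finset.card_insert_of_notMem (a := (⟨b, hn'.2⟩ : Fin n))]
      · congr 1
        ext u
        simp only [Finset.mem_filter, Finset.mem_univ, true_and, Finset.mem_insert, List.mem_cons,
          Prod.mk.injEq, Fin.ext_iff]
        have := Ne.symm hbv
        tauto
      · simp only [Finset.mem_filter, Finset.mem_univ, true_and, not_or]
        exact ⟨by rw [← hav]; exact hnot', by rw [← hav]; exact hnot⟩
    · by_cases hbv : b = v
      · simp only [hav, hbv, if_true, if_false, zero_add]
        rw [add_comm, ← Finset.card_insert_of_notMem (a := (⟨a, hn'.1⟩ : Fin n))]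
        · congr 1
          ext u
          simp only [Finset.mem_filter, Finset.mem_univ, true_and, Finset.mem_insert,
            List.mem_cons, Prod.mk.injEq, Fin.ext_iff]
          have := Ne.symm hav
          tauto
        · simp only [Finset.mem_filter, Finset.mem_univ, true_and, not_or]
          exact ⟨by rw [← hbv]; exact hnot, by rw [← hbv]; exact hnot'⟩
      · simp only [hav, hbv, if_false, zero_add]
        congr 1
        ext u
        simp only [Finset.mem_filter, Finset.mem_univ, true_and, List.mem_cons, Prod.mk.injEq]
        have := Ne.symm hav
        have := Ne.symm hbv
        tauto

theorem isPage_graphOfList {n : ℕ} {l : List (ℕ × ℕ)} {key : ℕ → ℕ} {pos : Equiv.Perm (Fin n)}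
    (hpos : ∀ u v, pos u < pos v ↔ key u < key v) (h : KeyIncreasing key l)
    (hc : NonCrossing key l) : IsPage pos (graphOfList n l) := by
  intro a b c e hab hce
  rw [hpos, hpos, hpos]
  rw [graphOfList_adj h] at hab hce
  rintro ⟨h1, h2, h3⟩
  rcases hab with hab | hab
  · rcases hce with hce | hce
    · exact hc _ hab _ hce ⟨h1, h2, h3⟩
    · have := h _ hce
      simp only at this
      omega
  · have := h _ hab
    simp only at this
    omega

/-- Two lists of edges that together have the right degrees, each without crossings, give a
realization with a 2-page book embedding. -/
theorem isTwoPageRealization_of_lists {n : ℕ} {d : Fin n → ℕ} {key : ℕ → ℕ}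
    {pos : Equiv.Perm (Fin n)} {l₁ l₂ : List (ℕ × ℕ)}
    (hpos : ∀ u v, pos u < pos v ↔ key u < key v) (hn : ∀ x ∈ l₁ ++ l₂, x.1 < n ∧ x.2 < n)
    (h : KeyIncreasing key (l₁ ++ l₂)) (hd : (l₁ ++ l₂).Nodup)
    (hdeg : ∀ v : Fin n, edgeDegree (l₁ ++ l₂) v = d v)
    (h₁ : NonCrossing key l₁) (h₂ : NonCrossing key l₂) :
    IsTwoPageRealization d pos (graphOfList n l₁) (graphOfList n l₂) := by
  have k₁ : KeyIncreasing key l₁ := fun x hx => h x (by simp [hx])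
  have k₂ : KeyIncreasing key l₂ := fun x hx => h x (by simp [hx])
  refine ⟨fun v => ?_, ?_, isPage_graphOfList hpos k₁ h₁, isPage_graphOfList hpos k₂ h₂⟩
  · rw [← hdeg v, ← card_filter_edgeDegree v _ h hn hd, ← Set.ncard_coe_finset]
    congr 1
    ext u
    simp only [SimpleGraph.mem_neighborSet, SimpleGraph.sup_adj, graphOfList_adj k₁,
      graphOfList_adj k₂, Finset.coe_filter, Finset.mem_univ, true_and, Set.mem_ofPred_eq,
      List.mem_append]
    tauto
  · rw [disjoint_iff, eq_bot_iff]
    intro u v huv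
    rw [SimpleGraph.inf_adj, graphOfList_adj k₁, graphOfList_adj k₂] at huv
    have hdis := List.disjoint_of_nodup_append hd
    obtain ⟨h3 | h3, h4 | h4⟩ := huv
    · exact (hdis h3 h4).elim
    · have := k₁ _ h3
      have := k₂ _ h4
      simp only at *
      omega
    · have := k₁ _ h3
      have := k₂ _ h4
      simp only at *
      omega
    · exact (hdis h3 h4).elim

/-! ### Ranks -/

/-- The number of `u < n` with a smaller key than `v`. -/
def rank (n : ℕ) (key : ℕ → ℕ) (v : ℕ) : ℕ := ((Finset.range n).filter fun u => key u < key v).card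

theorem rank_lt_rank {n : ℕ} {key : ℕ → ℕ} {u v : ℕ} (hu : u < n) (h : key u < key v) :
    rank n key u < rank n key v := by
  refine Finset.card_lt_card ⟨fun x => ?_, fun hs => ?_⟩
  · simp only [Finset.mem_filter]
    exact fun hx => ⟨hx.1, hx.2.trans h⟩
  · have := @hs u (by simp [hu, h])
    simp at this

theorem rank_lt {n : ℕ} {key : ℕ → ℕ} {v : ℕ} (hv : v < n) : rank n key v < n := by
  have := Finset.card_lt_card (s := (Finset.range n).filter fun u => key u < key v)
    (t := Finset.range n) ⟨Finset.filter_subset _ _, fun hs => by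
      have := @hs v (by simp [hv])
      simp at this⟩
  simpa [rank] using this

theorem rank_lt_iff {n : ℕ} {key : ℕ → ℕ} (hk : ∀ u < n, ∀ v < n, key u = key v → u = v)
    {u v : ℕ} (hu : u < n) (hv : v < n) : rank n key u < rank n key v ↔ key u < key v := by
  refine ⟨fun h => ?_, rank_lt_rank hu⟩
  by_contra hlt
  rcases (not_lt.1 hlt).lt_or_eq with h' | h'
  · have := rank_lt_rank hv h'
    omega
  · rw [hk v hv u hu h'] at h
    exact lt_irrefl _ h

theorem rank_inj {n : ℕ} {key : ℕ → ℕ} (hk : ∀ u < n, ∀ v < n, key u = key v → u = v)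
    {u v : ℕ} (hu : u < n) (hv : v < n) (h : rank n key u = rank n key v) : u = v := by
  refine hk u hu v hv ?_
  have h1 := rank_lt_iff hk hu hv
  have h2 := rank_lt_iff hk hv hu
  omega

/-- Every number below `n` is the rank of some `v < n`. -/
theorem exists_rank_eq {n : ℕ} {key : ℕ → ℕ} (hk : ∀ u < n, ∀ v < n, key u = key v → u = v)
    {k : ℕ} (h : k < n) : ∃ v < n, rank n key v = k := by
  have hinj : Function.Injective fun v : Fin n => (⟨rank n key v, rank_lt v.2⟩ : Fin n) :=
    fun u v huv => Fin.ext (rank_inj hk u.2 v.2 (by simpa using huv))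
  obtain ⟨v, hv⟩ := (Finite.injective_iff_surjective.1 hinj) ⟨k, h⟩
  exact ⟨v, v.2, by simpa using hv⟩

/-- If the first `M` numbers have smaller keys than the others, then their ranks are the first
`M` numbers. -/
theorem rank_lt_iff_lt {n M : ℕ} {key : ℕ → ℕ} (hM : M ≤ n)
    (hlt : ∀ u < M, ∀ v, M ≤ v → v < n → key u < key v) {v : ℕ} (hv : v < n) :
    rank n key v < M ↔ v < M := by
  constructor
  · intro h
    by_contra hge
    have : M ≤ rank n key v := by
      have := Finset.card_le_card (s := Finset.range M)
        (t := (Finset.range n).filter fun u => key u < key v) (fun u hu => by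
          simp only [Finset.mem_range] at hu
          simp only [Finset.mem_filter, Finset.mem_range]
          exact ⟨by omega, hlt u hu v (by omega) hv⟩)
      simpa [rank] using this
    omega
  · intro h
    have := Finset.card_lt_card (s := (Finset.range n).filter fun u => key u < key v)
      (t := Finset.range M) ⟨fun u => by
        simp only [Finset.mem_filter, Finset.mem_range]
        rintro ⟨h1, h2⟩
        by_contra hge
        have := hlt v h u (by omega) h1
        omega, fun hs => by
        have := @hs v (by simp [h])
        simp at this⟩
    simpa [rank] using this

/-- This allows the spine order to be prescribed by any distinct natural numbers, with gaps; the
positions are the ranks. -/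
theorem exists_perm_rank {n : ℕ} {key : ℕ → ℕ} (hk : ∀ u < n, ∀ v < n, key u = key v → u = v) :
    ∃ pos : Equiv.Perm (Fin n), (∀ v : Fin n, (pos v : ℕ) = rank n key v) ∧
      ∀ u v, pos u < pos v ↔ key u < key v := by
  have hinj : Function.Injective fun v : Fin n => (⟨rank n key v, rank_lt v.2⟩ : Fin n) :=
    fun u v huv => Fin.ext (rank_inj hk u.2 v.2 (by simpa using huv))
  refine ⟨Equiv.ofBijective _ (Finite.injective_iff_bijective.1 hinj), fun v => rfl, fun u v => ?_⟩
  rw [← rank_lt_iff hk u.2 v.2]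
  rfl

/-! ### The parameters of a sequence -/

/-- A sequence in the family whose entries are smaller than its length, as a function on `ℕ`. -/
structure Feasible (n : ℕ) (d : ℕ → ℕ) : Prop where
  anti : ∀ i j, i ≤ j → j < n → d j ≤ d i
  pos : ∀ i < n, 0 < d i
  even : Even (∑ i ∈ Finset.range n, d i)
  lower : 2 * n ≤ ∑ i ∈ Finset.range n, d i
  upper : (∑ i ∈ Finset.range n, d i) + 6 + 2 * (∑ i ∈ Finset.range n, (1 - (d i - 1))) ≤ 4 * n
  top : d 0 < n

/-- The quantities that govern the construction: the numbers of entries `1` (`ones`) and of entries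
at least `3` (`high`), the sum of the excesses `d i - 2`, the number of vertices of degree two that
are treated like vertices of degree one (`pseudo`), the number of pendant vertices of both kinds
(`pend`), half of the excess that is not used up by the pendant vertices (`half`), the number of
vertices of degree two that join two core vertices (`doubled`), the number of vertices outside the
core (`tokens`), the size of the core, and the number of high vertices that need not keep a part of
their excess for the forest (`free`). -/
structure Params where
  ones : ℕ
  high : ℕ
  excess : ℕ
  pseudo : ℕ
  pend : ℕ
  half : ℕ
  doubled : ℕ
  tokens : ℕ
  core : ℕ
  free : ℕ

/-- The parameters computed from `ones`, `high`, `excess`, the length `n` and the largest excess. -/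
def Params.mk' (n f₀ w h F : ℕ) : Params where
  ones := w
  high := h
  excess := F
  pseudo := f₀ + f₀ - (F + w)
  pend := w + (f₀ + f₀ - (F + w))
  half := (F - (w + (f₀ + f₀ - (F + w)))) / 2
  doubled := (F - (w + (f₀ + f₀ - (F + w)))) / 2 - (h - 1)
  tokens := (F - (w + (f₀ + f₀ - (F + w)))) / 2 - (h - 1) + (w + (f₀ + f₀ - (F + w)))
  core := n - ((F - (w + (f₀ + f₀ - (F + w)))) / 2 - (h - 1) + (w + (f₀ + f₀ - (F + w))))
  free := h - (F - (w + (f₀ + f₀ - (F + w))) - 2 * ((F - (w + (f₀ + f₀ - (F + w)))) / 2 - (h - 1)))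

/-- The parameters of the sequence `d`. -/
def params (n : ℕ) (d : ℕ → ℕ) : Params :=
  Params.mk' n (d 0 - 2) (∑ i ∈ Finset.range n, (1 - (d i - 1)))
    (∑ i ∈ Finset.range n, (1 - (1 - (d i - 2)))) (∑ i ∈ Finset.range n, (d i - 2))

/-- With truncated subtraction `1 - (1 - x)` is the indicator of `x > 0`, so the sum counts the
entries above `c`. In a nonincreasing sequence these form an initial segment. The indicator is
written this way because the machine evaluates the same expression. -/
theorem lt_sum_iff {n : ℕ} {d : ℕ → ℕ} (anti : ∀ i j, i ≤ j → j < n → d j ≤ d i) (c : ℕ) :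
    ∀ i < n, i < ∑ j ∈ Finset.range n, (1 - (1 - (d j - c))) ↔ c < d i := by
  induction n with
  | zero => simp
  | succ n ih =>
    have ih' := ih fun i j hij hj => anti i j hij (by omega)
    have hle : ∑ j ∈ Finset.range n, (1 - (1 - (d j - c))) ≤ n := by
      simpa using Finset.sum_le_card_nsmul (Finset.range n) (fun j => 1 - (1 - (d j - c))) 1
        (fun j _ => by omega)
    intro i hi
    rw [Finset.sum_range_succ]
    by_cases hn : c < d n
    · have : n ≤ ∑ j ∈ Finset.range n, (1 - (1 - (d j - c))) := by
        rcases Nat.eq_zero_or_pos n with h0 | h0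
        · omega
        · have := (ih' (n - 1) (by omega)).2 (lt_of_lt_of_le hn (anti _ _ (by omega) (by omega)))
          omega
      have := anti i n (by omega) (by omega)
      constructor <;> intro <;> omega
    · rcases Nat.lt_succ_iff_lt_or_eq.1 hi with h | rfl
      · have := ih' i h
        rw [show 1 - (1 - (d n - c)) = 0 by omega, add_zero]
        exact this
      · constructor <;> intro <;> omega

theorem Feasible.lt_high_iff {n : ℕ} {d : ℕ → ℕ} (H : Feasible n d) {i : ℕ} (hi : i < n) :
    i < (params n d).high ↔ 3 ≤ d i :=
  lt_sum_iff H.anti 2 i hi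

theorem Feasible.lt_sub_ones_iff {n : ℕ} {d : ℕ → ℕ} (H : Feasible n d) {i : ℕ} (hi : i < n) :
    i < n - (params n d).ones ↔ 2 ≤ d i := by
  have h1 : (params n d).ones + ∑ j ∈ Finset.range n, (1 - (1 - (d j - 1))) = n := by
    change (∑ j ∈ Finset.range n, (1 - (d j - 1))) + _ = n
    rw [← Finset.sum_add_distrib, Finset.sum_congr rfl (g := fun _ => 1)]
    · simp
    · intro j hj
      have := H.pos j (by simpa using hj)
      omega
  have h2 := lt_sum_iff H.anti 1 i hi
  constructor <;> intro <;> omega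

/-- The relations between the parameters. -/
structure Params.Good (P : Params) (n f₀ : ℕ) : Prop where
  excess_eq : P.excess = P.pend + 2 * P.half
  pend_eq : P.pend = P.ones + P.pseudo
  tokens_eq : P.tokens = P.doubled + P.pend
  core_add : P.core + P.tokens = n
  core_ge : 3 ≤ P.core
  high_le : P.high ≤ P.core
  pseudo_even : Even P.pseudo
  doubled_le : P.doubled ≤ P.half
  half_le : P.high ≤ 1 ∨ P.half + 1 ≤ P.doubled + P.high
  half_eq_doubled : P.high ≤ 1 → P.half = P.doubled
  few : P.core ≤ P.high + 1 → P.doubled = 0 ∧ P.half + 3 ≤ P.core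
  free_pos : 0 < P.free → P.doubled = 0 ∧ P.free + 2 * P.half = P.high
  free_zero : P.free = 0 → P.high + 2 * P.doubled ≤ 2 * P.half
  top_le : 2 * f₀ ≤ P.excess + P.pend
  pseudo_pos : 0 < P.pseudo → 0 < P.high ∧ f₀ + 1 = P.tokens + P.high
  doubled_add : P.doubled = 0 ∨ P.doubled + P.high = P.half + 1

/-- If `2 * f₀ ≤ F + w` there are no pseudo pendant vertices. Then either `doubled = 0` and the
tokens are just the entries `1`, or the number of tokens is `(F + w) / 2 - h + 1`, which leaves `h +
2` vertices by the bound on `F + w`. Otherwise `pend = 2 * f₀ - F` and `half = F - f₀`, so the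
number of tokens is `f₀ - h + 1`, and it is the bound on `f₀` that leaves enough vertices. -/
theorem Params.good_mk' {n f₀ w h F c : ℕ} (h1 : w ≤ F) (h2 : Even (F + w)) (h3 : F + 6 + w ≤ 2 * n)
    (h4 : F = h + c) (h5 : f₀ ≤ c + 1) (h6 : f₀ + 3 ≤ n) (h7 : h = 0 → F = 0 ∧ f₀ = 0)
    (h8 : h + w ≤ n) (h9 : h = 1 → F = f₀) : (Params.mk' n f₀ w h F).Good n f₀ := by
  obtain ⟨q, hq⟩ := h2
  unfold Params.mk'
  by_cases hy : 2 * f₀ ≤ F + w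
  · have : f₀ + f₀ - (F + w) = 0 := by omega
    constructor <;> simp only [this] <;> first | omega | exact ⟨0, by omega⟩
  · have hh : h ≠ 0 := fun e => by have := h7 e; omega
    have : (F - (w + (f₀ + f₀ - (F + w)))) / 2 = F - f₀ := by omega
    constructor <;> simp only [this] <;> first | omega | exact ⟨f₀ - q, by omega⟩

theorem Feasible.sum_excess {n : ℕ} {d : ℕ → ℕ} (H : Feasible n d) :
    (∑ i ∈ Finset.range n, d i) + (params n d).ones = (params n d).excess + 2 * n := by
  change (∑ i ∈ Finset.range n, d i) + (∑ i ∈ Finset.range n, (1 - (d i - 1))) =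
    (∑ i ∈ Finset.range n, (d i - 2)) + 2 * n
  have : 2 * n = ∑ i ∈ Finset.range n, 2 := by simp [mul_comm]
  rw [this, ← Finset.sum_add_distrib, ← Finset.sum_add_distrib]
  refine Finset.sum_congr rfl fun i hi => ?_
  have := H.pos i (by simpa using hi)
  omega

theorem excess_eq_high_add (n : ℕ) (d : ℕ → ℕ) :
    (params n d).excess = (params n d).high + ∑ i ∈ Finset.range n, (d i - 2 - 1) := by
  change (∑ i ∈ Finset.range n, (d i - 2)) = (∑ i ∈ Finset.range n, (1 - (1 - (d i - 2)))) + _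
  rw [← Finset.sum_add_distrib]
  exact Finset.sum_congr rfl fun i _ => by omega

theorem Feasible.n_pos {n : ℕ} {d : ℕ → ℕ} (H : Feasible n d) : 0 < n := by
  have := H.top
  omega

theorem Feasible.good {n : ℕ} {d : ℕ → ℕ} (H : Feasible n d) : (params n d).Good n (d 0 - 2) := by
  have hn := H.n_pos
  have hs := H.sum_excess
  have hu := H.upper
  change (∑ i ∈ Finset.range n, d i) + 6 + 2 * (params n d).ones ≤ 4 * n at hu
  have hl := H.lower
  have hc := excess_eq_high_add n d
  have h0 : d 0 - 2 - 1 ≤ ∑ i ∈ Finset.range n, (d i - 2 - 1) :=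
    Finset.single_le_sum (f := fun i => d i - 2 - 1) (fun _ _ => Nat.zero_le _) (by simpa using hn)
  have htop := H.top
  have hhigh := H.lt_high_iff hn
  have hall : (params n d).high = 0 → (params n d).excess = 0 := fun e => by
    change ∑ i ∈ Finset.range n, (d i - 2) = 0
    refine Finset.sum_eq_zero fun i hi => ?_
    have := H.lt_high_iff (i := i) (by simpa using hi)
    rw [e] at this
    omega
  have hhw : (params n d).high + (params n d).ones ≤ n := by
    change (∑ i ∈ Finset.range n, (1 - (1 - (d i - 2)))) +
      (∑ i ∈ Finset.range n, (1 - (d i - 1))) ≤ n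
    rw [← Finset.sum_add_distrib]
    simpa using Finset.sum_le_card_nsmul (Finset.range n)
      (fun i => (1 - (1 - (d i - 2))) + (1 - (d i - 1))) 1 (fun i _ => by omega)
  have hev : Even ((params n d).excess + (params n d).ones) := by
    obtain ⟨q, hq⟩ := H.even
    exact ⟨q + (params n d).ones - n, by omega⟩
  -- A single high vertex carries all the excess. This rules out doubled tokens in that case, which
  -- `free_pos` demands since then `free = 1`.
  have hone : (params n d).high = 1 → (params n d).excess = d 0 - 2 := fun e => by
    change ∑ i ∈ Finset.range n, (d i - 2) = _
    refine Finset.sum_eq_single_of_mem 0 (by simpa using hn) fun i hi h0 => ?_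
    have := H.lt_high_iff (i := i) (by simpa using hi)
    omega
  have h1 : (params n d).ones ≤ (params n d).excess := by omega
  have h3 : (params n d).excess + 6 + (params n d).ones ≤ 2 * n := by omega
  exact Params.good_mk' (c := ∑ i ∈ Finset.range n, (d i - 2 - 1)) h1 hev h3 hc
    (by omega) (by omega) (fun e => ⟨hall e, by
      change (params n d).high = 0 at e
      rw [e] at hhigh
      omega⟩) hhw hone

/-! ### Distributing the excess -/

/-- The greedy distribution of `Q` units among `0, 1, …` with capacities `c`. -/
def greedy (c : ℕ → ℕ) (Q i : ℕ) : ℕ := min (c i) (Q - ∑ j ∈ Finset.range i, c j)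

theorem sum_greedy (c : ℕ → ℕ) (Q n : ℕ) :
    ∑ i ∈ Finset.range n, greedy c Q i = min Q (∑ i ∈ Finset.range n, c i) := by
  induction n with
  | zero => simp
  | succ n ih =>
    rw [Finset.sum_range_succ, ih, Finset.sum_range_succ, greedy]
    omega

/-- The part of the excess of vertex `i` that may be used for the tokens. -/
def capacity (n : ℕ) (d : ℕ → ℕ) (i : ℕ) : ℕ :=
  min (d i - 2 - (1 - ((params n d).free - i))) (params n d).tokens

/-- The part of the excess of vertex `i` that is used for the tokens. -/
def share (n : ℕ) (d : ℕ → ℕ) (i : ℕ) : ℕ :=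
  greedy (capacity n d) (2 * (params n d).tokens - (params n d).pend) i

/-- The part of the excess of vertex `i` that is used for the forest. -/
def forestDegree (n : ℕ) (d : ℕ → ℕ) (i : ℕ) : ℕ := d i - 2 - share n d i

theorem share_le_capacity (n : ℕ) (d : ℕ → ℕ) (i : ℕ) : share n d i ≤ capacity n d i :=
  min_le_left _ _

theorem share_le (n : ℕ) (d : ℕ → ℕ) (i : ℕ) : share n d i ≤ d i - 2 :=
  (share_le_capacity n d i).trans ((min_le_left _ _).trans (Nat.sub_le _ _))

theorem share_le_tokens (n : ℕ) (d : ℕ → ℕ) (i : ℕ) : share n d i ≤ (params n d).tokens :=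
  (share_le_capacity n d i).trans (min_le_right _ _)

/-- The demand is `2 * doubled + pend`. The delicate case is that of a cap `tokens` which is
effective: then the first vertex alone supplies `tokens`, only `doubled` more units are needed, and
`top_le` says that the other vertices have enough excess. -/
theorem Feasible.le_sum_capacity {n : ℕ} {d : ℕ → ℕ} (H : Feasible n d) :
    2 * (params n d).tokens - (params n d).pend ≤ ∑ i ∈ Finset.range n, capacity n d i := by
  have G := H.good
  have hn := H.n_pos
  have e1 := G.excess_eq
  have e2 := G.tokens_eq
  rcases Nat.eq_zero_or_pos (params n d).free with hf | hf
  · have hcap : ∀ i, capacity n d i = min (d i - 2 - 1) (params n d).tokens := fun i => by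
      simp [capacity, hf]
    have hc := excess_eq_high_add n d
    have h2 := G.free_zero hf
    by_cases h0 : d 0 - 2 - 1 ≤ (params n d).tokens
    · have : ∑ i ∈ Finset.range n, capacity n d i = ∑ i ∈ Finset.range n, (d i - 2 - 1) := by
        refine Finset.sum_congr rfl fun i hi => ?_
        have := H.anti 0 i (Nat.zero_le _) (by simpa using hi)
        rw [hcap]
        omega
      omega
    -- Vertex `0` reaches its cap. If vertex `1` does so too, the two suffice; otherwise no further
    -- cap is effective and the others offer their excess less one unit each.
    · obtain ⟨m, rfl⟩ : ∃ m, n = m + 1 := ⟨n - 1, by omega⟩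
      rw [Finset.sum_range_succ'] at hc ⊢
      have hd := G.doubled_add
      have ht := G.top_le
      have hc0 : capacity (m + 1) d 0 = (params (m + 1) d).tokens := by rw [hcap]; omega
      rw [hc0]
      suffices (params (m + 1) d).doubled ≤
          ∑ i ∈ Finset.range m, capacity (m + 1) d (i + 1) by omega
      rcases Nat.eq_zero_or_pos m with rfl | hm
      · simp only [Finset.range_zero, Finset.sum_empty] at hc ⊢
        omega
      by_cases h1 : d 1 - 2 - 1 ≤ (params (m + 1) d).tokens
      · have : ∑ i ∈ Finset.range m, capacity (m + 1) d (i + 1) =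
            ∑ i ∈ Finset.range m, (d (i + 1) - 2 - 1) := by
          refine Finset.sum_congr rfl fun i hi => ?_
          have := H.anti 1 (i + 1) (by omega) (by simpa using hi)
          rw [hcap]
          omega
        rw [this]
        omega
      · have h3 : capacity (m + 1) d 1 ≤ ∑ i ∈ Finset.range m, capacity (m + 1) d (i + 1) :=
          Finset.single_le_sum (f := fun i => capacity (m + 1) d (i + 1))
            (fun _ _ => Nat.zero_le _) (Finset.mem_range.2 hm)
        rw [hcap] at h3
        omega
  -- Here the uncapped amounts add up to `pend`, which equals `tokens`, so that no single one can
  -- exceed the cap.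
  · obtain ⟨hd, h2⟩ := G.free_pos hf
    have hsum : ∑ i ∈ Finset.range n, (d i - 2 - (1 - ((params n d).free - i))) +
        ∑ i ∈ Finset.range n, (if i ∈ Finset.Ico (params n d).free (params n d).high then 1 else 0)
          = (params n d).excess := by
      rw [← Finset.sum_add_distrib]
      refine Finset.sum_congr rfl fun i hi => ?_
      have := H.lt_high_iff (i := i) (by simpa using hi)
      simp only [Finset.mem_Ico]
      split_ifs <;> omega
    have hcard : ∑ i ∈ Finset.range n,
        (if i ∈ Finset.Ico (params n d).free (params n d).high then 1 else 0) =
          (params n d).high - (params n d).free := by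
      rw [← Finset.sum_filter, Finset.sum_const, smul_eq_mul, mul_one, Finset.filter_mem_eq_inter,
        Finset.inter_eq_right.2, Nat.card_Ico]
      intro i hi
      have := G.high_le
      have := G.core_add
      simp only [Finset.mem_Ico, Finset.mem_range] at hi ⊢
      omega
    have hle : ∀ i ∈ Finset.range n, d i - 2 - (1 - ((params n d).free - i)) ≤
        ∑ i ∈ Finset.range n, (d i - 2 - (1 - ((params n d).free - i))) := fun i hi =>
      Finset.single_le_sum (f := fun i => d i - 2 - (1 - ((params n d).free - i)))
        (fun _ _ => Nat.zero_le _) hi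
    have : ∑ i ∈ Finset.range n, capacity n d i =
        ∑ i ∈ Finset.range n, (d i - 2 - (1 - ((params n d).free - i))) := by
      refine Finset.sum_congr rfl fun i hi => ?_
      have := hle i hi
      rw [capacity]
      omega
    omega

theorem Feasible.sum_share {n : ℕ} {d : ℕ → ℕ} (H : Feasible n d) :
    ∑ i ∈ Finset.range n, share n d i = 2 * (params n d).tokens - (params n d).pend := by
  unfold share
  rw [sum_greedy, min_eq_left H.le_sum_capacity]

theorem Feasible.sum_forestDegree {n : ℕ} {d : ℕ → ℕ} (H : Feasible n d) :
    (∑ i ∈ Finset.range n, forestDegree n d i) + 2 * (params n d).doubled =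
      2 * (params n d).half := by
  have h1 : (∑ i ∈ Finset.range n, forestDegree n d i) + ∑ i ∈ Finset.range n, share n d i =
      (params n d).excess := by
    rw [← Finset.sum_add_distrib]
    refine Finset.sum_congr rfl fun i _ => ?_
    have := share_le n d i
    rw [forestDegree]
    omega
  have G := H.good
  have := G.excess_eq
  have := G.tokens_eq
  have := H.sum_share
  omega

theorem Feasible.forestDegree_eq_zero {n : ℕ} {d : ℕ → ℕ} (H : Feasible n d) {i : ℕ} (hi : i < n)
    (h : (params n d).high ≤ i) : forestDegree n d i = 0 ∧ share n d i = 0 := by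
  have := H.lt_high_iff hi
  have := share_le n d i
  rw [forestDegree]
  omega

/-- The capacity of a vertex from `free` on withholds one unit, which therefore survives for the
forest. -/
theorem Feasible.forestDegree_pos {n : ℕ} {d : ℕ → ℕ} (H : Feasible n d) {i : ℕ}
    (h1 : (params n d).free ≤ i) (h2 : i < (params n d).high) : 0 < forestDegree n d i := by
  have G := H.good
  have := G.high_le
  have := G.core_add
  have := (H.lt_high_iff (i := i) (by omega)).1 h2
  have h3 := (share_le_capacity n d i).trans (min_le_left _ _)
  rw [forestDegree]
  omega

/-- If the high vertices need not all keep a part of their excess, then the forest is a perfect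
matching of those that do. -/
theorem Feasible.forestDegree_le_one {n : ℕ} {d : ℕ → ℕ} (H : Feasible n d)
    (hf : 0 < (params n d).free) {i : ℕ} (hi : i < n) :
    forestDegree n d i = if (params n d).free ≤ i ∧ i < (params n d).high then 1 else 0 := by
  have G := H.good
  obtain ⟨hd, h2⟩ := G.free_pos hf
  have hs := H.sum_forestDegree
  have hle : ∀ i ∈ Finset.range n,
      (if (params n d).free ≤ i ∧ i < (params n d).high then 1 else 0) ≤ forestDegree n d i := by
    intro i hi
    split_ifs with h
    · exact H.forestDegree_pos h.1 h.2
    · exact Nat.zero_le _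
  have hcard : ∑ i ∈ Finset.range n,
      (if (params n d).free ≤ i ∧ i < (params n d).high then 1 else 0) =
        (params n d).high - (params n d).free := by
    simp only [← Finset.mem_Ico]
    rw [← Finset.sum_filter, Finset.sum_const, smul_eq_mul, mul_one, Finset.filter_mem_eq_inter,
      Finset.inter_eq_right.2, Nat.card_Ico]
    intro i hi
    have := G.high_le
    have := G.core_add
    simp only [Finset.mem_Ico, Finset.mem_range] at hi ⊢
    omega
  -- The lower bounds already add up to the whole degree sum `2 * half = high - free`, so each is
  -- attained.
  exact ((Finset.sum_eq_sum_iff_of_le hle).1 (by omega) i (by simpa using hi)).symm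

/-- If there are pseudo pendant vertices, then the first vertex is on half of the half-edges. -/
theorem Feasible.share_zero {n : ℕ} {d : ℕ → ℕ} (H : Feasible n d) (h : 0 < (params n d).pseudo) :
    share n d 0 = (params n d).tokens := by
  have G := H.good
  obtain ⟨h1, h2⟩ := G.pseudo_pos h
  have h3 := G.half_eq_doubled
  have h4 := G.free_zero
  have h5 := G.tokens_eq
  have : capacity n d 0 = (params n d).tokens := by
    unfold capacity
    omega
  simp only [share, greedy, this, Finset.range_zero, Finset.sum_empty]
  omega

/-! ### The degrees of the forest -/

/-- The core vertices of forest degree at least two. -/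
def bigs (n : ℕ) (d : ℕ → ℕ) : List ℕ :=
  (List.range (params n d).core).filter fun i => 2 ≤ forestDegree n d i

/-- The core vertices of forest degree one. -/
def leaves (n : ℕ) (d : ℕ → ℕ) : List ℕ :=
  (List.range (params n d).core).filter fun i => forestDegree n d i = 1

/-- The core vertices of forest degree zero. -/
def zeros (n : ℕ) (d : ℕ → ℕ) : List ℕ :=
  (List.range (params n d).core).filter fun i => forestDegree n d i = 0

/-- The number of leaves that are left out of the forest and joined to each other. -/
def skipped (n : ℕ) (d : ℕ → ℕ) : ℕ := if 2 ≤ (zeros n d).length then 0 else 2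

/-- The degree sum in terms of the three classes; with the count of the classes it shows how many
leaves there are. -/
theorem sum_map_classify (τ : ℕ → ℕ) (l : List ℕ) :
    (l.map τ).sum = ((l.filter fun i => 2 ≤ τ i).map (τ · - 2)).sum +
      2 * (l.filter fun i => 2 ≤ τ i).length + (l.filter fun i => τ i = 1).length := by
  induction l with
  | nil => rfl
  | cons a l ih =>
    rcases (by omega : τ a = 0 ∨ τ a = 1 ∨ 2 ≤ τ a) with h | h | h
    · simp [h, ih]
    · simp [h, ih]; omega
    · have h1 : τ a ≠ 1 := by omega
      simp only [List.map_cons, List.sum_cons, ih, h, decide_true, List.filter_cons_of_pos,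
        List.length_cons, h1, decide_false, Bool.false_eq_true, not_false_eq_true,
        List.filter_cons_of_neg]
      omega

theorem length_classify (τ : ℕ → ℕ) (l : List ℕ) :
    l.length = (l.filter fun i => 2 ≤ τ i).length + (l.filter fun i => τ i = 1).length +
      (l.filter fun i => τ i = 0).length := by
  induction l with
  | nil => rfl
  | cons a l ih =>
    rcases (by omega : τ a = 0 ∨ τ a = 1 ∨ 2 ≤ τ a) with h | h | h
    · simp [h]; omega
    · simp [h]; omega
    · have h1 : τ a ≠ 1 := by omega
      have h0 : τ a ≠ 0 := by omega
      simp [h, h1, h0]; omega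

theorem length_filter_le_range (a m : ℕ) :
    ((List.range m).filter fun i => a ≤ i).length = m - a := by
  induction m with
  | zero => simp
  | succ m ih =>
    rw [List.range_succ, List.filter_append, List.length_append, ih]
    by_cases h : a ≤ m
    · simp [h]; omega
    · simp [h]; omega

theorem Feasible.sum_range_core {n : ℕ} {d : ℕ → ℕ} (H : Feasible n d) {φ : ℕ → ℕ}
    (hφ : ∀ i < n, (params n d).high ≤ i → φ i = 0) :
    ∑ i ∈ Finset.range (params n d).core, φ i = ∑ i ∈ Finset.range n, φ i := by
  have G := H.good
  have h1 := G.high_le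
  have h2 := G.core_add
  refine Finset.sum_subset (Finset.range_subset_range.2 (by omega)) fun i hi hi' => ?_
  simp only [Finset.mem_range] at hi hi'
  exact hφ i hi (by omega)

theorem Feasible.length_zeros {n : ℕ} {d : ℕ → ℕ} (H : Feasible n d)
    (hf : (params n d).free = 0) :
    (zeros n d).length = (params n d).core - (params n d).high := by
  have G := H.good
  rw [← length_filter_le_range, zeros]
  congr 1
  refine List.filter_congr fun i hi => ?_
  have hi' : i < n := by
    have := G.core_add
    simp only [List.mem_range] at hi
    omega
  by_cases h : (params n d).high ≤ i
  · simp [h, (H.forestDegree_eq_zero hi' h).1]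
  · have := H.forestDegree_pos (i := i) (by omega) (by omega)
    simp [h]
    omega

/-- The second page is thus free of token edges whenever it has to carry the edge between the
separating leaves. -/
theorem Feasible.doubled_eq_zero {n : ℕ} {d : ℕ → ℕ} (H : Feasible n d)
    (hz : (zeros n d).length < 2) : (params n d).doubled = 0 := by
  rcases Nat.eq_zero_or_pos (params n d).free with hf | hf
  · have := H.length_zeros hf
    exact (H.good.few (by omega)).1
  · exact (H.good.free_pos hf).1

/-- The degrees left for the forest are those of a forest without isolated vertices. -/
theorem Feasible.forest_balance {n : ℕ} {d : ℕ → ℕ} (H : Feasible n d) :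
    (∃ x, (if bigs n d = [] then 0 else 2) +
      ((bigs n d).map (forestDegree n d · - 2)).sum + 2 * x =
        ((leaves n d).drop (skipped n d)).length) ∧
    ((zeros n d).length < 2 → 4 ≤ (leaves n d).length) := by
  have G := H.good
  have hlen := length_classify (forestDegree n d) (List.range (params n d).core)
  have hsum := sum_map_classify (forestDegree n d) (List.range (params n d).core)
  have hs : ((List.range (params n d).core).map (forestDegree n d)).sum +
      2 * (params n d).doubled = 2 * (params n d).half := by
    rw [← H.sum_forestDegree, ← H.sum_range_core (fun i hi h => (H.forestDegree_eq_zero hi h).1)]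
    rfl
  have hzero := H.length_zeros
  have hbig : 0 < (params n d).free → bigs n d = [] := fun hf => by
    refine List.filter_eq_nil_iff.2 fun i hi => ?_
    have hi' : i < n := by
      have := G.core_add
      simp only [List.mem_range] at hi
      omega
    rw [H.forestDegree_le_one hf hi']
    split_ifs <;> simp
  rw [List.length_range] at hlen
  change _ = (bigs n d).length + (leaves n d).length + (zeros n d).length at hlen
  change _ = ((bigs n d).map (forestDegree n d · - 2)).sum + 2 * (bigs n d).length +
    (leaves n d).length at hsum
  rw [List.length_drop]
  have g1 := G.half_le
  have g2 := G.half_eq_doubled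
  have g3 := G.few
  have g4 := G.doubled_le
  have g5 := G.high_le
  have g6 := G.free_pos
  -- There are no doubled tokens here, so counting vertices against the degree sum `2 * half` gives
  -- at least `2 * (core - zeros - half)` leaves, and `half + 3 ≤ core` makes this at least `6 - 2 *
  -- zeros`.
  have key : (zeros n d).length < 2 → 4 ≤ (leaves n d).length := by
    intro hz
    rcases Nat.eq_zero_or_pos (params n d).free with hf | hf
    · have := hzero hf
      omega
    · have := hbig hf
      simp only [this, List.map_nil, List.sum_nil, List.length_nil] at hsum hlen
      omega
  refine ⟨?_, key⟩
  by_cases hb : bigs n d = []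
  · rw [if_pos hb]
    simp only [hb, List.map_nil, List.sum_nil, List.length_nil] at hsum hlen ⊢
    unfold skipped
    split_ifs with hz
    -- The witness is the number of components that are single edges: without big vertices it is the
    -- number of all forest edges.
    · exact ⟨(params n d).half - (params n d).doubled, by omega⟩
    · have := key (by omega)
      exact ⟨(params n d).half - (params n d).doubled - 1, by omega⟩
  · rw [if_neg hb]
    have hf : (params n d).free = 0 := by
      by_contra hf
      exact hb (hbig (by omega))
    have hz' := hzero hf
    have hpos : 0 < (bigs n d).length := List.length_pos_iff.2 hb
    unfold skipped
    split_ifs with hz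
    -- A forest with `high` vertices and `half - doubled` edges has this many components besides the
    -- caterpillar that contains all big vertices. In the next case one more edge is given up with
    -- the two skipped leaves.
    · exact ⟨(params n d).high - 1 - ((params n d).half - (params n d).doubled), by omega⟩
    · have := key (by omega)
      exact ⟨(params n d).high - 1 - ((params n d).half - (params n d).doubled) - 1, by omega⟩

/-! ### Building the forest -/

/-- The number of children of `a` among the first `T` vertices, if `par` gives the parents. -/
def childCount (par : ℕ → ℕ) (T a : ℕ) : ℕ :=
  ∑ t ∈ Finset.range T, if par t = a ∧ t ≠ a then 1 else 0

/-- The first `T` vertices `ch 0, ch 1, …` of a caterpillar forest with degrees `τ` on the vertices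
in the list `A`. Vertex `ch t` is drawn on the side `sd t` and is a root if `par t = t`, otherwise a
child of `ch (par t)`. The vertex `ch p` has `ρ` children to come and lies on the side `side`. The
vertices of degree at least two that are still to come are in `rb`, those of degree one in `rl`. -/
structure ForestState (τ : ℕ → ℕ) (A : List ℕ) (T ρ side p : ℕ) (rb rl : List ℕ)
    (ch sd par : ℕ → ℕ) : Prop where
  perm : ((List.range T).map ch ++ (rb ++ rl)).Perm A
  big : ∀ v ∈ rb, 2 ≤ τ v
  leaf : ∀ v ∈ rl, τ v = 1
  balance : ∃ x, (if ρ = 0 ∧ rb ≠ [] then 2 else ρ) + (rb.map (τ · - 2)).sum + 2 * x = rl.length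
  side_lt : side < 2
  sd_lt : ∀ t < T, sd t < 2
  par_le : ∀ t < T, par t ≤ t
  sd_ne : ∀ t < T, par t ≠ t → sd (par t) ≠ sd t
  mono : ∀ t t', t < t' → t' < T → par t ≠ t → par t' ≠ t' → par t' = par t ∨ t ≤ par t'
  cur : ρ ≠ 0 → p < T ∧ sd p = side ∧ ∀ t < T, par t ≠ t → par t = p ∨ t ≤ p
  deg : ∀ a < T, childCount par T a + (if par a = a then 0 else 1) + (if a = p then ρ else 0) =
    τ (ch a)

theorem childCount_eq_zero {par : ℕ → ℕ} {T a : ℕ} (h : ∀ t < T, par t ≤ t) (ha : T ≤ a) :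
    childCount par T a = 0 := by
  refine Finset.sum_eq_zero fun t ht => if_neg fun h' => ?_
  have := h t (by simpa using ht)
  simp only [Finset.mem_range] at ht
  omega

theorem childCount_succ {par par' : ℕ → ℕ} {T q a : ℕ}
    (hpar : ∀ t, par' t = if t = T then q else par t) :
    childCount par' (T + 1) a = childCount par T a + if q = a ∧ T ≠ a then 1 else 0 := by
  unfold childCount
  rw [Finset.sum_range_succ, hpar T, if_pos rfl]
  congr 1
  refine Finset.sum_congr rfl fun t ht => ?_
  have hne : t ≠ T := (Finset.mem_range.1 ht).ne
  simp only [hpar t, if_neg hne]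

theorem map_range_succ_of_update {ch ch' : ℕ → ℕ} {T v : ℕ}
    (hch : ∀ t, ch' t = if t = T then v else ch t) :
    (List.range (T + 1)).map ch' = (List.range T).map ch ++ [v] := by
  rw [List.range_succ, List.map_append, List.map_singleton, hch T, if_pos rfl]
  congr 1
  refine List.map_congr_left fun t ht => ?_
  rw [hch t, if_neg (by simp only [List.mem_range] at ht; omega)]

namespace ForestState

variable {τ : ℕ → ℕ} {A : List ℕ} {T side p v : ℕ} {rb rl : List ℕ} {ch sd par ch' sd' par' : ℕ → ℕ}

/-- A new root. -/
theorem root {rb' rl' : List ℕ} (h : ForestState τ A T 0 side p rb rl ch sd par)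
    (hperm : (v :: (rb' ++ rl')).Perm (rb ++ rl)) (hb : ∀ x ∈ rb', x ∈ rb) (hl : ∀ x ∈ rl', x ∈ rl)
    (hbal : ∃ x, τ v + (rb'.map (τ · - 2)).sum + 2 * x = rl'.length) (hv : 0 < τ v)
    (hch : ∀ t, ch' t = if t = T then v else ch t)
    (hsd : ∀ t, sd' t = if t = T then side else sd t)
    (hpar : ∀ t, par' t = if t = T then T else par t) :
    ForestState τ A (T + 1) (τ v) side T rb' rl' ch' sd' par' where
  perm := by
    rw [map_range_succ_of_update hch, List.append_assoc]
    exact (List.Perm.append_left _ hperm).trans h.perm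
  big x hx := h.big x (hb x hx)
  leaf x hx := h.leaf x (hl x hx)
  balance := by
    obtain ⟨x, hx⟩ := hbal
    exact ⟨x, by rw [if_neg (by omega)]; exact hx⟩
  side_lt := h.side_lt
  sd_lt t ht := by
    have := h.side_lt
    have := h.sd_lt t
    rw [hsd]
    split_ifs <;> omega
  par_le t ht := by
    have := h.par_le t
    rw [hpar]
    split_ifs <;> omega
  sd_ne t ht hne := by
    have h1 := h.sd_ne t
    have h2 := h.par_le t
    rw [hpar] at hne
    rw [hpar, hsd, hsd]
    split_ifs at * <;> omega
  mono t t' h1 h2 h3 h4 := by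
    have := h.mono t t' h1
    rw [hpar] at h3 h4
    rw [hpar, hpar]
    split_ifs at * <;> omega
  cur _ := by
    refine ⟨by omega, by rw [hsd, if_pos rfl], fun t ht _ => .inr (by omega)⟩
  deg a ha := by
    rw [childCount_succ hpar, hpar, hch]
    by_cases haT : a = T
    · subst haT
      simp [childCount_eq_zero h.par_le le_rfl]
    · have := h.deg a (by omega)
      simp only [ite_self, add_zero] at this
      rw [if_neg (by omega), if_neg haT, if_neg haT, if_neg haT]
      omega

/-- The last child of `ch p`, which becomes the new vertex with children to come. -/
theorem bigChild (h : ForestState τ A T 1 side p (v :: rb) rl ch sd par)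
    (hch : ∀ t, ch' t = if t = T then v else ch t)
    (hsd : ∀ t, sd' t = if t = T then 1 - side else sd t)
    (hpar : ∀ t, par' t = if t = T then p else par t) :
    ForestState τ A (T + 1) (τ v - 1) (1 - side) T rb rl ch' sd' par' := by
  obtain ⟨hp, hps, hcur⟩ := h.cur (by omega)
  have hv := h.big v (by simp)
  have hs := h.side_lt
  constructor
  · rw [map_range_succ_of_update hch, List.append_assoc]
    exact h.perm
  · exact fun x hx => h.big x (by simp [hx])
  · exact h.leaf
  -- One edge of the new vertex goes to its parent, so the pending child of `ch p` is replaced by `τ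
  -- v - 1 = 1 + (τ v - 2)` children, and the sum over `rb` loses `τ v - 2`.
  · obtain ⟨x, hx⟩ := h.balance
    rw [if_neg (by omega)] at hx
    simp only [List.map_cons, List.sum_cons] at hx
    exact ⟨x, by rw [if_neg (by omega)]; omega⟩
  · omega
  · intro t ht
    have := h.sd_lt t
    rw [hsd]
    split_ifs <;> omega
  · intro t ht
    have := h.par_le t
    rw [hpar]
    split_ifs <;> omega
  · intro t ht hne
    have h1 := h.sd_ne t
    have h2 := h.par_le t
    rw [hpar] at hne
    rw [hpar, hsd, hsd]
    split_ifs at * <;> omega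
  · intro t t' h1 h2 h3 h4
    have h5 := h.mono t t' h1
    have h6 := hcur t
    rw [hpar] at h3 h4
    rw [hpar, hpar]
    split_ifs at * <;> omega
  · intro _
    exact ⟨by omega, by rw [hsd, if_pos rfl], fun t ht _ => .inr (by omega)⟩
  · intro a ha
    rw [childCount_succ hpar, hpar, hch]
    by_cases haT : a = T
    · subst haT
      rw [childCount_eq_zero h.par_le le_rfl]
      simp only [if_true, ne_eq, not_true_eq_false, and_false, if_false, if_neg hp.ne]
      omega
    · have := h.deg a (by omega)
      rw [if_neg haT, if_neg haT, if_neg haT]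
      split_ifs at * <;> omega

/-- A child of `ch p` that is a leaf. -/
theorem leafChild {ρ : ℕ} (h : ForestState τ A T (ρ + 1) side p rb (v :: rl) ch sd par)
    (hρ : ρ = 0 → rb = [])
    (hch : ∀ t, ch' t = if t = T then v else ch t)
    (hsd : ∀ t, sd' t = if t = T then 1 - side else sd t)
    (hpar : ∀ t, par' t = if t = T then p else par t) :
    ForestState τ A (T + 1) ρ side p rb rl ch' sd' par' := by
  obtain ⟨hp, hps, hcur⟩ := h.cur (by omega)
  have hv := h.leaf v (by simp)
  have hs := h.side_lt
  constructor
  · rw [map_range_succ_of_update hch, List.append_assoc]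
    exact (List.Perm.append_left _ (List.perm_middle (l₁ := rb) (a := v)).symm).trans h.perm
  · exact h.big
  · exact fun x hx => h.leaf x (by simp [hx])
  -- `hρ` keeps the last child for a big vertex as long as there is one. Otherwise a component would
  -- be closed too early, and the next big root would need two leaves that the balance does not
  -- provide for.
  · obtain ⟨x, hx⟩ := h.balance
    rw [if_neg (by omega)] at hx
    simp only [List.length_cons] at hx
    exact ⟨x, by rw [if_neg (fun h' => h'.2 (hρ h'.1))]; omega⟩
  · exact hs
  · intro t ht
    have := h.sd_lt t
    rw [hsd]
    split_ifs <;> omega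
  · intro t ht
    have := h.par_le t
    rw [hpar]
    split_ifs <;> omega
  · intro t ht hne
    have h1 := h.sd_ne t
    have h2 := h.par_le t
    rw [hpar] at hne
    rw [hpar, hsd, hsd]
    split_ifs at * <;> omega
  · intro t t' h1 h2 h3 h4
    have h5 := h.mono t t' h1
    have h6 := hcur t
    rw [hpar] at h3 h4
    rw [hpar, hpar]
    split_ifs at * <;> omega
  · intro h0
    refine ⟨by omega, by rw [hsd, if_neg hp.ne]; exact hps, fun t ht hne => ?_⟩
    rw [hpar] at hne ⊢
    have := hcur t
    split_ifs at * <;> omega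
  · intro a ha
    rw [childCount_succ hpar, hpar, hch]
    by_cases haT : a = T
    · subst haT
      rw [childCount_eq_zero h.par_le le_rfl]
      simp only [if_true, ne_eq, not_true_eq_false, and_false, if_false, if_neg hp.ne,
        if_neg hp.ne']
      omega
    · have := h.deg a (by omega)
      rw [if_neg haT, if_neg haT]
      split_ifs at * <;> omega

end ForestState

/-- A caterpillar forest, drawn with its vertices on two sides. -/
structure IsForest (τ : ℕ → ℕ) (A : List ℕ) (ch sd par : ℕ → ℕ) : Prop where
  perm : ((List.range A.length).map ch).Perm A
  sd_lt : ∀ t < A.length, sd t < 2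
  par_le : ∀ t < A.length, par t ≤ t
  sd_ne : ∀ t < A.length, par t ≠ t → sd (par t) ≠ sd t
  mono : ∀ t t', t < t' → t' < A.length → par t ≠ t → par t' ≠ t' → par t' = par t ∨ t ≤ par t'
  deg : ∀ a < A.length,
    childCount par A.length a + (if par a = a then 0 else 1) = τ (ch a)

/-- Once all vertices are placed both waiting lists are empty, and the balance then forces that no
child is missing. -/
theorem ForestState.isForest {τ : ℕ → ℕ} {A : List ℕ} {ρ side p : ℕ} {rb rl : List ℕ}
    {ch sd par : ℕ → ℕ} (h : ForestState τ A A.length ρ side p rb rl ch sd par) :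
    IsForest τ A ch sd par := by
  have hl := h.perm.length_eq
  simp only [List.length_append, List.length_map, List.length_range] at hl
  have hb : rb = [] := List.length_eq_zero_iff.1 (by omega)
  have hr : rl = [] := List.length_eq_zero_iff.1 (by omega)
  subst hb hr
  obtain ⟨x, hx⟩ := h.balance
  simp only [ne_eq, not_true_eq_false, and_false, if_false, List.map_nil, List.sum_nil,
    List.length_nil] at hx
  have hρ : ρ = 0 := by omega
  subst hρ
  exact ⟨by simpa using h.perm, h.sd_lt, h.par_le, h.sd_ne, h.mono, fun a ha => by
    simpa using h.deg a ha⟩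

/-! ### The tokens

The vertices outside the core are tokens. Each core vertex has a block of consecutive half-edges, the
last block belongs to no core vertex, and the tokens join the half-edges in pairs, without
crossings and without joining two half-edges of the same block. -/

/-- The first half-edge at token `s`: there are `2 * K` half-edges, and those from `a` to
`a + m - 1` form the block in the middle. -/
def tokenLow (K a m s : ℕ) : ℕ :=
  if s + m < K then s else if s + a + m < 2 * K then 2 * a + 2 * m + s - 2 * K else s + a - K

/-- The second half-edge at token `s`. -/
def tokenHigh (K a m s : ℕ) : ℕ :=
  if s + a + m < 2 * K then 2 * K - 1 - s else a + K - 1 - s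

/-- The middle block cuts the half-edges into segments of lengths `a`, `m` and `2 * K - a - m`, none
longer than `K`. The two branch conditions separate `K - m` pairs left–right, `K - a` pairs
middle–right and `a + m - K` pairs left–middle, in this order of `s`. In each family the first
half-edges form an interval, and these intervals are disjoint. -/
theorem tokenLow_inj {K a m s s' : ℕ} (h1 : a < K) (h2 : K ≤ a + m) (h3 : m ≤ K) (hs : s < K)
    (hs' : s' < K) (h : tokenLow K a m s = tokenLow K a m s') : s = s' := by
  unfold tokenLow at h
  split_ifs at h <;> omega

theorem tokenHigh_inj {K a m s s' : ℕ} (h1 : a < K) (h2 : K ≤ a + m) (h3 : m ≤ K) (hs : s < K)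
    (hs' : s' < K) (h : tokenHigh K a m s = tokenHigh K a m s') : s = s' := by
  unfold tokenHigh at h
  split_ifs at h <;> omega

theorem tokenLow_ne_tokenHigh {K a m s s' : ℕ} (h1 : a < K) (h2 : K ≤ a + m) (h3 : m ≤ K)
    (hs : s < K) (hs' : s' < K) : tokenLow K a m s ≠ tokenHigh K a m s' := by
  unfold tokenLow tokenHigh
  split_ifs <;> omega

theorem tokenHigh_lt {K a m s : ℕ} (h1 : a < K) (hs : s < K) :
    tokenHigh K a m s < 2 * K := by
  unfold tokenHigh
  split_ifs <;> omega

/-- The two half-edges of a token lie on different sides of one end of the middle block. -/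
theorem token_separated {K a m s : ℕ} (h1 : a < K) (h2 : K ≤ a + m) (h3 : m ≤ K) (hs : s < K) :
    (tokenLow K a m s < a ∧ a ≤ tokenHigh K a m s) ∨
      (tokenLow K a m s < a + m ∧ a + m ≤ tokenHigh K a m s) := by
  unfold tokenLow tokenHigh
  split_ifs <;> omega

/-- Each of the three families is nested. The left–right pairs enclose the other two families, which
lie side by side. -/
theorem token_nonCrossing {K a m s s' : ℕ} (h1 : a < K) (h2 : K ≤ a + m) (h3 : m ≤ K)
    (hs : s < K) (hs' : s' < K) (l1 : tokenLow K a m s < tokenLow K a m s')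
    (l2 : tokenLow K a m s' < tokenHigh K a m s) : tokenHigh K a m s' < tokenHigh K a m s := by
  unfold tokenLow tokenHigh at *
  split_ifs at * <;> omega

/-- Exactly the first `c` tokens have their second half-edge among the last `c`. -/
theorem tokenHigh_ge_iff {K a m s c : ℕ} (h1 : a < K) (h2 : K ≤ a + m) (hc : a + m + c ≤ 2 * K)
    (hs : s < K) : 2 * K - c ≤ tokenHigh K a m s ↔ s < c := by
  unfold tokenHigh
  split_ifs <;> omega

/-- If the block in the middle has the greatest possible length, then the first half-edges of the
first `c` tokens are consecutive. -/
theorem tokenLow_succ {K a s c : ℕ} (hc : a + K + c ≤ 2 * K) (hs : s + 1 < c) :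
    tokenLow K a K (s + 1) = tokenLow K a K s + 1 := by
  unfold tokenLow
  split_ifs <;> omega

/-- The `K` first and `K` second half-edges are all distinct and lie below `2 * K`, so they exhaust
this range. -/
theorem sum_tokens {K a m : ℕ} (h1 : a < K) (h2 : K ≤ a + m) (h3 : m ≤ K) (φ : ℕ → ℕ) :
    ∑ s ∈ Finset.range K, (φ (tokenLow K a m s) + φ (tokenHigh K a m s)) =
      ∑ j ∈ Finset.range (2 * K), φ j := by
  have hl : Set.InjOn (tokenLow K a m) (Finset.range K) := fun s hs s' hs' h =>
    tokenLow_inj h1 h2 h3 (by simpa using hs) (by simpa using hs') h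
  have hh : Set.InjOn (tokenHigh K a m) (Finset.range K) := fun s hs s' hs' h =>
    tokenHigh_inj h1 h2 h3 (by simpa using hs) (by simpa using hs') h
  have hdis : Disjoint ((Finset.range K).image (tokenLow K a m))
      ((Finset.range K).image (tokenHigh K a m)) := by
    rw [Finset.disjoint_left]
    intro x hx hx'
    simp only [Finset.mem_image, Finset.mem_range] at hx hx'
    obtain ⟨s, hs, rfl⟩ := hx
    obtain ⟨s', hs', h⟩ := hx'
    exact tokenLow_ne_tokenHigh h1 h2 h3 hs hs' h.symm
  rw [Finset.sum_add_distrib, ← Finset.sum_image hl, ← Finset.sum_image hh,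
    ← Finset.sum_union hdis]
  refine Finset.sum_congr (Finset.eq_of_subset_of_card_le ?_ ?_) fun _ _ => rfl
  · intro x hx
    simp only [Finset.mem_union, Finset.mem_image, Finset.mem_range] at hx ⊢
    rcases hx with ⟨s, hs, rfl⟩ | ⟨s, hs, rfl⟩
    · have h4 := tokenHigh_lt (m := m) h1 hs
      have := token_separated h1 h2 h3 hs
      omega
    · exact tokenHigh_lt h1 hs
  · rw [Finset.card_union_of_disjoint hdis, Finset.card_image_of_injOn hl,
      Finset.card_image_of_injOn hh]
    simp
    omega

/-- The block of the half-edge `j`, if block `k` of the `M` blocks ends before `E (k + 1)`. -/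
def owner (M : ℕ) (E : ℕ → ℕ) (j : ℕ) : ℕ := ∑ k ∈ Finset.range M, (1 - (E (k + 1) - j))

theorem owner_le (M : ℕ) (E : ℕ → ℕ) (j : ℕ) : owner M E j ≤ M := by
  unfold owner
  simpa using Finset.sum_le_card_nsmul (Finset.range M) (fun k => 1 - (E (k + 1) - j)) 1
    (fun k _ => by omega)

theorem lt_owner_iff {M : ℕ} {E : ℕ → ℕ} (hE : ∀ k < M, E k ≤ E (k + 1)) {j k : ℕ} (hk : k < M) :
    k < owner M E j ↔ E (k + 1) ≤ j := by
  have hmono : ∀ k l, k ≤ l → l < M → E (k + 1) ≤ E (l + 1) := by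
    intro k l hkl
    induction l, hkl using Nat.le_induction with
    | base => intro _; exact le_rfl
    | succ l _ ih => intro hl; exact (ih (by omega)).trans (hE _ hl)
  -- The summand is the indicator of `E (k + 1) ≤ j`, that is, of `0 < j + 1 - E (k + 1)`, which is
  -- nonincreasing in `k`.
  have := lt_sum_iff (n := M) (d := fun k => j + 1 - E (k + 1))
    (fun k l hkl hl => by have := hmono k l hkl hl; omega) 0 k hk
  have heq : owner M E j = ∑ k ∈ Finset.range M, (1 - (1 - (j + 1 - E (k + 1) - 0))) :=
    Finset.sum_congr rfl fun k _ => by omega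
  rw [heq, this]
  omega

/-- Block `k` of the `M` blocks starts at `E k`, and the half-edges of the last one are those from
`E M`. -/
structure Blocks (M : ℕ) (E : ℕ → ℕ) : Prop where
  zero : E 0 = 0
  step : ∀ k < M, E k ≤ E (k + 1)

theorem Blocks.mono {M : ℕ} {E : ℕ → ℕ} (B : Blocks M E) {k l : ℕ} (hkl : k ≤ l) :
    l ≤ M → E k ≤ E l := by
  induction l, hkl using Nat.le_induction with
  | base => intro _; exact le_rfl
  | succ l _ ih => intro hl; exact (ih (by omega)).trans (B.step _ hl)

/-- Together with `owner_lt` this is a Galois connection: for `k ≤ M`, block `k` has been reached by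
`j` exactly if `E k ≤ j`. -/
theorem Blocks.le_owner {M : ℕ} {E : ℕ → ℕ} (B : Blocks M E) {j k : ℕ} (hk : k ≤ M)
    (h : E k ≤ j) : k ≤ owner M E j := by
  rcases Nat.eq_zero_or_pos k with rfl | h0
  · exact Nat.zero_le _
  · have := (lt_owner_iff B.step (j := j) (k := k - 1) (by omega)).2
      (by rwa [Nat.sub_add_cancel h0])
    omega

theorem Blocks.owner_lt {M : ℕ} {E : ℕ → ℕ} (B : Blocks M E) {j k : ℕ} (hk : k ≤ M)
    (h : j < E k) : owner M E j < k := by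
  rcases Nat.eq_zero_or_pos k with rfl | h0
  · rw [B.zero] at h
    omega
  · have := (lt_owner_iff B.step (j := j) (k := k - 1) (by omega)).not.2
      (by rw [Nat.sub_add_cancel h0]; omega)
    omega

theorem Blocks.start_le {M : ℕ} {E : ℕ → ℕ} (B : Blocks M E) (j : ℕ) : E (owner M E j) ≤ j := by
  by_contra h
  have := B.owner_lt (owner_le M E j) (not_le.1 h)
  omega

theorem Blocks.lt_next {M : ℕ} {E : ℕ → ℕ} (B : Blocks M E) {j : ℕ} (h : owner M E j < M) :
    j < E (owner M E j + 1) := by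
  by_contra h'
  have := B.le_owner (j := j) h (not_lt.1 h')
  omega

theorem Blocks.owner_mono {M : ℕ} {E : ℕ → ℕ} (B : Blocks M E) {i j : ℕ} (h : i ≤ j) :
    owner M E i ≤ owner M E j :=
  B.le_owner (owner_le M E i) ((B.start_le i).trans h)

theorem Blocks.sum_owner {M : ℕ} {E : ℕ → ℕ} (B : Blocks M E) {k N : ℕ} (hk : k < M)
    (hN : E M ≤ N) :
    ∑ j ∈ Finset.range N, (if owner M E j = k then 1 else 0) = E (k + 1) - E k := by
  have : ∀ j, owner M E j = k ↔ j ∈ Finset.Ico (E k) (E (k + 1)) := fun j => by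
    rw [Finset.mem_Ico]
    constructor
    · rintro rfl
      exact ⟨B.start_le j, B.lt_next hk⟩
    · rintro ⟨h1, h2⟩
      have := B.le_owner hk.le h1
      have := B.owner_lt hk h2
      omega
  simp only [this]
  rw [← Finset.sum_filter, Finset.sum_const, smul_eq_mul, mul_one, Finset.filter_mem_eq_inter,
    Finset.inter_eq_right.2, Nat.card_Ico]
  intro j hj
  have := B.mono (k := k + 1) (l := M) hk le_rfl
  simp only [Finset.mem_Ico, Finset.mem_range] at hj ⊢
  omega

/-- The data of the tokens: the blocks are not longer than half of the half-edges, and the last block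
contains `c` half-edges. -/
structure TokenData (M K c : ℕ) (E : ℕ → ℕ) : Prop extends Blocks M E where
  pend_le : c ≤ K
  total : E M + c = 2 * K
  block_le : ∀ k < M, E (k + 1) ≤ E k + K

/-- The start of the block in the middle. -/
def midStart (M K : ℕ) (E : ℕ → ℕ) : ℕ := E (owner M E (K - 1))

/-- The length of the block in the middle. -/
def midLength (M K : ℕ) (E : ℕ → ℕ) : ℕ :=
  E (owner M E (K - 1) + 1) - E (owner M E (K - 1))

namespace TokenData

variable {M K c s s' : ℕ} {E : ℕ → ℕ}

theorem mid_lt (B : TokenData M K c E) (hK : 0 < K) : owner M E (K - 1) < M := by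
  have := B.pend_le
  have := B.total
  exact B.owner_lt le_rfl (by omega)

/-- The middle block is the one that contains half-edge `K - 1`. It belongs to a core vertex because
the last block, of at most `K` half-edges, starts only at `K` or later. -/
theorem mid (B : TokenData M K c E) (hK : 0 < K) :
    midStart M K E < K ∧ K ≤ midStart M K E + midLength M K E ∧ midLength M K E ≤ K ∧
      midStart M K E + midLength M K E + c ≤ 2 * K := by
  have h0 := B.mid_lt hK
  have h1 := B.start_le (K - 1)
  have h2 := B.lt_next h0
  have h3 := B.block_le _ h0
  have h4 := B.mono (k := owner M E (K - 1) + 1) (l := M) h0 le_rfl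
  have := B.total
  unfold midStart midLength
  omega

/-- An end of the middle block lies between the two half-edges. So no doubled token is joined twice
to the same core vertex. -/
theorem owner_low_lt (B : TokenData M K c E) (hs : s < K) :
    owner M E (tokenLow K (midStart M K E) (midLength M K E) s) <
      owner M E (tokenHigh K (midStart M K E) (midLength M K E) s) := by
  have hK : 0 < K := by omega
  obtain ⟨h1, h2, h3, -⟩ := B.mid hK
  have h0 := B.mid_lt hK
  have h5 := B.step _ h0
  rcases token_separated h1 h2 h3 hs with ⟨h, h'⟩ | ⟨h, h'⟩
  · exact (B.owner_lt h0.le h).trans_le (B.le_owner h0.le h')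
  · have : midStart M K E + midLength M K E = E (owner M E (K - 1) + 1) := by
      unfold midStart midLength
      omega
    rw [this] at h h'
    exact (B.owner_lt h0 h).trans_le (B.le_owner h0 h')

/-- The pendant tokens are those whose second half-edge is a dummy; the pairing puts them first. -/
theorem owner_high_eq_iff (B : TokenData M K c E) (hs : s < K) :
    owner M E (tokenHigh K (midStart M K E) (midLength M K E) s) = M ↔ s < c := by
  have hK : 0 < K := by omega
  obtain ⟨h1, h2, h3, h4⟩ := B.mid hK
  have h5 := B.total
  rw [← tokenHigh_ge_iff h1 h2 h4 hs, show 2 * K - c = E M by omega]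
  constructor
  · intro h
    have := B.start_le (tokenHigh K (midStart M K E) (midLength M K E) s)
    rwa [h] at this
  · intro h
    exact le_antisymm (owner_le _ _ _) (B.le_owner le_rfl h)

end TokenData

/-! ### The order of the core vertices -/

/-- The vertices of the forest. -/
def forestVertices (n : ℕ) (d : ℕ → ℕ) : List ℕ := bigs n d ++ (leaves n d).drop (skipped n d)

/-- The list whose first two entries separate the two sides of the forest. -/
def sepList (n : ℕ) (d : ℕ → ℕ) : List ℕ :=
  if 2 ≤ (zeros n d).length then zeros n d else leaves n d

/-- The vertex on the cycle before the first side of the forest. -/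
def sepFirst (n : ℕ) (d : ℕ → ℕ) : ℕ := (sepList n d).getD 0 0

/-- A vertex on the cycle between the two sides of the forest. -/
def sepSecond (n : ℕ) (d : ℕ → ℕ) : ℕ := (sepList n d).getD 1 0

/-- The edge between the separating vertices, if they are leaves. -/
def sepEdges (n : ℕ) (d : ℕ → ℕ) : List (ℕ × ℕ) :=
  if 2 ≤ (zeros n d).length then [] else [(sepFirst n d, sepSecond n d)]

/-- The edges of the forest, from the first side to the second. -/
def forestEdges (ch sd par : ℕ → ℕ) (T : ℕ) : List (ℕ × ℕ) :=
  ((List.range T).filter fun t => par t ≠ t).map fun t =>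
    if sd t = 0 then (ch t, ch (par t)) else (ch (par t), ch t)

theorem mem_forestVertices {n : ℕ} {d : ℕ → ℕ} {v : ℕ} (h : v ∈ forestVertices n d) :
    v < (params n d).core ∧ forestDegree n d v ≠ 0 := by
  rcases List.mem_append.1 h with h | h
  · simp only [bigs, List.mem_filter, List.mem_range, decide_eq_true_eq] at h
    omega
  · have h := List.mem_of_mem_drop h
    simp only [leaves, List.mem_filter, List.mem_range, decide_eq_true_eq] at h
    omega

theorem nodup_leaves (n : ℕ) (d : ℕ → ℕ) : (leaves n d).Nodup := List.nodup_range.filter _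

theorem nodup_forestVertices (n : ℕ) (d : ℕ → ℕ) : (forestVertices n d).Nodup := by
  refine List.nodup_append'.2 ⟨List.nodup_range.filter _, (nodup_leaves n d).drop, ?_⟩
  intro v h1 h2
  have h2 := List.mem_of_mem_drop h2
  simp only [bigs, leaves, List.mem_filter, List.mem_range, decide_eq_true_eq] at h1 h2
  omega

theorem length_forestVertices_le (n : ℕ) (d : ℕ → ℕ) :
    (forestVertices n d).length ≤ (params n d).core := by
  have := (List.subperm_of_subset (nodup_forestVertices n d)
    (l₂ := List.range (params n d).core) fun v hv => by
      simpa using (mem_forestVertices hv).1).length_le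
  simpa using this

/-- What we need to know about the separating vertices. -/
theorem Feasible.sep_spec {n : ℕ} {d : ℕ → ℕ} (H : Feasible n d) :
    (sepFirst n d < (params n d).core ∧ sepSecond n d < (params n d).core) ∧
    sepFirst n d ≠ sepSecond n d ∧
    (sepFirst n d ∉ forestVertices n d ∧ sepSecond n d ∉ forestVertices n d) ∧
    (∀ v < (params n d).core, v ∉ forestVertices n d →
      forestDegree n d v = edgeDegree (sepEdges n d) v) ∧
    (∀ v ∈ forestVertices n d, edgeDegree (sepEdges n d) v = 0) ∧
    ((zeros n d).length < 2 → forestVertices n d ≠ []) := by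
  have hb := H.forest_balance.2
  by_cases hz : 2 ≤ (zeros n d).length
  · have hl : sepList n d = zeros n d := if_pos hz
    have hsk : skipped n d = 0 := if_pos hz
    have hse : sepEdges n d = [] := if_pos hz
    obtain ⟨a, b, l, hab⟩ : ∃ a b l, zeros n d = a :: b :: l := by
      match h : zeros n d with
      | a :: b :: l => exact ⟨a, b, l, rfl⟩
      | [a] => simp [h] at hz
      | [] => simp [h] at hz
    have hnd : (zeros n d).Nodup := List.nodup_range.filter _
    have ha : a ∈ zeros n d := by simp [hab]
    have hb' : b ∈ zeros n d := by simp [hab]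
    have hf : sepFirst n d = a := by simp [sepFirst, hl, hab]
    have hs : sepSecond n d = b := by simp [sepSecond, hl, hab]
    simp only [zeros, List.mem_filter, List.mem_range, decide_eq_true_eq] at ha hb'
    rw [hf, hs, hse]
    refine ⟨⟨ha.1, hb'.1⟩, ?_, ⟨fun h => (mem_forestVertices h).2 ha.2,
      fun h => (mem_forestVertices h).2 hb'.2⟩, fun v hv hv' => ?_, fun _ _ => rfl, fun h => ?_⟩
    · rintro rfl
      simp [hab] at hnd
    · simp only [forestVertices, hsk, List.drop_zero, List.mem_append, bigs, leaves,
        List.mem_filter, List.mem_range, decide_eq_true_eq] at hv'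
      rw [edgeDegree_nil]
      omega
    · omega
  · have hl : sepList n d = leaves n d := if_neg hz
    have hsk : skipped n d = 2 := if_neg hz
    have h4 := hb (by omega)
    obtain ⟨a, b, c, l, hab⟩ : ∃ a b c l, leaves n d = a :: b :: c :: l := by
      match h : leaves n d with
      | a :: b :: c :: l => exact ⟨a, b, c, l, rfl⟩
      | [a, b] => simp [h] at h4
      | [a] => simp [h] at h4
      | [] => simp [h] at h4
    have hnd := nodup_leaves n d
    have ha : a ∈ leaves n d := by simp [hab]
    have hb' : b ∈ leaves n d := by simp [hab]
    have hf : sepFirst n d = a := by simp [sepFirst, hl, hab]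
    have hs : sepSecond n d = b := by simp [sepSecond, hl, hab]
    have hse : sepEdges n d = [(a, b)] := by rw [sepEdges, if_neg hz, hf, hs]
    have hdrop : (leaves n d).drop (skipped n d) = c :: l := by rw [hsk, hab]; rfl
    have hmem : ∀ v, v ∈ leaves n d ↔ v = a ∨ v = b ∨ v ∈ c :: l := fun v => by simp [hab]
    rw [hab, List.nodup_cons, List.nodup_cons] at hnd
    have hab' : a ≠ b := fun e => hnd.1 (by simp [e])
    have ha2 : a ∉ c :: l := fun h => hnd.1 (List.mem_cons_of_mem _ h)
    have hb2 : b ∉ c :: l := hnd.2.1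
    have hleaf : ∀ v, v ∈ leaves n d ↔ v < (params n d).core ∧ forestDegree n d v = 1 := fun v => by
      simp [leaves]
    have hbig : ∀ v, v ∈ bigs n d ↔ v < (params n d).core ∧ 2 ≤ forestDegree n d v := fun v => by
      simp [bigs]
    have hzero : ∀ v, v ∈ forestVertices n d ↔ v ∈ bigs n d ∨ v ∈ c :: l := fun v => by
      rw [forestVertices, hdrop, List.mem_append]
    have haf : a ∉ forestVertices n d := by
      have := (hleaf a).1 ha
      rw [hzero, hbig]
      rintro (h | h)
      · omega
      · exact ha2 h
    have hbf : b ∉ forestVertices n d := by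
      have := (hleaf b).1 hb'
      rw [hzero, hbig]
      rintro (h | h)
      · omega
      · exact hb2 h
    rw [hf, hs, hse]
    refine ⟨⟨((hleaf a).1 ha).1, ((hleaf b).1 hb').1⟩, hab', ⟨haf, hbf⟩, fun v hv hv' => ?_,
      fun v hv => ?_, fun _ => ?_⟩
    · rw [hzero, not_or] at hv'
      have h1 := (hmem v)
      simp only [hv'.2, or_false] at h1
      rw [hleaf] at h1
      rw [hbig] at hv'
      simp only [edgeDegree_cons, edgeDegree_nil]
      by_cases hva : v = a
      · have := h1.2 (.inl hva)
        rw [if_pos hva.symm, if_neg (fun e => hab' (hva.symm.trans e.symm))]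
        omega
      · by_cases hvb : v = b
        · have := h1.2 (.inr hvb)
          rw [if_pos hvb.symm, if_neg (Ne.symm hva)]
          omega
        · rw [if_neg (Ne.symm hva), if_neg (Ne.symm hvb)]
          have : ¬ (v < (params n d).core ∧ forestDegree n d v = 1) := fun h => by
            rcases h1.1 h with h | h
            · exact hva h
            · exact hvb h
          omega
    · simp only [edgeDegree_cons, edgeDegree_nil]
      rw [if_neg (fun e : a = v => haf (e ▸ hv)), if_neg (fun e : b = v => hbf (e ▸ hv))]
    · rw [forestVertices, hdrop]
      simp

theorem edgeDegree_map_filter_range (m : ℕ) (p : ℕ → Prop) [DecidablePred p] (g : ℕ → ℕ × ℕ)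
    (v : ℕ) : edgeDegree (((List.range m).filter fun k => p k).map g) v =
      ∑ k ∈ Finset.range m,
        if p k then (if (g k).1 = v then 1 else 0) + (if (g k).2 = v then 1 else 0) else 0 := by
  induction m with
  | zero => rfl
  | succ m ih =>
    by_cases h : p m
    · simp [List.range_succ, Finset.sum_range_succ, ih, h]
    · simp [List.range_succ, Finset.sum_range_succ, ih, h]

namespace IsForest

variable {τ : ℕ → ℕ} {A : List ℕ} {ch sd par : ℕ → ℕ}

theorem ch_mem (F : IsForest τ A ch sd par) {t : ℕ} (ht : t < A.length) : ch t ∈ A :=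
  F.perm.subset (List.mem_map_of_mem (List.mem_range.2 ht))

theorem exists_ch (F : IsForest τ A ch sd par) {v : ℕ} (hv : v ∈ A) : ∃ t < A.length, ch t = v := by
  have := F.perm.symm.subset hv
  simpa using this

theorem ch_inj (F : IsForest τ A ch sd par) (hA : A.Nodup) {t t' : ℕ} (ht : t < A.length)
    (ht' : t' < A.length) (h : ch t = ch t') : t = t' :=
  List.inj_on_of_nodup_map (F.perm.nodup_iff.2 hA) (by simpa using ht) (by simpa using ht') h

/-- Edge `t` is counted at `ch a` once if `t` is a child of `a`, and once if `t = a` is not a root,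
which is the left-hand side of `deg`. -/
theorem edgeDegree_forestEdges (F : IsForest τ A ch sd par) (hA : A.Nodup) {v : ℕ} (hv : v ∈ A) :
    edgeDegree (forestEdges ch sd par A.length) v = τ v := by
  obtain ⟨a, ha, rfl⟩ := F.exists_ch hv
  rw [← F.deg a ha, forestEdges, edgeDegree_map_filter_range]
  have h1 : ∀ t ∈ Finset.range A.length,
      (if par t ≠ t then
        (if (if sd t = 0 then (ch t, ch (par t)) else (ch (par t), ch t)).1 = ch a then 1 else 0) +
        (if (if sd t = 0 then (ch t, ch (par t)) else (ch (par t), ch t)).2 = ch a then 1 else 0)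
       else 0) =
      (if par t = a ∧ t ≠ a then 1 else 0) +
        (if t = a then (if par a = a then 0 else 1) else 0) := by
    intro t ht
    have ht := Finset.mem_range.1 ht
    have e1 : ch t = ch a ↔ t = a := ⟨F.ch_inj hA ht ha, fun h => h ▸ rfl⟩
    have e2 : ch (par t) = ch a ↔ par t = a :=
      ⟨F.ch_inj hA ((F.par_le t ht).trans_lt ht) ha, fun h => h ▸ rfl⟩
    by_cases hta : t = a
    · subst hta
      split_ifs <;> simp_all
    · split_ifs <;> simp_all
  rw [Finset.sum_congr rfl h1, Finset.sum_add_distrib, Finset.sum_ite_eq', if_pos (by simpa using ha)]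
  rfl

theorem edgeDegree_forestEdges_of_notMem (F : IsForest τ A ch sd par) {v : ℕ} (hv : v ∉ A) :
    edgeDegree (forestEdges ch sd par A.length) v = 0 := by
  rw [forestEdges, edgeDegree_map_filter_range]
  refine Finset.sum_eq_zero fun t ht => ?_
  have ht := Finset.mem_range.1 ht
  have h1 : ch t ≠ v := fun h => hv (h ▸ F.ch_mem ht)
  have h2 : ch (par t) ≠ v := fun h => hv (h ▸ F.ch_mem ((F.par_le t ht).trans_lt ht))
  split_ifs <;> simp_all

/-- The ends of the edges of the forest, as positions on the two sides. -/
theorem mem_forestEdges (F : IsForest τ A ch sd par) {x : ℕ × ℕ}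
    (hx : x ∈ forestEdges ch sd par A.length) :
    ∃ i j t, t < A.length ∧ par t ≠ t ∧ ((i = t ∧ j = par t) ∨ (i = par t ∧ j = t)) ∧
      sd i = 0 ∧ sd j = 1 ∧ x = (ch i, ch j) := by
  simp only [forestEdges, List.mem_map, List.mem_filter, List.mem_range, ne_eq, decide_not,
    Bool.not_eq_eq_eq_not, Bool.not_true, decide_eq_false_iff_not] at hx
  obtain ⟨t, ⟨ht, hp⟩, rfl⟩ := hx
  have h1 := F.sd_lt t ht
  have h2 := F.sd_lt _ ((F.par_le t ht).trans_lt ht)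
  have h3 := F.sd_ne t ht hp
  by_cases h : sd t = 0
  · exact ⟨t, par t, t, ht, hp, .inl ⟨rfl, rfl⟩, h, by omega, if_pos h⟩
  · exact ⟨par t, t, t, ht, hp, .inr ⟨rfl, rfl⟩, by omega, by omega, if_neg h⟩

theorem nodup_forestEdges (F : IsForest τ A ch sd par) (hA : A.Nodup) :
    (forestEdges ch sd par A.length).Nodup := by
  refine List.Nodup.map_on (fun t ht t' ht' h => ?_) (List.nodup_range.filter _)
  simp only [List.mem_filter, List.mem_range, ne_eq, decide_not, Bool.not_eq_eq_eq_not,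
    Bool.not_true, decide_eq_false_iff_not] at ht ht'
  have hp := F.par_le t ht.1
  have hp' := F.par_le t' ht'.1
  have i1 := fun a b => F.ch_inj hA (t := a) (t' := b)
  have s1 := F.sd_ne t ht.1 ht.2
  have s2 := F.sd_ne t' ht'.1 ht'.2
  split_ifs at h with h1 h2 h2
  · exact i1 _ _ ht.1 ht'.1 (Prod.ext_iff.1 h).1
  -- Edges on different sides could only agree if each of `t` and `t'` were the parent of the other,
  -- contrary to `par t ≤ t`.
  · have e1 := i1 _ _ ht.1 (by omega) (Prod.ext_iff.1 h).1
    have e2 := i1 _ _ (by omega) ht'.1 (Prod.ext_iff.1 h).2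
    omega
  · have e1 := i1 _ _ (by omega) ht'.1 (Prod.ext_iff.1 h).1
    have e2 := i1 _ _ ht.1 (by omega) (Prod.ext_iff.1 h).2
    omega
  · exact i1 _ _ ht.1 ht'.1 (Prod.ext_iff.1 h).2

end IsForest

/-- The keys that determine the order of the core vertices: first a separating vertex, then the
first side of the forest, then the vertices outside of the forest, then the second side in
reverse order. -/
structure CoreKeys (n : ℕ) (d : ℕ → ℕ) (ch sd ck : ℕ → ℕ) : Prop where
  on_forest : ∀ t < (forestVertices n d).length, ck (ch t) = if sd t = 0 then 1 + t else 3 * n - t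
  off_forest : ∀ v < n, v ∉ forestVertices n d →
    ck v = if v = sepFirst n d then 0 else if v < (params n d).core then n + 1 + v else 4 * n + v

namespace CoreKeys

variable {n : ℕ} {d ch sd par ck : ℕ → ℕ}

theorem cases (C : CoreKeys n d ch sd ck) (H : Feasible n d)
    (F : IsForest (forestDegree n d) (forestVertices n d) ch sd par) {v : ℕ} (hv : v < n) :
    (∃ t < n, v = ch t ∧ v < (params n d).core ∧ ck v = 1 + t) ∨
    (∃ t < n, v = ch t ∧ v < (params n d).core ∧ ck v = 3 * n - t) ∨
    (v = sepFirst n d ∧ v < (params n d).core ∧ ck v = 0) ∨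
    (v < (params n d).core ∧ ck v = n + 1 + v) ∨
    ((params n d).core ≤ v ∧ ck v = 4 * n + v) := by
  have hl := length_forestVertices_le n d
  have hc := H.good.core_add
  by_cases h : v ∈ forestVertices n d
  · obtain ⟨t, ht, rfl⟩ := F.exists_ch h
    have h1 := C.on_forest t ht
    have h2 := (mem_forestVertices h).1
    by_cases hs : sd t = 0
    · exact .inl ⟨t, by omega, rfl, h2, by rw [h1, if_pos hs]⟩
    · exact .inr (.inl ⟨t, by omega, rfl, h2, by rw [h1, if_neg hs]⟩)
  · have h1 := C.off_forest v hv h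
    split_ifs at h1 with h2 h3
    · exact .inr (.inr (.inl ⟨h2, h2 ▸ H.sep_spec.1.1, h1⟩))
    · exact .inr (.inr (.inr (.inl ⟨h3, h1⟩)))
    · exact .inr (.inr (.inr (.inr ⟨by omega, h1⟩)))

/-- The five kinds of vertices have keys in the disjoint ranges `0`, `1` to `n`, `n + 1` to `2 * n`,
`2 * n + 1` to `3 * n`, and from `4 * n` on. -/
theorem inj (C : CoreKeys n d ch sd ck) (H : Feasible n d)
    (F : IsForest (forestDegree n d) (forestVertices n d) ch sd par) :
    ∀ u < n, ∀ v < n, ck u = ck v → u = v := by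
  intro u hu v hv h
  have key : ∀ t t' : ℕ, u = ch t → v = ch t' → t = t' → u = v := by
    rintro t t' rfl rfl rfl
    rfl
  rcases C.cases H F hu with ⟨t, ht, e, -, k⟩ | ⟨t, ht, e, -, k⟩ | ⟨e, -, k⟩ | ⟨e, k⟩ | ⟨e, k⟩ <;>
  rcases C.cases H F hv with ⟨t', ht', e', -, k'⟩ | ⟨t', ht', e', -, k'⟩ | ⟨e', -, k'⟩ | ⟨e', k'⟩ |
    ⟨e', k'⟩ <;> first | omega | exact key t t' e e' (by omega)

theorem core_lt (C : CoreKeys n d ch sd ck) (H : Feasible n d)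
    (F : IsForest (forestDegree n d) (forestVertices n d) ch sd par) :
    ∀ u < (params n d).core, ∀ v, (params n d).core ≤ v → v < n → ck u < ck v := by
  intro u hu v hv hv'
  rcases C.cases H F (v := u) (by omega) with
    ⟨t, ht, e, -, k⟩ | ⟨t, ht, e, -, k⟩ | ⟨e, -, k⟩ | ⟨e, k⟩ | ⟨e, k⟩ <;>
  rcases C.cases H F hv' with ⟨t', ht', e', _, k'⟩ | ⟨t', ht', e', _, k'⟩ | ⟨e', _, k'⟩ |
    ⟨e', k'⟩ | ⟨e', k'⟩ <;> omega

theorem sepFirst_eq (C : CoreKeys n d ch sd ck) (H : Feasible n d) : ck (sepFirst n d) = 0 := by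
  obtain ⟨h1, -, h2, -⟩ := H.sep_spec
  have := H.good.core_add
  rw [C.off_forest _ (by omega) h2.1, if_pos rfl]

theorem sepSecond_eq (C : CoreKeys n d ch sd ck) (H : Feasible n d) :
    ck (sepSecond n d) = n + 1 + sepSecond n d := by
  obtain ⟨h1, h2, h3, -⟩ := H.sep_spec
  have := H.good.core_add
  rw [C.off_forest _ (by omega) h3.2, if_neg h2.symm, if_pos h1.2]

/-- Each forest edge stays clear of `sepFirst` and passes over `sepSecond`, so its ends are not
consecutive on the cycle. -/
theorem forestEdge_keys (C : CoreKeys n d ch sd ck)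
    (F : IsForest (forestDegree n d) (forestVertices n d) ch sd par) (H : Feasible n d) {x : ℕ × ℕ}
    (hx : x ∈ forestEdges ch sd par (forestVertices n d).length) :
    (x.1 < (params n d).core ∧ x.2 < (params n d).core) ∧
      0 < ck x.1 ∧ ck x.1 < ck (sepSecond n d) ∧ ck (sepSecond n d) < ck x.2 := by
  obtain ⟨i, j, t, ht, hp, hij, si, sj, rfl⟩ := F.mem_forestEdges hx
  have hpt := F.par_le t ht
  have hl := length_forestVertices_le n d
  have hc := H.good.core_add
  have hi : i < (forestVertices n d).length := by omega
  have hj : j < (forestVertices n d).length := by omega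
  have h1 := (mem_forestVertices (F.ch_mem hi)).1
  have h2 := (mem_forestVertices (F.ch_mem hj)).1
  have h3 := H.sep_spec.1.2
  have k1 := C.on_forest i hi
  have k2 := C.on_forest j hj
  rw [if_pos si] at k1
  rw [if_neg (by omega)] at k2
  rw [C.sepSecond_eq H]
  simp only
  omega

/-- By `mono` the later of two edges has no smaller index on either side. Since the keys increase on
the first side and decrease on the second, it is nested inside the earlier one. -/
theorem nonCrossing_forestEdges (C : CoreKeys n d ch sd ck)
    (F : IsForest (forestDegree n d) (forestVertices n d) ch sd par) (H : Feasible n d) :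
    NonCrossing ck (forestEdges ch sd par (forestVertices n d).length) := by
  intro x hx y hy
  obtain ⟨i, j, t, ht, hp, hij, si, sj, rfl⟩ := F.mem_forestEdges hx
  obtain ⟨i', j', t', ht', hp', hij', si', sj', rfl⟩ := F.mem_forestEdges hy
  have hpt := F.par_le t ht
  have hpt' := F.par_le t' ht'
  have hl := length_forestVertices_le n d
  have hc := H.good.core_add
  have k1 := C.on_forest i (by omega)
  have k2 := C.on_forest j (by omega)
  have k1' := C.on_forest i' (by omega)
  have k2' := C.on_forest j' (by omega)
  rw [if_pos (by omega)] at k1 k1'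
  rw [if_neg (by omega)] at k2 k2'
  simp only [k1, k2, k1', k2']
  rcases lt_trichotomy t t' with h | rfl | h
  · have := F.mono t t' h ht' hp hp'
    rcases hij with ⟨rfl, rfl⟩ | ⟨rfl, rfl⟩ <;> rcases hij' with ⟨rfl, rfl⟩ | ⟨rfl, rfl⟩
    · omega
    · rcases this with e | e
      -- A common parent would have to lie on both sides.
      · rw [e] at si'; omega
      · omega
    · rcases this with e | e
      · rw [e] at sj'; omega
      · omega
    · omega
  · rcases hij with ⟨rfl, rfl⟩ | ⟨rfl, rfl⟩ <;> rcases hij' with ⟨rfl, rfl⟩ | ⟨rfl, rfl⟩ <;> omega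
  · have := F.mono t' t h ht hp' hp
    rcases hij with ⟨rfl, rfl⟩ | ⟨rfl, rfl⟩ <;> rcases hij' with ⟨rfl, rfl⟩ | ⟨rfl, rfl⟩
    · omega
    · rcases this with e | e
      · rw [e] at sj; omega
      · omega
    · rcases this with e | e
      · rw [e] at si; omega
      · omega
    · omega

end CoreKeys

/-! ### The drawing -/

/-- The vertex that is token `s`: the pendant vertices are the first tokens. -/
def tokenId (P : Params) (s : ℕ) : ℕ :=
  if s < P.pend then P.core + P.doubled + s else P.core + (s - P.pend)

/-- The block of the first half-edge at token `s`. -/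
def lowBlock (P : Params) (E : ℕ → ℕ) (s : ℕ) : ℕ :=
  owner P.core E (tokenLow P.tokens (midStart P.core P.tokens E) (midLength P.core P.tokens E) s)

/-- The block of the second half-edge at token `s`. -/
def highBlock (P : Params) (E : ℕ → ℕ) (s : ℕ) : ℕ :=
  owner P.core E (tokenHigh P.tokens (midStart P.core P.tokens E) (midLength P.core P.tokens E) s)

/-- The Hamiltonian cycle of the core. -/
def cycleEdges (M : ℕ) (co : ℕ → ℕ) : List (ℕ × ℕ) :=
  (List.range (M - 1)).map (fun k => (co k, co (k + 1))) ++ [(co 0, co (M - 1))]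

/-- The edges from the core vertices to the tokens next to them. -/
def lowEdges (P : Params) (co E : ℕ → ℕ) : List (ℕ × ℕ) :=
  (List.range P.tokens).map fun s => (co (lowBlock P E s), tokenId P s)

/-- The edges from the doubled tokens to their second neighbours. -/
def highEdges (P : Params) (co E : ℕ → ℕ) : List (ℕ × ℕ) :=
  ((List.range P.tokens).filter fun s => P.pend ≤ s).map fun s =>
    (tokenId P s, co (highBlock P E s))

/-- The edges that join the pseudo pendant vertices in pairs. -/
def pseudoEdges (n : ℕ) (P : Params) : List (ℕ × ℕ) :=
  ((List.range n).filter fun i => 2 * i + 1 < P.pseudo).map fun i =>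
    (P.core + P.doubled + 2 * i, P.core + P.doubled + (2 * i + 1))

/-- The forest, the order of the core vertices, and the blocks of half-edges. -/
structure CoreOrder (n : ℕ) (d ch sd par ck co E : ℕ → ℕ) : Prop where
  feas : Feasible n d
  forest : IsForest (forestDegree n d) (forestVertices n d) ch sd par
  keys : CoreKeys n d ch sd ck
  co_rank : ∀ v < n, co (rank n ck v) = v
  E_zero : E 0 = 0
  E_succ : ∀ k < (params n d).core, E (k + 1) = E k + share n d (co k)

namespace CoreOrder

variable {n : ℕ} {d ch sd par ck co E : ℕ → ℕ}

theorem rank_core (D : CoreOrder n d ch sd par ck co E) {v : ℕ} (hv : v < (params n d).core) :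
    rank n ck v < (params n d).core := by
  have := D.feas.good.core_add
  exact (rank_lt_iff_lt (by omega) (D.keys.core_lt D.feas D.forest) (by omega)).2 hv

theorem co_spec (D : CoreOrder n d ch sd par ck co E) {k : ℕ} (hk : k < (params n d).core) :
    co k < (params n d).core ∧ rank n ck (co k) = k := by
  have := D.feas.good.core_add
  obtain ⟨v, hv, rfl⟩ := exists_rank_eq (D.keys.inj D.feas D.forest) (k := k) (by omega)
  rw [D.co_rank v hv]
  exact ⟨(rank_lt_iff_lt (by omega) (D.keys.core_lt D.feas D.forest) hv).1 hk, rfl⟩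

theorem co_inj (D : CoreOrder n d ch sd par ck co E) {k l : ℕ} (hk : k < (params n d).core)
    (hl : l < (params n d).core) (h : co k = co l) : k = l := by
  rw [← (D.co_spec hk).2, ← (D.co_spec hl).2, h]

theorem co_eq_iff (D : CoreOrder n d ch sd par ck co E) {k v : ℕ} (hk : k < (params n d).core)
    (hv : v < (params n d).core) : co k = v ↔ k = rank n ck v := by
  have := D.feas.good.core_add
  constructor
  · rintro rfl
    exact (D.co_spec hk).2.symm
  · rintro rfl
    exact D.co_rank v (by omega)

theorem sum_share_co (D : CoreOrder n d ch sd par ck co E) :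
    ∑ k ∈ Finset.range (params n d).core, share n d (co k) =
      2 * (params n d).tokens - (params n d).pend := by
  rw [← D.feas.sum_share,
    ← D.feas.sum_range_core fun i hi h => (D.feas.forestDegree_eq_zero hi h).2]
  refine Finset.sum_nbij' co (rank n ck) ?_ ?_ ?_ ?_ ?_
  · intro k hk
    simpa using (D.co_spec (by simpa using hk)).1
  · intro v hv
    simpa using D.rank_core (by simpa using hv)
  · intro k hk
    exact (D.co_spec (by simpa using hk)).2
  · intro v hv
    have := D.feas.good.core_add
    simp only [Finset.mem_range] at hv
    exact D.co_rank v (by omega)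
  · intro k _
    rfl

/-- The shares add up to `2 * tokens - pend`, and the cap `tokens` in `capacity` bounds each block
by half of the half-edges. -/
theorem tokenData (D : CoreOrder n d ch sd par ck co E) :
    TokenData (params n d).core (params n d).tokens (params n d).pend E where
  zero := D.E_zero
  step k hk := by rw [D.E_succ k hk]; omega
  pend_le := by
    have := D.feas.good.tokens_eq
    omega
  total := by
    have h : ∀ m ≤ (params n d).core, E m = ∑ k ∈ Finset.range m, share n d (co k) := by
      intro m
      induction m with
      | zero => intro _; simp [D.E_zero]
      | succ m ih =>
        intro hm
        rw [D.E_succ m hm, ih (by omega), Finset.sum_range_succ]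
    rw [h _ le_rfl, D.sum_share_co]
    have := D.feas.good.tokens_eq
    omega
  block_le k hk := by
    rw [D.E_succ k hk]
    have := share_le_tokens n d (co k)
    omega

end CoreOrder

/-- The data from which the drawing is made: the order of the core vertices, and the keys that give
the final order of all vertices. -/
structure Drawing (n : ℕ) (d ch sd par ck co E key : ℕ → ℕ) : Prop extends
    CoreOrder n d ch sd par ck co E where
  key_core : ∀ k < (params n d).core, key (co k) = k + E k
  key_token : ∀ s < (params n d).tokens, key (tokenId (params n d) s) =
    tokenLow (params n d).tokens (midStart (params n d).core (params n d).tokens E)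
      (midLength (params n d).core (params n d).tokens E) s + lowBlock (params n d) E s + 1

namespace Drawing

variable {n : ℕ} {d ch sd par ck co E key : ℕ → ℕ}

/-- The keys of the core vertices are in the order of their ranks. -/
theorem key_core_eq (D : Drawing n d ch sd par ck co E key) {v : ℕ}
    (hv : v < (params n d).core) : key v = rank n ck v + E (rank n ck v) := by
  have := D.feas.good.core_add
  conv_lhs => rw [← D.co_rank v (by omega)]
  exact D.key_core _ (D.rank_core hv)

/-- `k + E k` is strictly increasing: core vertex `k` is followed by one slot for each half-edge of
its block. Slots of second half-edges stay empty. -/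
theorem key_lt_iff_rank (D : Drawing n d ch sd par ck co E key) {u v : ℕ}
    (hu : u < (params n d).core) (hv : v < (params n d).core) :
    key u < key v ↔ rank n ck u < rank n ck v := by
  rw [D.key_core_eq hu, D.key_core_eq hv]
  have h1 := D.rank_core hu
  have h2 := D.rank_core hv
  constructor
  · intro h
    by_contra h'
    have := D.tokenData.mono (not_lt.1 h') h1.le
    omega
  · intro h
    have := D.tokenData.mono h.le h2.le
    omega

theorem key_lt_iff (D : Drawing n d ch sd par ck co E key) {u v : ℕ}
    (hu : u < (params n d).core) (hv : v < (params n d).core) : key u < key v ↔ ck u < ck v := by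
  have := D.feas.good.core_add
  rw [D.key_lt_iff_rank hu hv, rank_lt_iff (D.keys.inj D.feas D.forest) (by omega) (by omega)]

theorem lowBlock_lt (D : Drawing n d ch sd par ck co E key) {s : ℕ}
    (hs : s < (params n d).tokens) : lowBlock (params n d) E s < (params n d).core :=
  (D.tokenData.owner_low_lt hs).trans_le (owner_le _ _ _)

theorem highBlock_lt (D : Drawing n d ch sd par ck co E key) {s : ℕ}
    (hs : s < (params n d).tokens) (hs' : (params n d).pend ≤ s) :
    highBlock (params n d) E s < (params n d).core := by
  have h1 := D.tokenData.owner_high_eq_iff hs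
  have h2 := owner_le (params n d).core E (tokenHigh (params n d).tokens
    (midStart (params n d).core (params n d).tokens E)
    (midLength (params n d).core (params n d).tokens E) s)
  change highBlock _ _ _ = _ ↔ _ at h1
  change highBlock _ _ _ ≤ _ at h2
  omega

/-- The key of a token lies between those of its block and of the next block. -/
theorem key_token_mem (D : Drawing n d ch sd par ck co E key) {s : ℕ}
    (hs : s < (params n d).tokens) :
    lowBlock (params n d) E s + E (lowBlock (params n d) E s) < key (tokenId (params n d) s) ∧
    key (tokenId (params n d) s) <
      lowBlock (params n d) E s + 1 + E (lowBlock (params n d) E s + 1) := by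
  rw [D.key_token s hs]
  have h1 := D.tokenData.start_le (tokenLow (params n d).tokens
    (midStart (params n d).core (params n d).tokens E)
    (midLength (params n d).core (params n d).tokens E) s)
  have h2 := D.tokenData.lt_next (D.lowBlock_lt hs)
  change E (lowBlock _ _ _) ≤ _ at h1
  change _ < E (lowBlock _ _ _ + 1) at h2
  omega

/-- No core vertex lies between a core vertex and a token in its block. -/
theorem core_key_not_between (D : Drawing n d ch sd par ck co E key) {s v : ℕ}
    (hs : s < (params n d).tokens) (hv : v < (params n d).core) :
    key v ≤ lowBlock (params n d) E s + E (lowBlock (params n d) E s) ∨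
      key (tokenId (params n d) s) < key v := by
  obtain ⟨h1, h2⟩ := D.key_token_mem hs
  have h3 := D.lowBlock_lt hs
  have h4 := D.rank_core hv
  rw [D.key_core_eq hv]
  rcases Nat.lt_or_ge (lowBlock (params n d) E s) (rank n ck v) with h | h
  · have := D.tokenData.mono (k := lowBlock (params n d) E s + 1) h h4.le
    omega
  · have := D.tokenData.mono h h3.le
    omega

/-- Behind the core come the doubled tokens, then the pseudo pendant vertices, then the entries `1`.
This agrees with the order of the degrees. -/
theorem exists_tokenId (H : Feasible n d) {v : ℕ} (hv : (params n d).core ≤ v) (hn : v < n) :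
    ∃ s < (params n d).tokens, tokenId (params n d) s = v := by
  have h1 := H.good.core_add
  have h2 := H.good.tokens_eq
  unfold tokenId
  by_cases h : v < (params n d).core + (params n d).doubled
  · exact ⟨v - (params n d).core + (params n d).pend, by omega, by rw [if_neg (by omega)]; omega⟩
  · exact ⟨v - (params n d).core - (params n d).doubled, by omega, by
      rw [if_pos (by omega)]; omega⟩

theorem tokenId_spec (H : Feasible n d) {s : ℕ} (hs : s < (params n d).tokens) :
    (params n d).core ≤ tokenId (params n d) s ∧ tokenId (params n d) s < n := by
  have h1 := H.good.core_add
  have h2 := H.good.tokens_eq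
  unfold tokenId
  split_ifs <;> omega

theorem tokenId_inj (H : Feasible n d) {s s' : ℕ} (hs : s < (params n d).tokens)
    (hs' : s' < (params n d).tokens) (h : tokenId (params n d) s = tokenId (params n d) s') :
    s = s' := by
  have h2 := H.good.tokens_eq
  unfold tokenId at h
  split_ifs at h <;> omega

/-- The slot of half-edge `j` is `j + owner j + 1`, which is strictly increasing in `j`. -/
theorem low_lt_iff (D : Drawing n d ch sd par ck co E key) {s s' : ℕ}
    (hs : s < (params n d).tokens) (hs' : s' < (params n d).tokens) :
    key (tokenId (params n d) s) < key (tokenId (params n d) s') ↔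
    tokenLow (params n d).tokens (midStart (params n d).core (params n d).tokens E)
      (midLength (params n d).core (params n d).tokens E) s <
    tokenLow (params n d).tokens (midStart (params n d).core (params n d).tokens E)
      (midLength (params n d).core (params n d).tokens E) s' := by
  rw [D.key_token s hs, D.key_token s' hs']
  constructor
  · intro h
    by_contra h'
    have := D.tokenData.owner_mono (not_lt.1 h')
    change lowBlock _ _ _ ≤ lowBlock _ _ _ at this
    omega
  · intro h
    have := D.tokenData.owner_mono h.le
    change lowBlock _ _ _ ≤ lowBlock _ _ _ at this
    omega

theorem key_inj (D : Drawing n d ch sd par ck co E key) :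
    ∀ u < n, ∀ v < n, key u = key v → u = v := by
  intro u hu v hv h
  have ht : ∀ u < (params n d).core, ∀ s < (params n d).tokens,
      key u ≠ key (tokenId (params n d) s) := fun u hu s hs h => by
    have h1 := D.core_key_not_between hs hu
    have h2 := D.key_token_mem hs
    omega
  by_cases hu' : u < (params n d).core
  · by_cases hv' : v < (params n d).core
    · have h1 := D.key_lt_iff hu' hv'
      have h2 := D.key_lt_iff hv' hu'
      exact D.keys.inj D.feas D.forest u hu v hv (by omega)
    · obtain ⟨s, hs, rfl⟩ := exists_tokenId D.feas (not_lt.1 hv') hv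
      exact absurd h (ht u hu' s hs)
  · obtain ⟨s, hs, rfl⟩ := exists_tokenId D.feas (not_lt.1 hu') hu
    by_cases hv' : v < (params n d).core
    · exact absurd h.symm (ht v hv' s hs)
    · obtain ⟨s', hs', rfl⟩ := exists_tokenId D.feas (not_lt.1 hv') hv
      have h1 := D.low_lt_iff hs hs'
      have h2 := D.low_lt_iff hs' hs
      obtain ⟨m1, m2, m3, -⟩ := D.tokenData.mid (by omega)
      rw [tokenLow_inj m1 m2 m3 hs hs' (by omega)]

/-! ### The edges of the drawing -/

theorem mem_cycleEdges (D : Drawing n d ch sd par ck co E key) {x : ℕ × ℕ}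
    (hx : x ∈ cycleEdges (params n d).core co) :
    (x.1 < (params n d).core ∧ x.2 < (params n d).core) ∧
    (rank n ck x.2 = rank n ck x.1 + 1 ∨
      rank n ck x.1 = 0 ∧ rank n ck x.2 = (params n d).core - 1) := by
  have hc := D.feas.good.core_ge
  rcases List.mem_append.1 hx with h | h
  · simp only [List.mem_map, List.mem_range] at h
    obtain ⟨k, hk, rfl⟩ := h
    have h1 := D.co_spec (k := k) (by omega)
    have h2 := D.co_spec (k := k + 1) (by omega)
    exact ⟨⟨h1.1, h2.1⟩, .inl (by simp only; omega)⟩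
  · rw [List.mem_singleton] at h
    subst h
    have h1 := D.co_spec (k := 0) (by omega)
    have h2 := D.co_spec (k := (params n d).core - 1) (by omega)
    exact ⟨⟨h1.1, h2.1⟩, .inr ⟨h1.2, h2.2⟩⟩

theorem mem_lowEdges (D : Drawing n d ch sd par ck co E key) {x : ℕ × ℕ}
    (hx : x ∈ lowEdges (params n d) co E) :
    ∃ s < (params n d).tokens, x = (co (lowBlock (params n d) E s), tokenId (params n d) s) ∧
      co (lowBlock (params n d) E s) < (params n d).core ∧
      key (co (lowBlock (params n d) E s)) =
        lowBlock (params n d) E s + E (lowBlock (params n d) E s) := by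
  simp only [lowEdges, List.mem_map, List.mem_range] at hx
  obtain ⟨s, hs, rfl⟩ := hx
  exact ⟨s, hs, rfl, (D.co_spec (D.lowBlock_lt hs)).1, D.key_core _ (D.lowBlock_lt hs)⟩

theorem mem_highEdges (D : Drawing n d ch sd par ck co E key) {x : ℕ × ℕ}
    (hx : x ∈ highEdges (params n d) co E) :
    ∃ s < (params n d).tokens, (params n d).pend ≤ s ∧
      x = (tokenId (params n d) s, co (highBlock (params n d) E s)) ∧
      co (highBlock (params n d) E s) < (params n d).core ∧
      key (co (highBlock (params n d) E s)) =
        highBlock (params n d) E s + E (highBlock (params n d) E s) := by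
  simp only [highEdges, List.mem_map, List.mem_filter, List.mem_range, decide_eq_true_eq] at hx
  obtain ⟨s, ⟨hs, hs'⟩, rfl⟩ := hx
  exact ⟨s, hs, hs', rfl, (D.co_spec (D.highBlock_lt hs hs')).1,
    D.key_core _ (D.highBlock_lt hs hs')⟩

/-- The block in the middle is that of the first vertex if there are pseudo pendant vertices. -/
theorem midLength_eq (D : Drawing n d ch sd par ck co E key) (h : 0 < (params n d).pseudo) :
    midLength (params n d).core (params n d).tokens E = (params n d).tokens := by
  have G := D.feas.good
  have hc := G.core_ge
  have hp := G.pend_eq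
  have h0 := D.rank_core (v := 0) (by omega)
  have h1 := D.E_succ _ h0
  have h2 := G.core_add
  rw [D.co_rank 0 (by omega), D.feas.share_zero h] at h1
  have B := D.tokenData
  have ht := B.total
  have hpl := B.pend_le
  have hm := B.mono (k := rank n ck 0 + 1) (l := (params n d).core) h0 le_rfl
  have h3 := B.le_owner (j := (params n d).tokens - 1) h0.le (by omega)
  have h4 := B.owner_lt (j := (params n d).tokens - 1) (k := rank n ck 0 + 1) h0 (by omega)
  have h5 : owner (params n d).core E ((params n d).tokens - 1) = rank n ck 0 := by omega
  unfold midLength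
  rw [h5]
  omega

/-- The two ends of an edge between pseudo pendant vertices are consecutive. -/
theorem mem_pseudoEdges (D : Drawing n d ch sd par ck co E key) {x : ℕ × ℕ}
    (hx : x ∈ pseudoEdges n (params n d)) :
    ((params n d).core ≤ x.1 ∧ x.1 < n ∧ (params n d).core ≤ x.2 ∧ x.2 < n) ∧
      key x.2 = key x.1 + 1 := by
  simp only [pseudoEdges, List.mem_map, List.mem_filter, List.mem_range, decide_eq_true_eq] at hx
  obtain ⟨i, ⟨-, hi⟩, rfl⟩ := hx
  have G := D.feas.good
  have g1 := G.pend_eq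
  have g2 := G.core_add
  have g3 := G.tokens_eq
  refine ⟨by simp only; omega, ?_⟩
  have e1 : (params n d).core + (params n d).doubled + 2 * i = tokenId (params n d) (2 * i) := by
    rw [tokenId, if_pos (by omega)]
  have e2 : (params n d).core + (params n d).doubled + (2 * i + 1) =
      tokenId (params n d) (2 * i + 1) := by
    rw [tokenId, if_pos (by omega)]
  have hm := D.midLength_eq (by omega)
  obtain ⟨m1, m2, m3, m4⟩ := D.tokenData.mid (by omega)
  simp only
  rw [e1, e2, D.key_token _ (by omega), D.key_token _ (by omega)]
  unfold lowBlock
  rw [hm] at m4 ⊢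
  rw [tokenLow_succ m4 (by omega)]
  have B := D.tokenData
  have k1 := D.midLength_eq (by omega)
  have k0 := B.mid_lt (by omega)
  -- As the middle block has length `tokens`, there are no left–right pairs, and all pendant tokens
  -- start in that block. Hence their slots are consecutive just like their half-edges.
  have hlow : ∀ s < (params n d).pend, owner (params n d).core E (tokenLow (params n d).tokens
      (midStart (params n d).core (params n d).tokens E) (params n d).tokens s) =
      owner (params n d).core E ((params n d).tokens - 1) := by
    intro s hs
    have hb : midStart (params n d).core (params n d).tokens E ≤ tokenLow (params n d).tokens
        (midStart (params n d).core (params n d).tokens E) (params n d).tokens s ∧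
        tokenLow (params n d).tokens
        (midStart (params n d).core (params n d).tokens E) (params n d).tokens s <
        midStart (params n d).core (params n d).tokens E + (params n d).tokens := by
      unfold tokenLow
      split_ifs <;> omega
    have hst := B.step _ k0
    have hend : E (owner (params n d).core E ((params n d).tokens - 1) + 1) =
        midStart (params n d).core (params n d).tokens E + (params n d).tokens := by
      have u1 : midStart (params n d).core (params n d).tokens E =
        E (owner (params n d).core E ((params n d).tokens - 1)) := rfl
      have u2 : midLength (params n d).core (params n d).tokens E =
        E (owner (params n d).core E ((params n d).tokens - 1) + 1) -
          E (owner (params n d).core E ((params n d).tokens - 1)) := rfl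
      omega
    have h1 := B.le_owner k0.le hb.1
    have h2 := B.owner_lt (k := owner (params n d).core E ((params n d).tokens - 1) + 1) k0
      (by rw [hend]; exact hb.2)
    omega
  have q1 := hlow (2 * i) (by omega)
  have q2 := hlow (2 * i + 1) (by omega)
  rw [tokenLow_succ m4 (by omega)] at q2
  rw [q1, q2]
  omega

end Drawing

/-- The edges of the first page. -/
def pageOne (n : ℕ) (d ch sd par co E : ℕ → ℕ) : List (ℕ × ℕ) :=
  forestEdges ch sd par (forestVertices n d).length ++ cycleEdges (params n d).core co ++
    (lowEdges (params n d) co E ++ pseudoEdges n (params n d))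

/-- The edges of the second page. -/
def pageTwo (n : ℕ) (d co E : ℕ → ℕ) : List (ℕ × ℕ) :=
  sepEdges n d ++ highEdges (params n d) co E

namespace Drawing

variable {n : ℕ} {d ch sd par ck co E key : ℕ → ℕ}

/-- The forest edges and the edges of the cycle join core vertices. -/
theorem mem_coreEdges (D : Drawing n d ch sd par ck co E key) {x : ℕ × ℕ}
    (hx : x ∈ forestEdges ch sd par (forestVertices n d).length ++
      cycleEdges (params n d).core co) :
    (x.1 < (params n d).core ∧ x.2 < (params n d).core) ∧ rank n ck x.1 < rank n ck x.2 := by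
  have hc := D.feas.good.core_ge
  have hn := D.feas.good.core_add
  rcases List.mem_append.1 hx with h | h
  · obtain ⟨h1, h2, h3, h4⟩ := D.keys.forestEdge_keys D.forest D.feas h
    exact ⟨h1, rank_lt_rank (by omega) (by omega)⟩
  · obtain ⟨h1, h2⟩ := D.mem_cycleEdges h
    exact ⟨h1, by omega⟩

theorem forestEdge_rank (D : Drawing n d ch sd par ck co E key) {x : ℕ × ℕ}
    (hx : x ∈ forestEdges ch sd par (forestVertices n d).length) :
    0 < rank n ck x.1 ∧ rank n ck x.1 < rank n ck (sepSecond n d) ∧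
      rank n ck (sepSecond n d) < rank n ck x.2 := by
  have hn := D.feas.good.core_add
  obtain ⟨h1, h2, h3, h4⟩ := D.keys.forestEdge_keys D.forest D.feas hx
  obtain ⟨⟨s1, s2⟩, -⟩ := D.feas.sep_spec
  have h0 : rank n ck (sepFirst n d) < rank n ck x.1 :=
    rank_lt_rank (by omega) (by rw [D.keys.sepFirst_eq D.feas]; exact h2)
  exact ⟨by omega, rank_lt_rank (by omega) h3, rank_lt_rank (by omega) h4⟩

/-- The edge is not a cycle edge: any forest edge has one end between the two separators and the
other end behind the second, and there is a forest edge because four leaves exist and only two are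
skipped. -/
theorem sepEdge_spec (D : Drawing n d ch sd par ck co E key) {x : ℕ × ℕ}
    (hx : x ∈ sepEdges n d) :
    (x.1 < (params n d).core ∧ x.2 < (params n d).core) ∧ rank n ck x.1 = 0 ∧
      1 < rank n ck x.2 ∧ rank n ck x.2 + 1 < (params n d).core ∧ (params n d).doubled = 0 ∧
      x.1 ∉ forestVertices n d ∧ x = (sepFirst n d, sepSecond n d) := by
  have hn := D.feas.good.core_add
  obtain ⟨⟨s1, s2⟩, s3, s4, s5, s6, s7⟩ := D.feas.sep_spec
  unfold sepEdges at hx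
  split_ifs at hx with hz
  · simp at hx
  · rw [List.mem_singleton] at hx
    subst hx
    have hne := s7 (by omega)
    have F := D.forest
    obtain ⟨v, hv⟩ := List.exists_mem_of_ne_nil _ hne
    have hdeg := F.edgeDegree_forestEdges (nodup_forestVertices n d) hv
    have hpos := (mem_forestVertices hv).2
    obtain ⟨y, hy⟩ : ∃ y, y ∈ forestEdges ch sd par (forestVertices n d).length := by
      refine List.exists_mem_of_ne_nil _ fun h => ?_
      rw [h, edgeDegree_nil] at hdeg
      exact hpos hdeg.symm
    obtain ⟨r1, r2, r3⟩ := D.forestEdge_rank hy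
    obtain ⟨h1, -⟩ := D.keys.forestEdge_keys D.forest D.feas hy
    have r4 := D.rank_core h1.2
    have r0 : rank n ck (sepFirst n d) = 0 := by
      unfold rank
      rw [D.keys.sepFirst_eq D.feas]
      simp
    exact ⟨⟨s1, s2⟩, r0, by simp only; omega, by simp only; omega,
      D.feas.doubled_eq_zero (by omega), s4.1, rfl⟩

theorem highEdges_eq_nil (H : Feasible n d) (h : (params n d).doubled = 0) :
    highEdges (params n d) co E = [] := by
  have := H.good.tokens_eq
  unfold highEdges
  rw [List.map_eq_nil_iff, List.filter_eq_nil_iff]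
  intro s hs
  simp only [List.mem_range, decide_eq_true_eq] at hs ⊢
  omega

theorem lt_and_key_lt (D : Drawing n d ch sd par ck co E key) {x : ℕ × ℕ}
    (hx : x ∈ pageOne n d ch sd par co E ++ pageTwo n d co E) :
    (x.1 < n ∧ x.2 < n) ∧ key x.1 < key x.2 := by
  have hn := D.feas.good.core_add
  simp only [pageOne, pageTwo] at hx
  rcases List.mem_append.1 hx with hx | hx <;> rcases List.mem_append.1 hx with hx | hx
  · obtain ⟨h1, h2⟩ := D.mem_coreEdges hx
    exact ⟨by omega, (D.key_lt_iff_rank h1.1 h1.2).2 h2⟩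
  · rcases List.mem_append.1 hx with hx | hx
    · obtain ⟨s, hs, rfl, h1, h2⟩ := D.mem_lowEdges hx
      have h3 := tokenId_spec D.feas hs
      exact ⟨by simp only; omega, by simp only [h2]; exact (D.key_token_mem hs).1⟩
    · have := D.mem_pseudoEdges hx
      omega
  · obtain ⟨h1, h2, h3, -⟩ := D.sepEdge_spec hx
    exact ⟨by omega, (D.key_lt_iff_rank h1.1 h1.2).2 (by omega)⟩
  · obtain ⟨s, hs, hs', rfl, h1, h2⟩ := D.mem_highEdges hx
    have h3 := tokenId_spec D.feas hs
    have h4 := (D.key_token_mem hs).2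
    have h5 := D.tokenData.owner_low_lt hs
    change lowBlock _ _ _ < highBlock _ _ _ at h5
    have h6 := D.tokenData.mono (k := lowBlock (params n d) E s + 1) h5
      (D.highBlock_lt hs hs').le
    exact ⟨by simp only; omega, by simp only [h2]; omega⟩

/-- A cycle edge joins neighbours or the two extreme vertices of the core order, so it interleaves
with no edge between core vertices. -/
theorem nonCrossing_coreEdges (D : Drawing n d ch sd par ck co E key) :
    NonCrossing key (forestEdges ch sd par (forestVertices n d).length ++
      cycleEdges (params n d).core co) := by
  intro x hx y hy
  obtain ⟨⟨x1, x2⟩, x3⟩ := D.mem_coreEdges hx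
  obtain ⟨⟨y1, y2⟩, y3⟩ := D.mem_coreEdges hy
  have rx := D.rank_core x2
  have ry := D.rank_core y2
  rcases List.mem_append.1 hx with h | h
  · rcases List.mem_append.1 hy with h' | h'
    · rw [D.key_lt_iff x1 y1, D.key_lt_iff y1 x2, D.key_lt_iff x2 y2]
      exact D.keys.nonCrossing_forestEdges D.forest D.feas x h y h'
    · have := (D.mem_cycleEdges h').2
      rw [D.key_lt_iff_rank x1 y1, D.key_lt_iff_rank y1 x2, D.key_lt_iff_rank x2 y2]
      omega
  · have := (D.mem_cycleEdges h).2
    rw [D.key_lt_iff_rank x1 y1, D.key_lt_iff_rank y1 x2, D.key_lt_iff_rank x2 y2]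
    omega

/-- A low edge passes over no core vertex, so it meets no core edge; two low edges at the same core
vertex share an end, and otherwise they lie in different gaps. A pseudo edge joins consecutive keys
and encloses nothing. -/
theorem nonCrossing_pageOne (D : Drawing n d ch sd par ck co E key) :
    NonCrossing key (pageOne n d ch sd par co E) := by
  intro x hx y hy
  rcases List.mem_append.1 hx with hx | hx
  · obtain ⟨⟨x1, x2⟩, -⟩ := D.mem_coreEdges hx
    rcases List.mem_append.1 hy with hy | hy
    · exact D.nonCrossing_coreEdges x hx y hy
    · rcases List.mem_append.1 hy with hy | hy
      · obtain ⟨s, hs, rfl, h1, h2⟩ := D.mem_lowEdges hy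
        have := D.core_key_not_between hs x2
        simp only [h2]
        omega
      · have := (D.mem_pseudoEdges hy).2
        omega
  · rcases List.mem_append.1 hx with hx | hx
    · obtain ⟨s, hs, rfl, h1, h2⟩ := D.mem_lowEdges hx
      rcases List.mem_append.1 hy with hy | hy
      · obtain ⟨⟨y1, y2⟩, -⟩ := D.mem_coreEdges hy
        have := D.core_key_not_between hs y1
        simp only [h2]
        omega
      · rcases List.mem_append.1 hy with hy | hy
        · obtain ⟨s', hs', rfl, h1', h2'⟩ := D.mem_lowEdges hy
          have := D.core_key_not_between hs h1'
          simp only [h2, h2'] at this ⊢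
          omega
        · have := (D.mem_pseudoEdges hy).2
          omega
    · have := (D.mem_pseudoEdges hx).2
      omega

/-- The page is either the single edge between the separators or the set of high edges. Crossing
high edges would give crossing pairs of half-edges, as keys and owners are monotone in the
half-edges. -/
theorem nonCrossing_pageTwo (D : Drawing n d ch sd par ck co E key) :
    NonCrossing key (pageTwo n d co E) := by
  intro x hx y hy
  rcases List.mem_append.1 hx with hx | hx
  · obtain ⟨-, -, -, -, h0, -, hx⟩ := D.sepEdge_spec hx
    rw [pageTwo, highEdges_eq_nil D.feas h0, List.append_nil] at hy
    obtain ⟨-, -, -, -, -, -, hy⟩ := D.sepEdge_spec hy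
    rw [hx, hy]
    omega
  · rcases List.mem_append.1 hy with hy | hy
    · obtain ⟨-, -, -, -, h0, -⟩ := D.sepEdge_spec hy
      rw [highEdges_eq_nil D.feas h0] at hx
      simp at hx
    · obtain ⟨s, hs, hs1, rfl, h1, h2⟩ := D.mem_highEdges hx
      obtain ⟨s', hs', hs1', rfl, h1', h2'⟩ := D.mem_highEdges hy
      have hb := D.highBlock_lt hs hs1
      have hb' := D.highBlock_lt hs' hs1'
      rintro ⟨l1, l2, l3⟩
      simp only at l1 l2 l3
      rw [D.low_lt_iff hs hs'] at l1
      have l4 : lowBlock (params n d) E s' < highBlock (params n d) E s := by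
        by_contra hcon
        have := D.tokenData.mono (not_lt.1 hcon) (D.lowBlock_lt hs').le
        have := (D.key_token_mem hs').1
        omega
      have l5 : highBlock (params n d) E s < highBlock (params n d) E s' := by
        by_contra hcon
        have := D.tokenData.mono (not_lt.1 hcon) hb.le
        omega
      obtain ⟨m1, m2, m3, -⟩ := D.tokenData.mid (by omega)
      refine absurd (token_nonCrossing m1 m2 m3 hs hs' l1 ?_) fun hlt => ?_
      · by_contra hcon
        have := D.tokenData.owner_mono (not_lt.1 hcon)
        change highBlock _ _ _ ≤ lowBlock _ _ _ at this
        omega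
      · have := D.tokenData.owner_mono hlt.le
        change highBlock _ _ _ ≤ highBlock _ _ _ at this
        omega

theorem nodup_cycleEdges (D : Drawing n d ch sd par ck co E key) :
    (cycleEdges (params n d).core co).Nodup := by
  have hc := D.feas.good.core_ge
  refine List.nodup_append'.2 ⟨?_, List.nodup_singleton _, ?_⟩
  · refine List.Nodup.map_on (fun k hk l hl h => ?_) List.nodup_range
    simp only [List.mem_range] at hk hl
    exact D.co_inj (by omega) (by omega) (Prod.ext_iff.1 h).1
  · intro x h1 h2
    simp only [List.mem_map, List.mem_range] at h1
    obtain ⟨k, hk, rfl⟩ := h1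
    rw [List.mem_singleton, Prod.mk.injEq] at h2
    have e1 := D.co_inj (by omega) (by omega) h2.1
    have e2 := D.co_inj (by omega) (by omega) h2.2
    omega

theorem nodup_pages (D : Drawing n d ch sd par ck co E key) :
    (pageOne n d ch sd par co E ++ pageTwo n d co E).Nodup := by
  have F := D.forest
  refine List.nodup_append'.2 ⟨List.nodup_append'.2 ⟨List.nodup_append'.2
    ⟨F.nodup_forestEdges (nodup_forestVertices n d), D.nodup_cycleEdges, ?_⟩,
    List.nodup_append'.2 ⟨?_, ?_, ?_⟩, ?_⟩, List.nodup_append'.2 ⟨?_, ?_, ?_⟩, ?_⟩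
  · intro x h1 h2
    have := D.forestEdge_rank h1
    have := (D.mem_cycleEdges h2).2
    have := D.rank_core (D.mem_cycleEdges h2).1.2
    omega
  · refine List.Nodup.map_on (fun s hs s' hs' h => ?_) List.nodup_range
    exact tokenId_inj D.feas (by simpa using hs) (by simpa using hs') (Prod.ext_iff.1 h).2
  · refine List.Nodup.map_on (fun i _ j _ h => ?_) (List.nodup_range.filter _)
    have := (Prod.ext_iff.1 h).1
    simp only at this
    omega
  · intro x h1 h2
    obtain ⟨s, hs, rfl, h3, -⟩ := D.mem_lowEdges h1
    have := (D.mem_pseudoEdges h2).1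
    simp only at this
    omega
  · intro x h1 h2
    have h3 := (D.mem_coreEdges h1).1
    rcases List.mem_append.1 h2 with h2 | h2
    · obtain ⟨s, hs, rfl, -⟩ := D.mem_lowEdges h2
      have := tokenId_spec D.feas hs
      simp only at h3
      omega
    · have := (D.mem_pseudoEdges h2).1
      omega
  · unfold sepEdges
    split_ifs <;> simp
  · refine List.Nodup.map_on (fun s hs s' hs' h => ?_) (List.nodup_range.filter _)
    simp only [List.mem_filter, List.mem_range] at hs hs'
    exact tokenId_inj D.feas hs.1 hs'.1 (Prod.ext_iff.1 h).1
  · intro x h1 h2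
    obtain ⟨-, -, -, -, h0, -⟩ := D.sepEdge_spec h1
    rw [highEdges_eq_nil D.feas h0] at h2
    simp at h2
  · intro x h1 h2
    rcases List.mem_append.1 h2 with h2 | h2
    · obtain ⟨⟨e1, e2⟩, r1, r2, r3, -, e3, -⟩ := D.sepEdge_spec h2
      rcases List.mem_append.1 h1 with h1 | h1
      · rcases List.mem_append.1 h1 with h1 | h1
        · have := D.forestEdge_rank h1
          omega
        · have := (D.mem_cycleEdges h1).2
          omega
      · rcases List.mem_append.1 h1 with h1 | h1
        · obtain ⟨s, hs, rfl, -⟩ := D.mem_lowEdges h1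
          have := tokenId_spec D.feas hs
          simp only at e2
          omega
        · have := (D.mem_pseudoEdges h1).1
          omega
    · obtain ⟨s, hs, -, rfl, h3, -⟩ := D.mem_highEdges h2
      have h4 := tokenId_spec D.feas hs
      rcases List.mem_append.1 h1 with h1 | h1
      · have := (D.mem_coreEdges h1).1
        simp only at this
        omega
      · rcases List.mem_append.1 h1 with h1 | h1
        · obtain ⟨s', hs', e, h5, -⟩ := D.mem_lowEdges h1
          have := (Prod.ext_iff.1 e).1
          simp only at this
          omega
        · have := (D.mem_pseudoEdges h1).1
          simp only at this
          omega

end Drawing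

theorem edgeDegree_eq_zero {l : List (ℕ × ℕ)} {v : ℕ} (h : ∀ x ∈ l, x.1 ≠ v ∧ x.2 ≠ v) :
    edgeDegree l v = 0 := by
  induction l with
  | nil => rfl
  | cons x l ih =>
    have := h x (by simp)
    rw [edgeDegree_cons, if_neg this.1, if_neg this.2, ih fun y hy => h y (by simp [hy])]

namespace Drawing

variable {n : ℕ} {d ch sd par ck co E key : ℕ → ℕ}

theorem edgeDegree_cycleEdges (D : Drawing n d ch sd par ck co E key) {v : ℕ}
    (hv : v < (params n d).core) : edgeDegree (cycleEdges (params n d).core co) v = 2 := by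
  have hc := D.feas.good.core_ge
  have hr := D.rank_core hv
  rw [cycleEdges, edgeDegree_append, edgeDegree_map_range, edgeDegree_cons, edgeDegree_nil]
  simp only
  -- A vertex of rank `r` is the start of edge `r` and the end of edge `r - 1`. The vertices of rank
  -- `0` and `core - 1` miss one of these and get the closing edge instead.
  have h1 : ∀ k ∈ Finset.range ((params n d).core - 1),
      ((if co k = v then 1 else 0) + (if co (k + 1) = v then 1 else 0)) =
      (if k = rank n ck v then 1 else 0) +
        (if k = rank n ck v - 1 then (if rank n ck v = 0 then 0 else 1) else 0) := by
    intro k hk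
    simp only [Finset.mem_range] at hk
    simp only [D.co_eq_iff (k := k) (by omega) hv, D.co_eq_iff (k := k + 1) (by omega) hv]
    split_ifs <;> omega
  rw [Finset.sum_congr rfl h1, Finset.sum_add_distrib, Finset.sum_ite_eq', Finset.sum_ite_eq']
  simp only [D.co_eq_iff (k := 0) (by omega) hv,
    D.co_eq_iff (k := (params n d).core - 1) (by omega) hv, Finset.mem_range]
  split_ifs <;> omega

/-- Each half-edge of the block of `v` belongs to exactly one token, as its first or its second
half-edge, so the degree is the length of the block. -/
theorem edgeDegree_tokens_core (D : Drawing n d ch sd par ck co E key) {v : ℕ}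
    (hv : v < (params n d).core) :
    edgeDegree (lowEdges (params n d) co E) v + edgeDegree (highEdges (params n d) co E) v =
      share n d v := by
  have hc := D.feas.good.core_add
  have hr := D.rank_core hv
  have B := D.tokenData
  rw [lowEdges, highEdges, edgeDegree_map_range, edgeDegree_map_filter_range,
    ← Finset.sum_add_distrib]
  simp only
  have h1 : ∀ s ∈ Finset.range (params n d).tokens,
      (if co (lowBlock (params n d) E s) = v then 1 else 0) +
          (if tokenId (params n d) s = v then 1 else 0) +
        (if (params n d).pend ≤ s then (if tokenId (params n d) s = v then 1 else 0) +
          (if co (highBlock (params n d) E s) = v then 1 else 0) else 0) =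
      (if lowBlock (params n d) E s = rank n ck v then 1 else 0) +
        (if highBlock (params n d) E s = rank n ck v then 1 else 0) := by
    intro s hs
    simp only [Finset.mem_range] at hs
    have e1 := D.co_eq_iff (D.lowBlock_lt hs) hv
    have e2 := tokenId_spec D.feas hs
    simp only [e1, if_neg (show tokenId (params n d) s ≠ v by omega)]
    by_cases hp : (params n d).pend ≤ s
    · simp only [if_pos hp, D.co_eq_iff (D.highBlock_lt hs hp) hv]
      omega
    -- The second half-edge of a pendant token lies in the dummy block, so it counts at no core
    -- vertex.
    · have e3 : highBlock (params n d) E s = (params n d).core :=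
        (B.owner_high_eq_iff hs).2 (by omega)
      rw [if_neg hp, if_neg (show ¬ highBlock (params n d) E s = rank n ck v by omega)]
  rw [Finset.sum_congr rfl h1]
  have hE := D.E_succ _ hr
  rw [D.co_rank v (by omega)] at hE
  rcases Nat.eq_zero_or_pos (params n d).tokens with h0 | h0
  · have := share_le_tokens n d v
    rw [h0]
    simp only [Finset.range_zero, Finset.sum_empty]
    omega
  · obtain ⟨m1, m2, m3, -⟩ := B.mid h0
    have := sum_tokens m1 m2 m3
      (fun j => if owner (params n d).core E j = rank n ck v then 1 else 0)
    refine this.trans ?_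
    have ht := B.total
    rw [B.sum_owner hr (by omega)]
    omega

theorem edgeDegree_lowEdges_token (D : Drawing n d ch sd par ck co E key) {s : ℕ}
    (hs : s < (params n d).tokens) :
    edgeDegree (lowEdges (params n d) co E) (tokenId (params n d) s) = 1 := by
  have h2 := tokenId_spec D.feas hs
  rw [lowEdges, edgeDegree_map_range]
  have h1 : ∀ t ∈ Finset.range (params n d).tokens,
      (if (co (lowBlock (params n d) E t), tokenId (params n d) t).1 = tokenId (params n d) s
        then 1 else 0) +
      (if (co (lowBlock (params n d) E t), tokenId (params n d) t).2 = tokenId (params n d) s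
        then 1 else 0) = if t = s then 1 else 0 := by
    intro t ht
    simp only [Finset.mem_range] at ht
    have e1 := (D.co_spec (D.lowBlock_lt ht)).1
    rw [if_neg (by simp only; omega), zero_add]
    by_cases hts : t = s
    · rw [if_pos (by rw [hts]), if_pos hts]
    · rw [if_neg (fun h => hts (tokenId_inj D.feas ht hs h)), if_neg hts]
  rw [Finset.sum_congr rfl h1, Finset.sum_ite_eq', if_pos (by simpa using hs)]

theorem edgeDegree_highEdges_token (D : Drawing n d ch sd par ck co E key) {s : ℕ}
    (hs : s < (params n d).tokens) :
    edgeDegree (highEdges (params n d) co E) (tokenId (params n d) s) =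
      if (params n d).pend ≤ s then 1 else 0 := by
  have h2 := tokenId_spec D.feas hs
  rw [highEdges, edgeDegree_map_filter_range]
  have h1 : ∀ t ∈ Finset.range (params n d).tokens,
      (if (params n d).pend ≤ t then
        (if (tokenId (params n d) t, co (highBlock (params n d) E t)).1 = tokenId (params n d) s
          then 1 else 0) +
        (if (tokenId (params n d) t, co (highBlock (params n d) E t)).2 = tokenId (params n d) s
          then 1 else 0) else 0) =
      if t = s then (if (params n d).pend ≤ s then 1 else 0) else 0 := by
    intro t ht
    simp only [Finset.mem_range] at ht
    by_cases hp : (params n d).pend ≤ t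
    · have e1 := (D.co_spec (D.highBlock_lt ht hp)).1
      rw [if_pos hp,
        if_neg (show ¬ co (highBlock (params n d) E t) = tokenId (params n d) s by omega), add_zero]
      by_cases hts : t = s
      · rw [if_pos (by rw [hts]), if_pos hts, if_pos (hts ▸ hp)]
      · rw [if_neg (fun h => hts (tokenId_inj D.feas ht hs h)), if_neg hts]
    · rw [if_neg hp]
      by_cases hts : t = s
      · rw [if_pos hts, if_neg (hts ▸ hp)]
      · rw [if_neg hts]
  rw [Finset.sum_congr rfl h1, Finset.sum_ite_eq', if_pos (by simpa using hs)]

theorem edgeDegree_pseudoEdges (H : Feasible n d) (s : ℕ) :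
    edgeDegree (pseudoEdges n (params n d)) ((params n d).core + (params n d).doubled + s) =
      if s < (params n d).pseudo then 1 else 0 := by
  have G := H.good
  obtain ⟨q, hq⟩ := G.pseudo_even
  have g1 := G.pend_eq
  have g2 := G.core_add
  have g3 := G.tokens_eq
  rw [pseudoEdges, edgeDegree_map_filter_range]
  have h1 : ∀ i ∈ Finset.range n,
      (if 2 * i + 1 < (params n d).pseudo then
        (if ((params n d).core + (params n d).doubled + 2 * i,
          (params n d).core + (params n d).doubled + (2 * i + 1)).1 =
            (params n d).core + (params n d).doubled + s then 1 else 0) +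
        (if ((params n d).core + (params n d).doubled + 2 * i,
          (params n d).core + (params n d).doubled + (2 * i + 1)).2 =
            (params n d).core + (params n d).doubled + s then 1 else 0) else 0) =
      if i = s / 2 then (if s < (params n d).pseudo then 1 else 0) else 0 := by
    intro i _
    simp only
    split_ifs <;> omega
  rw [Finset.sum_congr rfl h1, Finset.sum_ite_eq']
  simp only [Finset.mem_range]
  split_ifs <;> omega

theorem edgeDegree_pages (D : Drawing n d ch sd par ck co E key) {v : ℕ} (hv : v < n) :
    edgeDegree (pageOne n d ch sd par co E ++ pageTwo n d co E) v = d v := by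
  have G := D.feas.good
  have g1 := G.pend_eq
  have g2 := G.core_add
  have g3 := G.tokens_eq
  have g4 := G.high_le
  have F := D.forest
  have two := D.feas.lt_sub_ones_iff hv
  have three := D.feas.lt_high_iff hv
  have pos := D.feas.pos v hv
  simp only [pageOne, pageTwo, edgeDegree_append]
  by_cases hc : v < (params n d).core
  -- At a core vertex: two from the cycle, the share from the tokens, and the rest of the excess
  -- from the forest, or from the separating edge if the vertex was skipped. An entry `1` is never
  -- in the core.
  · have h1 := D.edgeDegree_cycleEdges hc
    have h2 := D.edgeDegree_tokens_core hc
    have h3 : edgeDegree (pseudoEdges n (params n d)) v = 0 := edgeDegree_eq_zero fun x hx => by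
      have := (D.mem_pseudoEdges hx).1
      omega
    have h4 : edgeDegree (forestEdges ch sd par (forestVertices n d).length) v +
        edgeDegree (sepEdges n d) v = forestDegree n d v := by
      obtain ⟨-, -, -, s1, s2, -⟩ := D.feas.sep_spec
      by_cases hf : v ∈ forestVertices n d
      · rw [F.edgeDegree_forestEdges (nodup_forestVertices n d) hf, s2 v hf, add_zero]
      · rw [F.edgeDegree_forestEdges_of_notMem hf, s1 v hc hf, zero_add]
    have h5 := share_le n d v
    have h6 : forestDegree n d v = d v - 2 - share n d v := rfl
    omega
  · have h1 : edgeDegree (cycleEdges (params n d).core co) v = 0 :=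
      edgeDegree_eq_zero fun x hx => by
        have := (D.mem_cycleEdges hx).1
        omega
    have h2 : edgeDegree (forestEdges ch sd par (forestVertices n d).length) v = 0 :=
      F.edgeDegree_forestEdges_of_notMem fun h => hc (mem_forestVertices h).1
    have h3 : edgeDegree (sepEdges n d) v = 0 := edgeDegree_eq_zero fun x hx => by
      have := (D.sepEdge_spec hx).1
      omega
    obtain ⟨s, hs, rfl⟩ := exists_tokenId D.feas (not_lt.1 hc) hv
    rw [h1, h2, h3, D.edgeDegree_lowEdges_token hs, D.edgeDegree_highEdges_token hs]
    by_cases hp : (params n d).pend ≤ s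
    · have e : tokenId (params n d) s = (params n d).core + (s - (params n d).pend) := by
        rw [tokenId, if_neg (by omega)]
      have h4 : edgeDegree (pseudoEdges n (params n d)) (tokenId (params n d) s) = 0 :=
        edgeDegree_eq_zero fun x hx => by
          simp only [pseudoEdges, List.mem_map] at hx
          obtain ⟨i, -, rfl⟩ := hx
          simp only
          omega
      rw [h4, if_pos hp]
      omega
    · have e : tokenId (params n d) s = (params n d).core + (params n d).doubled + s := by
        rw [tokenId, if_pos (by omega)]
      have h4 := edgeDegree_pseudoEdges D.feas s
      rw [← e] at h4
      rw [h4, if_neg hp]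
      split_ifs <;> omega

/-- The drawing is a 2-page book embedding of a realization. -/
theorem isTwoPageRealization (D : Drawing n d ch sd par ck co E key) {δ : Fin n → ℕ}
    (hδ : ∀ v : Fin n, d v = δ v) :
    ∃ pos : Equiv.Perm (Fin n), (∀ v : Fin n, (pos v : ℕ) = rank n key v) ∧
      IsTwoPageRealization δ pos (graphOfList n (pageOne n d ch sd par co E))
        (graphOfList n (pageTwo n d co E)) := by
  obtain ⟨pos, h1, h2⟩ := exists_perm_rank D.key_inj
  exact ⟨pos, h1, isTwoPageRealization_of_lists h2 (fun x hx => (D.lt_and_key_lt hx).1)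
    (fun x hx => (D.lt_and_key_lt hx).2) D.nodup_pages
    (fun v => (D.edgeDegree_pages v.2).trans (hδ v)) D.nonCrossing_pageOne D.nonCrossing_pageTwo⟩

end Drawing

namespace RAM

/-! ### Building blocks of programs -/

/-- `if e ≠ 0 then x else y`, provided that cell `0` of array `47` is `0` and cell `1` is large. -/
def Expr.ite (e x y : Expr) : Expr :=
  .add (Expr.min x (.read 47 (.sub (.const 1) (.sub (.const 1) e))))
    (Expr.min y (.read 47 (.sub (.const 1) e)))

/-- The index into array `47` is `0` or `1` according to `e`, so taking the minimum with that cell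
either suppresses a summand or leaves it unchanged. -/
theorem Expr.eval_ite {e x y : Expr} {s : State} {B : ℕ} (h0 : s 47 0 = 0) (h1 : s 47 1 = B)
    (hx : e.eval s ≠ 0 → x.eval s ≤ B) (hy : e.eval s = 0 → y.eval s ≤ B) :
    (Expr.ite e x y).eval s = if e.eval s ≠ 0 then x.eval s else y.eval s := by
  simp only [Expr.ite, Expr.eval, Expr.eval_min]
  by_cases he : e.eval s = 0
  · simp [he, h0, h1, hy he]
  · have h2 : 1 - e.eval s = 0 := by omega
    simp [he, h2, h0, h1, hx he]

/-- Stores the value of `e` in cell `idx` of array `a`, for `c = 0, …, b - 1`. -/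
def Cmd.scatter (c : ℕ) (b : Expr) (a : ℕ) (idx e : Expr) : Cmd := .loop c b (.write a idx e)

theorem Cmd.scatter_spec {c a m : ℕ} {b idx e : Expr} {s : State} {f g : ℕ → ℕ} (hca : a ≠ c)
    (hm : b.eval s = m) (hm2 : m ≤ 2 * s 0 0)
    (he : ∀ i < m, ∀ t : State, (∀ x ∉ [a, c], t x = s x) → t c 0 = i →
      idx.eval t = g i ∧ e.eval t = f i)
    (hg : ∀ i < m, ∀ j < m, g i = g j → i = j) :
    (∀ i < m, (Cmd.scatter c b a idx e).run s a (g i) = f i) ∧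
      ∀ x, (∀ i < m, g i ≠ x) → (Cmd.scatter c b a idx e).run s a x = s a x := by
  refine Cmd.loop_induction m hm hm2 (fun k t => (∀ i < k, t a (g i) = f i) ∧
    ∀ x, (∀ i < k, g i ≠ x) → t a x = s a x) ⟨by simp, by simp⟩ ?_ ?_
  · rintro k hk t ht ⟨h1, h2⟩
    obtain ⟨e1, e2⟩ := he k hk (t.set c 0 k) (fun x hx => by
      simp only [List.mem_cons, List.not_mem_nil, or_false, not_or] at hx
      rw [State.set_of_ne _ _ _ hx.2, ht x (by simpa [Cmd.writes, and_comm] using hx)])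
      (by simp [State.set_apply])
    simp only [Cmd.run, e1, e2, State.set_apply, true_and]
    refine ⟨fun i hi => ?_, fun x hx => ?_⟩
    · by_cases hik : i = k
      · simp [hik]
      · rw [if_neg fun h => hik (hg i (by omega) k hk h), if_neg (by simp [hca])]
        exact h1 i (by omega)
    · rw [if_neg (hx k (by omega)).symm, if_neg (by simp [hca])]
      exact h2 x fun i hi => hx i (by omega)
  · intro t h
    rwa [State.set_of_ne _ _ _ hca]

/-- Stores the value of `e` in cell `c` of array `a`, for `c = 0, …, b - 1`. -/
def Cmd.tabulate (c : ℕ) (b : Expr) (a : ℕ) (e : Expr) : Cmd := .scatter c b a (.var c) e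

theorem Cmd.tabulate_spec {c a m : ℕ} {b e : Expr} {s : State} {f : ℕ → ℕ} (hca : a ≠ c)
    (hm : b.eval s = m) (hm2 : m ≤ 2 * s 0 0)
    (he : ∀ i < m, ∀ t : State, (∀ x ∉ [a, c], t x = s x) → t c 0 = i → e.eval t = f i) :
    ∀ i < m, (Cmd.tabulate c b a e).run s a i = f i :=
  (Cmd.scatter_spec (g := id) (idx := .var c) hca hm hm2 (fun i hi t h1 h2 => ⟨h2, he i hi t h1 h2⟩)
    (fun _ _ _ _ h => h)).1

/-- Stores the sum of the values of `e` for `c = 0, …, b - 1` in cell `0` of array `a`. -/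
def Cmd.sum (c : ℕ) (b : Expr) (a : ℕ) (e : Expr) : Cmd :=
  .seq (.write a (.const 0) (.const 0)) (.loop c b (.write a (.const 0) (.add (.var a) e)))

theorem Cmd.sum_spec {c a m : ℕ} {b e : Expr} {s : State} {f : ℕ → ℕ} (hca : a ≠ c) (ha : a ≠ 0)
    (hm : ∀ t : State, (∀ x ∉ [a, c], t x = s x) → t c 0 = s c 0 → b.eval t = m)
    (hm2 : m ≤ 2 * s 0 0)
    (he : ∀ i < m, ∀ t : State, (∀ x ∉ [a, c], t x = s x) → t c 0 = i → e.eval t = f i) :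
    (Cmd.sum c b a e).run s a 0 = ∑ i ∈ Finset.range m, f i := by
  have hs : ∀ x ∉ [a, c], s.set a 0 0 x = s x := fun x hx => by
    simp only [List.mem_cons, not_or] at hx
    rw [State.set_of_ne _ _ _ hx.1]
  refine Cmd.loop_induction m (hm _ hs (by rw [State.set_of_ne _ _ _ hca.symm]))
    (by rwa [State.set_of_ne _ _ _ ha.symm])
    (fun k t => t a 0 = ∑ i ∈ Finset.range k, f i) ?_ ?_ ?_
  · simp [State.set_apply]
  · intro k hk t ht h
    have e1 := he k hk (t.set c 0 k) (fun x hx => by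
      rw [← hs x hx]
      simp only [List.mem_cons, List.not_mem_nil, or_false, not_or] at hx
      rw [State.set_of_ne _ _ _ hx.2, ht x (by simpa [Cmd.writes, and_comm] using hx)])
      (by simp [State.set_apply])
    simp only [Cmd.run, Expr.eval, Expr.eval_var, e1]
    rw [State.set_apply, if_pos ⟨rfl, rfl⟩, State.set_of_ne _ _ _ hca, h, Finset.sum_range_succ]
  · intro t h
    rwa [State.set_of_ne _ _ _ hca]

/-- For `c = 0, …, b - 1` stores the sum of the values of `e` for `c' = 0, …, b' - 1` in cell `c` of
array `a`. The sum is computed in array `62`. -/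
def Cmd.sumTable (c : ℕ) (b : Expr) (c' : ℕ) (b' : Expr) (a : ℕ) (e : Expr) : Cmd :=
  .loop c b (.seq (.sum c' b' 62 e) (.write a (.var c) (.var 62)))

theorem Cmd.sumTable_spec {c c' a m : ℕ} {b b' e : Expr} {s : State} {m' : ℕ → ℕ} {f : ℕ → ℕ → ℕ}
    (hc : [a, c, c', 62, 0].Nodup) (hm : b.eval s = m) (hm2 : m ≤ 2 * s 0 0)
    (hm' : ∀ i < m, m' i ≤ 2 * s 0 0 ∧
      ∀ t : State, (∀ x ∉ [a, c, c', 62], t x = s x) → t c 0 = i → b'.eval t = m' i)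
    (he : ∀ i < m, ∀ j < m' i, ∀ t : State, (∀ x ∉ [a, c, c', 62], t x = s x) → t c 0 = i →
      t c' 0 = j → e.eval t = f i j) :
    ∀ i < m, (Cmd.sumTable c b c' b' a e).run s a i = ∑ j ∈ Finset.range (m' i), f i j := by
  simp only [List.nodup_cons, List.mem_cons, List.not_mem_nil, or_false, not_or,
    List.nodup_nil, and_true, not_false_eq_true] at hc
  obtain ⟨⟨ac, ac', a62, a0⟩, ⟨cc', c62, c0⟩, ⟨c'62, c'0⟩, -⟩ := hc
  refine Cmd.loop_induction m hm hm2 (fun k t => ∀ i < k, t a i = ∑ j ∈ Finset.range (m' i), f i j)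
    (by simp) ?_ ?_
  · intro k hk t ht h
    have hw : (Cmd.sum c' b' 62 e).writes = [62, c', 62] := rfl
    have h0 : ∀ x ∉ [a, c, c', 62], t.set c 0 k x = s x := fun x hx => by
      simp only [List.mem_cons, List.not_mem_nil, or_false, not_or] at hx
      rw [State.set_of_ne _ _ _ hx.2.1]
      exact ht x (by simp [Cmd.writes, hw, hx])
    have h1 := Cmd.sum_spec (c := c') (a := 62) (b := b') (e := e) (s := t.set c 0 k) (m := m' k)
      (f := f k) (Ne.symm c'62) (by decide)
      (fun u hu _ => (hm' k hk).2 u (fun x hx => by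
        rw [← h0 x hx]
        simp only [List.mem_cons, List.not_mem_nil, or_false, not_or] at hx
        exact hu x (by simp [hx]))
        (by rw [hu c (by simp [cc', c62])]; simp [State.set_apply]))
      (by rw [h0 0 (by simp [Ne.symm a0, Ne.symm c0, Ne.symm c'0])]; exact (hm' k hk).1)
      (fun j hj u hu huj => he k hk j hj u (fun x hx => by
        rw [← h0 x hx]
        simp only [List.mem_cons, List.not_mem_nil, or_false, not_or] at hx
        exact hu x (by simp [hx]))
        (by rw [hu c (by simp [cc', c62])]; simp [State.set_apply]) huj)
    have h2 : (Cmd.sum c' b' 62 e).run (t.set c 0 k) c 0 = k := by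
      rw [Cmd.run_frame _ (by simp [hw, cc', c62])]
      simp [State.set_apply]
    have h3 : (Cmd.sum c' b' 62 e).run (t.set c 0 k) a = t a := by
      rw [Cmd.run_frame _ (by simp [hw, ac', a62]), State.set_of_ne _ _ _ ac]
    intro i hi
    rw [Cmd.run, Cmd.run, State.set_apply]
    simp only [Expr.eval_var, h1, h2, h3, true_and]
    split_ifs with hik
    · rw [hik]
    · exact h i (by omega)
  · intro t h
    rwa [State.set_of_ne _ _ _ ac]

/-- The list in the first `s c 0` cells of array `a`. -/
def entries (s : State) (c a : ℕ) : List ℕ := (List.range (s c 0)).map (s a)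

/-- The list of the pairs in the first `s c 0` cells of the arrays `a` and `b`. -/
def pairs (s : State) (c a b : ℕ) : List (ℕ × ℕ) :=
  (List.range (s c 0)).map fun k => (s a k, s b k)

theorem pairs_congr {s t : State} {c a b : ℕ} (hc : t c = s c) (ha : t a = s a) (hb : t b = s b) :
    pairs t c a b = pairs s c a b := by rw [pairs, pairs, hc, ha, hb]

/-- Appends the pair `(u, v)` to the list in the arrays `k`, `x`, `y`. -/
def Cmd.emit (k x y : ℕ) (u v : Expr) : Cmd :=
  .seq (.write x (.var k) u) (.seq (.write y (.var k) v)
    (.write k (.const 0) (.add (.var k) (.const 1))))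

theorem Cmd.emit_spec {k x y : ℕ} {u v : Expr} {s : State} {a b : ℕ} (hd : [k, x, y].Nodup)
    (hu : u.eval s = a) (hv : ∀ t : State, (∀ z ∉ [x], t z = s z) → v.eval t = b) :
    pairs ((Cmd.emit k x y u v).run s) k x y = pairs s k x y ++ [(a, b)] := by
  simp only [List.nodup_cons, List.mem_cons, List.not_mem_nil, or_false, not_or,
    List.nodup_nil, and_true, not_false_eq_true] at hd
  obtain ⟨⟨kx, ky⟩, xy⟩ := hd
  have hv' := hv (s.set x (s k 0) a) fun z hz => State.set_of_ne _ _ _ (by simpa using hz)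
  simp only [Cmd.emit, Cmd.run, Expr.eval, Expr.eval_var, hu]
  rw [State.set_of_ne _ _ _ ky, State.set_of_ne _ _ _ kx, hv']
  simp only [pairs, State.set_apply, kx, ky, Ne.symm kx, Ne.symm ky, xy, Ne.symm xy, false_and,
    true_and, if_false, and_true, if_true]
  rw [List.range_succ, List.map_append, List.map_singleton]
  congr 1
  · refine List.map_congr_left fun i hi => ?_
    simp only [List.mem_range] at hi
    rw [if_neg (by omega), if_neg (by omega)]
  · simp

/-- Appends the pairs `(u, v)` with `q ≠ 0` for `c = 0, …, b - 1`. -/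
def Cmd.emits (c : ℕ) (b : Expr) (k x y : ℕ) (q u v : Expr) : Cmd :=
  .loop c b (.branch q (.emit k x y u v) .skip)

theorem Cmd.emits_spec {c k x y m : ℕ} {b q u v : Expr} {s : State} {p : ℕ → Prop}
    [DecidablePred p] {f : ℕ → ℕ × ℕ} (hd : [k, x, y, c].Nodup)
    (hm : b.eval s = m) (hm2 : m ≤ 2 * s 0 0)
    (he : ∀ i < m, ∀ t : State, (∀ z ∉ [k, x, y, c], t z = s z) → t c 0 = i →
      (q.eval t ≠ 0 ↔ p i) ∧ (p i → u.eval t = (f i).1 ∧ v.eval t = (f i).2)) :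
    pairs ((Cmd.emits c b k x y q u v).run s) k x y =
      pairs s k x y ++ ((List.range m).filter fun i => p i).map f := by
  have hd' := hd
  simp only [List.nodup_cons, List.mem_cons, List.not_mem_nil, or_false, not_or,
    List.nodup_nil, and_true, not_false_eq_true] at hd'
  obtain ⟨⟨kx, ky, kc⟩, ⟨xy, xc⟩, yc⟩ := hd'
  refine Cmd.loop_induction m hm hm2 (fun j t => pairs t k x y =
      pairs s k x y ++ ((List.range j).filter fun i => p i).map f) (by simp) ?_ ?_
  · intro j hj t ht h
    have hset : pairs (t.set c 0 j) k x y = pairs t k x y :=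
      pairs_congr (State.set_of_ne _ _ _ kc) (State.set_of_ne _ _ _ xc) (State.set_of_ne _ _ _ yc)
    have h0 : ∀ z ∉ [k, x, y, c], t.set c 0 j z = s z := fun z hz => by
      simp only [List.mem_cons, List.not_mem_nil, or_false, not_or] at hz
      rw [State.set_of_ne _ _ _ hz.2.2.2]
      exact ht z (by simp [Cmd.writes, Cmd.emit, hz])
    have hj0 : t.set c 0 j c 0 = j := by simp [State.set_apply]
    obtain ⟨h1, h2⟩ := he j hj _ h0 hj0
    rw [List.range_succ, List.filter_append, List.map_append, ← List.append_assoc, ← h, ← hset,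
      Cmd.run]
    by_cases hp : p j
    · rw [if_pos (h1.2 hp), Cmd.emit_spec (a := (f j).1) (b := (f j).2)
        (by simp [kx, ky, xy]) (h2 hp).1]
      · simp [hp]
      · intro w hw
        refine ((he j hj w (fun z hz => ?_) ?_).2 hp).2
        · rw [← h0 z hz]
          exact hw z (by simp only [List.mem_cons, not_or] at hz; simp [hz])
        · rw [hw c (by simpa using Ne.symm xc), hj0]
    · rw [if_neg fun h' => hp (h1.1 h')]
      simp [hp, Cmd.run]
  · intro t h
    rw [pairs_congr (State.set_of_ne _ _ _ kc) (State.set_of_ne _ _ _ xc)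
      (State.set_of_ne _ _ _ yc)]
    exact h

/-- Lists in array `a` the `i < b` with `q ≠ 0`, and counts them in array `k`. -/
def Cmd.collect (c : ℕ) (b : Expr) (k a : ℕ) (q : Expr) : Cmd :=
  .seq (.write k (.const 0) (.const 0)) (.loop c b (.branch q
    (.seq (.write a (.var k) (.var c)) (.write k (.const 0) (.add (.var k) (.const 1)))) .skip))

theorem Cmd.collect_spec {c k a m : ℕ} {b q : Expr} {s : State} {p : ℕ → Prop}
    [DecidablePred p] (hd : [k, a, c, 0].Nodup)
    (hm : ∀ t : State, (∀ z ∉ [k, a, c], t z = s z) → b.eval t = m) (hm2 : m ≤ 2 * s 0 0)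
    (he : ∀ i < m, ∀ t : State, (∀ z ∉ [k, a, c], t z = s z) → t c 0 = i →
      (q.eval t ≠ 0 ↔ p i)) :
    entries ((Cmd.collect c b k a q).run s) k a = (List.range m).filter fun i => p i := by
  simp only [List.nodup_cons, List.mem_cons, List.not_mem_nil, or_false, not_or,
    List.nodup_nil, and_true, not_false_eq_true] at hd
  obtain ⟨⟨ka, kc, k0⟩, ⟨ac, a0⟩, c0⟩ := hd
  have hs : ∀ z ∉ [k, a, c], s.set k 0 0 z = s z := fun z hz => by
    simp only [List.mem_cons, not_or] at hz
    rw [State.set_of_ne _ _ _ hz.1]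
  have hset : ∀ (t : State) j, entries (t.set c 0 j) k a = entries t k a := fun t j => by
    rw [entries, entries, State.set_of_ne _ _ _ kc, State.set_of_ne _ _ _ ac]
  refine Cmd.loop_induction m (hm _ hs)
    (by rwa [State.set_of_ne _ _ _ (Ne.symm k0)])
    (fun j t => entries t k a = (List.range j).filter fun i => p i) ?_ ?_ ?_
  · simp [entries, State.set_apply]
  · intro j hj t ht h
    have h0 : ∀ z ∉ [k, a, c], t.set c 0 j z = s z := fun z hz => by
      rw [← hs z hz]
      simp only [List.mem_cons, List.not_mem_nil, or_false, not_or] at hz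
      rw [State.set_of_ne _ _ _ hz.2.2]
      exact ht z (by simp [Cmd.writes, hz])
    have h1 := he j hj _ h0 (by simp [State.set_apply])
    rw [List.range_succ, List.filter_append, ← h, Cmd.run]
    by_cases hp : p j
    · rw [if_pos (h1.2 hp)]
      simp only [Cmd.run, Expr.eval, Expr.eval_var, entries, State.set_apply, ka, kc, false_and,
        if_false, and_true, if_true]
      rw [List.range_succ, List.map_append, List.map_singleton, State.set_of_ne _ _ _ (Ne.symm ka)]
      simp only [State.set_apply, hp, and_true, if_true, decide_true, List.filter_cons_of_pos, List.filter_nil]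
      congr 1
      refine List.map_congr_left fun i hi => ?_
      simp only [List.mem_range] at hi
      rw [State.set_apply, if_neg (by omega), State.set_of_ne _ _ _ ac]
    · rw [if_neg fun h' => hp (h1.1 h'), Cmd.run, hset]
      simp [hp]
  · intro t h
    rw [hset]
    exact h

theorem entries_count {s : State} {c a : ℕ} {l : List ℕ} (h : entries s c a = l) :
    s c 0 = l.length := by simp [← h, entries]

theorem entries_apply {s : State} {c a : ℕ} {l : List ℕ} (h : entries s c a = l) {i : ℕ}
    (hi : i < l.length) : s a i = l[i] := by
  subst h
  simp [entries]

end RAM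

/-! ### Program logic for straight-line blocks, and the programs for parameters and shares -/

namespace RAM

open RAM.Expr

instance : Add Expr := ⟨.add⟩

instance : Sub Expr := ⟨.sub⟩

instance (k : ℕ) : OfNat Expr k := ⟨.const k⟩

@[simp] theorem Expr.eval_add (x y : Expr) (s : State) : (x + y).eval s = x.eval s + y.eval s := rfl

@[simp] theorem Expr.eval_sub (x y : Expr) (s : State) : (x - y).eval s = x.eval s - y.eval s := rfl

@[simp] theorem Expr.eval_ofNat (k : ℕ) (s : State) : (no_index (OfNat.ofNat k) : Expr).eval s = OfNat.ofNat k := rfl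

@[simp] theorem Expr.eval_read (a : ℕ) (i : Expr) (s : State) : (read a i).eval s = s a (i.eval s) :=
  rfl

/-- Programs run one after the other. -/
def Cmd.block : List Cmd → Cmd
  | [] => .skip
  | p :: l => .seq p (.block l)

/-- After running `p` in memory `s`, the memory satisfies `Q`. -/
def Cmd.Ensures (p : Cmd) (s : State) (Q : State → Prop) : Prop := Q (p.run s)

theorem Cmd.Ensures.nil {s : State} {Q : State → Prop} (h : Q s) : (Cmd.block []).Ensures s Q := h

/-- The remaining program is verified in an arbitrary memory `t`, known only through the unchanged
arrays and the equation `t = p.run s`; programs are never unfolded as a whole. -/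
theorem Cmd.Ensures.cons {p : Cmd} {l : List Cmd} {s : State} {Q : State → Prop}
    (h : ∀ t, (∀ a ∉ p.writes, t a = s a) → t = p.run s → (Cmd.block l).Ensures t Q) :
    (Cmd.block (p :: l)).Ensures s Q :=
  h _ (fun _ ha => p.run_frame ha s) rfl

theorem Cmd.Ensures.write {a : ℕ} {i e : Expr} {l : List Cmd} {s : State} {Q : State → Prop}
    (h : ∀ t, (∀ b ∉ [a], t b = s b) → t a (i.eval s) = e.eval s →
      (∀ j, j ≠ i.eval s → t a j = s a j) → (Cmd.block l).Ensures t Q) :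
    (Cmd.block (.write a i e :: l)).Ensures s Q :=
  h _ (fun _ hb => State.set_of_ne _ _ _ (by simpa using hb)) (by simp [Cmd.run, State.set_apply])
    (fun j hj => by simp [Cmd.run, State.set_apply, hj])

/-! ### The program

The arrays `10` to `19` hold the parameters of the sequence, array `47` the constants for
conditional expressions. -/

/-- Computes the parameters. -/
def paramsCmd : Cmd := .block [
  .sum 60 (var 0) 10 (1 - (read 1 (var 60) - 1)),
  .sum 60 (var 0) 11 (1 - (1 - (read 1 (var 60) - 2))),
  .sum 60 (var 0) 12 (read 1 (var 60) - 2),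
  .write 13 0 ((var 1 - 2) + (var 1 - 2) - (var 12 + var 10)),
  .write 14 0 (var 10 + var 13),
  .sum 60 (var 0) 15 (1 - (var 60 + var 60 + 2 - (var 12 - var 14))),
  .write 16 0 (var 15 - (var 11 - 1)),
  .write 17 0 (var 16 + var 14),
  .write 18 0 (var 0 - var 17),
  .write 19 0 (var 11 - (var 12 - var 14 - (var 16 + var 16))),
  .write 47 0 0,
  .write 47 1 (var 0 + var 0 + (var 0 + var 0) + (var 0 + var 0))]

/-- The memory holds the length, the sequence and its parameters. -/
structure ParamsStored (n : ℕ) (d : ℕ → ℕ) (s : State) : Prop where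
  length : s 0 0 = n
  seq : s 1 = d
  pseudo : s 13 0 = (params n d).pseudo
  pend : s 14 0 = (params n d).pend
  doubled : s 16 0 = (params n d).doubled
  tokens : s 17 0 = (params n d).tokens
  core : s 18 0 = (params n d).core
  free : s 19 0 = (params n d).free
  ite_zero : s 47 0 = 0
  ite_one : s 47 1 = 6 * n

/-- The machine has no division; it halves by counting the `i` with `2 * i + 2 ≤ G`. -/
theorem sum_half {n G : ℕ} (h : G ≤ 2 * n) :
    ∑ i ∈ Finset.range n, (1 - (i + i + 2 - G)) = G / 2 := by
  have key : ∀ m, ∑ i ∈ Finset.range m, (1 - (i + i + 2 - G)) = min m (G / 2) := by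
    intro m
    induction m with
    | zero => simp
    | succ m ih => rw [Finset.sum_range_succ, ih]; omega
  rw [key]
  omega

/-- As in the later specifications, `f1, f2, …` say which arrays each command leaves alone, with the
side conditions on array numbers left to `decide`, and `g…` give the meaning of the new contents. -/
theorem paramsCmd_spec {n : ℕ} {d : ℕ → ℕ} {s : State} (H : Feasible n d) (h0 : s 0 0 = n)
    (h1 : s 1 = d) : paramsCmd.Ensures s (ParamsStored n d) := by
  have hF : (params n d).excess ≤ 2 * n := by
    have h2 := H.sum_excess
    have h3 := H.upper
    change _ + 6 + 2 * (params n d).ones ≤ _ at h3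
    omega
  refine .cons fun s1 f1 e1 => ?_
  have g10 : s1 10 0 = (params n d).ones := by
    rw [e1]
    refine Cmd.sum_spec (by decide) (by decide) (fun t ht _ => ?_) (by omega) fun i hi t ht hc => ?_
    · simp (disch := decide) [ht, h0]
    · simp (disch := decide) [ht, hc, h1]
  refine .cons fun s2 f2 e2 => ?_
  have g11 : s2 11 0 = (params n d).high := by
    rw [e2]
    refine Cmd.sum_spec (by decide) (by decide) (fun t ht _ => ?_) ?_ fun i hi t ht hc => ?_
    · simp (disch := decide) [ht, f1, h0]
    · simp (disch := decide) only [f1]; omega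
    · simp (disch := decide) [ht, hc, f1, h1]
  refine .cons fun s3 f3 e3 => ?_
  have g12 : s3 12 0 = (params n d).excess := by
    rw [e3]
    refine Cmd.sum_spec (by decide) (by decide) (fun t ht _ => ?_) ?_ fun i hi t ht hc => ?_
    · simp (disch := decide) [ht, f2, f1, h0]
    · simp (disch := decide) only [f2, f1]; omega
    · simp (disch := decide) [ht, hc, f2, f1, h1]
  refine .write fun s4 f4 e4 _ => .write fun s5 f5 e5 _ => ?_
  simp (disch := decide) only [eval_add, eval_sub, eval_ofNat, eval_var, f4, f3, f2, f1, g10, g12,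
    h1] at e4 e5
  rw [e4] at e5
  refine .cons fun s6 f6 e6 => ?_
  have g15 : s6 15 0 = (params n d).half := by
    rw [e6]
    refine (Cmd.sum_spec (by decide) (by decide) (fun t ht _ => ?_) ?_ fun i hi t ht hc => ?_).trans
      (sum_half ((Nat.sub_le _ _).trans hF))
    · simp (disch := decide) [ht, f5, f4, f3, f2, f1, h0]
    · simp (disch := decide) only [f5, f4, f3, f2, f1]; omega
    · simp (disch := decide) only [eval_add, eval_sub, eval_ofNat, eval_var, ht, hc, f5, f4, g12]
      rw [e5]
      rfl
  refine .write fun s7 f7 e7 _ => .write fun s8 f8 e8 _ => .write fun s9 f9 e9 _ =>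
    .write fun s10 f10 e10 _ => .write fun s11 f11 e11 _ => .write fun s12 f12 e12 e12' => .nil ?_
  simp (disch := decide) only [eval_add, eval_sub, eval_ofNat, eval_var, f11, f10, f9, f8, f7, f6,
    f5, f4, f3, f2, f1, g15, g11, g12, e5, h0] at e7 e8 e9 e10 e11 e12
  rw [e7] at e8 e10
  rw [e8] at e9
  rw [← two_mul ((params n d).half - _)] at e10
  constructor
  · simp (disch := decide) only [f12, f11, f10, f9, f8, f7, f6, f5, f4, f3, f2, f1, h0]
  · simp (disch := decide) only [f12, f11, f10, f9, f8, f7, f6, f5, f4, f3, f2, f1, h1]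
  · simp (disch := decide) only [f12, f11, f10, f9, f8, f7, f6, f5]
    exact e4
  · simp (disch := decide) only [f12, f11, f10, f9, f8, f7, f6]
    exact e5
  · simp (disch := decide) only [f12, f11, f10, f9, f8]
    exact e7
  · simp (disch := decide) only [f12, f11, f10, f9]
    exact e8
  · simp (disch := decide) only [f12, f11, f10]
    exact e9
  · simp (disch := decide) only [f12, f11]
    exact e10
  · rw [e12' 0 (by simp), e11]
  · rw [e12]
    omega

/-! The arrays `20` to `23` hold the capacities, their partial sums, the shares, and the forest
degrees. -/

/-- Computes the shares of the vertices and their forest degrees. -/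
def shareCmd : Cmd := .block [
  .tabulate 60 (var 0) 20 (Expr.min (read 1 (var 60) - 2 - (1 - (var 19 - var 60))) (var 17)),
  .sumTable 60 (var 0) 61 (var 60) 21 (read 20 (var 61)),
  .tabulate 60 (var 0) 22
    (Expr.min (read 20 (var 60)) (var 17 + var 17 - var 14 - read 21 (var 60))),
  .tabulate 60 (var 0) 23 (read 1 (var 60) - 2 - read 22 (var 60))]

/-- The memory holds the parameters, the shares and the forest degrees. -/
structure SharesStored (n : ℕ) (d : ℕ → ℕ) (s : State) : Prop extends ParamsStored n d s where
  share : ∀ i < n, s 22 i = share n d i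
  forestDegree : ∀ i < n, s 23 i = forestDegree n d i

theorem ParamsStored.congr {n : ℕ} {d : ℕ → ℕ} {s t : State} (S : ParamsStored n d s)
    (h : ∀ a ∈ [0, 1, 13, 14, 16, 17, 18, 19, 47], t a = s a) : ParamsStored n d t := by
  constructor <;> simp only [List.forall_mem_cons] at h <;> simp only [h, S.length, S.seq, S.pseudo,
    S.pend, S.doubled, S.tokens, S.core, S.free, S.ite_zero, S.ite_one]

theorem shareCmd_spec {n : ℕ} {d : ℕ → ℕ} {s : State} (S : ParamsStored n d s) :
    shareCmd.Ensures s (SharesStored n d) := by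
  have h0 := S.length
  refine .cons fun s1 f1 e1 => ?_
  have g1 : ∀ i < n, s1 20 i = capacity n d i := by
    rw [e1]
    refine Cmd.tabulate_spec (by decide) h0 (by omega) fun i hi t ht hc => ?_
    simp (disch := decide) [ht, hc, eval_min, S.seq, S.free, S.tokens, capacity]
  refine .cons fun s2 f2 e2 => ?_
  have g2 : ∀ i < n, s2 21 i = ∑ j ∈ Finset.range i, capacity n d j := by
    rw [e2]
    refine Cmd.sumTable_spec (m' := id) (f := fun _ j => capacity n d j) (by decide) ?_ ?_
      (fun i hi => ⟨?_, fun t ht hc => hc⟩) fun i hi j hj t ht hc hc' => ?_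
    · simp (disch := decide) [f1, h0]
    · simp (disch := decide) only [f1]; omega
    · simp (disch := decide) only [f1, id]; omega
    · simp (disch := decide) [ht, hc', g1 j (lt_trans hj hi)]
  refine .cons fun s3 f3 e3 => ?_
  have g3 : ∀ i < n, s3 22 i = share n d i := by
    rw [e3]
    refine Cmd.tabulate_spec (by decide) ?_ ?_ fun i hi t ht hc => ?_
    · simp (disch := decide) [f2, f1, h0]
    · simp (disch := decide) only [f2, f1]; omega
    · simp (disch := decide) [ht, hc, eval_min, f2, f1, S.pend, S.tokens, g1 i hi, g2 i hi, share,
        greedy, two_mul]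
  refine .cons fun s4 f4 e4 => .nil ?_
  refine ⟨S.congr ?_, fun i hi => ?_, ?_⟩
  · simp (disch := decide) only [List.forall_mem_cons, f4, f3, f2, f1]
    simp
  · simp (disch := decide) only [f4, g3 i hi]
  · rw [e4]
    refine Cmd.tabulate_spec (by decide) ?_ ?_ fun i hi t ht hc => ?_
    · simp (disch := decide) [f3, f2, f1, h0]
    · simp (disch := decide) only [f3, f2, f1]; omega
    · simp (disch := decide) [ht, hc, f3, f2, f1, S.seq, g3 i hi, _root_.forestDegree]

end RAM

/-! ### The programs for the classes, the separating vertices and the forest -/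

namespace RAM

open RAM.Expr

/-- Unlike `write`, this describes the written array completely, in the form in which the forest
steps expect `ch'`, `sd'` and `par'`. -/
theorem Cmd.Ensures.store {a : ℕ} {i e : Expr} {l : List Cmd} {s : State} {Q : State → Prop}
    (h : ∀ t, (∀ b ∉ [a], t b = s b) →
      (∀ j, t a j = if j = i.eval s then e.eval s else s a j) → (Cmd.block l).Ensures t Q) :
    (Cmd.block (.write a i e :: l)).Ensures s Q :=
  h _ (fun _ hb => State.set_of_ne _ _ _ (by simpa using hb))
    (fun j => by simp [Cmd.run, State.set_apply])

theorem Cmd.Ensures.branch {e : Expr} {p q : Cmd} {s : State} {Q : State → Prop}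
    (hp : e.eval s ≠ 0 → p.Ensures s Q) (hq : e.eval s = 0 → q.Ensures s Q) :
    (Cmd.branch e p q).Ensures s Q := by
  rw [Cmd.Ensures, Cmd.run]
  split_ifs with h
  · exact hp h
  · exact hq (not_not.1 h)

/-! The arrays `24`, `26` and `28` list the core vertices of forest degree at least two, one and
zero, and the arrays `25`, `27` and `29` hold their numbers. -/

/-- Classifies the core vertices by their forest degrees. -/
def classifyCmd : Cmd := .block [
  .collect 60 (var 18) 25 24 (read 23 (var 60) - 1),
  .collect 60 (var 18) 27 26 (1 - (read 23 (var 60) - 1) - (1 - read 23 (var 60))),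
  .collect 60 (var 18) 29 28 (1 - read 23 (var 60))]

/-- The memory holds the classes of the core vertices. -/
structure ClassesStored (n : ℕ) (d : ℕ → ℕ) (s : State) : Prop extends SharesStored n d s where
  bigs : entries s 25 24 = bigs n d
  leaves : entries s 27 26 = leaves n d
  zeros : entries s 29 28 = zeros n d

theorem SharesStored.congr {n : ℕ} {d : ℕ → ℕ} {s t : State} (S : SharesStored n d s)
    (h : ∀ a ∈ [0, 1, 13, 14, 16, 17, 18, 19, 47, 22, 23], t a = s a) : SharesStored n d t :=
  ⟨S.toParamsStored.congr fun a ha => h a (by revert a; decide),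
    by rw [h 22 (by decide)]; exact S.share, by rw [h 23 (by decide)]; exact S.forestDegree⟩

theorem classifyCmd_spec {n : ℕ} {d : ℕ → ℕ} {s : State} (H : Feasible n d)
    (S : SharesStored n d s) : classifyCmd.Ensures s (ClassesStored n d) := by
  have h0 := S.length
  have hn := H.good.core_add
  have h23 : ∀ i < (params n d).core, s 23 i = forestDegree n d i :=
    fun i hi => S.forestDegree i (by omega)
  refine .cons fun s1 f1 e1 => ?_
  have g1 : entries s1 25 24 = bigs n d := by
    rw [e1]
    refine Cmd.collect_spec (by decide) (fun t ht => ?_) ?_ fun i hi t ht hc => ?_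
    · simp (disch := decide) [ht, S.core]
    · omega
    · simp (disch := decide) only [eval_sub, eval_read, eval_var, eval_ofNat, ht, hc, h23 i hi]
      omega
  refine .cons fun s2 f2 e2 => ?_
  have g2 : entries s2 27 26 = leaves n d := by
    rw [e2]
    refine Cmd.collect_spec (by decide) (fun t ht => ?_) ?_ fun i hi t ht hc => ?_
    · simp (disch := decide) [ht, f1, S.core]
    · simp (disch := decide) only [f1]; omega
    · simp (disch := decide) only [eval_sub, eval_read, eval_var, eval_ofNat, ht, hc, f1, h23 i hi]
      omega
  refine .cons fun s3 f3 e3 => .nil ⟨S.congr ?_, ?_, ?_, ?_⟩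
  · simp (disch := decide) only [List.forall_mem_cons, f3, f2, f1]
    simp
  · rw [← g1]
    simp (disch := decide) only [entries, f3, f2]
  · rw [← g2]
    simp (disch := decide) only [entries, f3]
  · rw [e3]
    refine Cmd.collect_spec (by decide) (fun t ht => ?_) ?_ fun i hi t ht hc => ?_
    · simp (disch := decide) [ht, f2, f1, S.core]
    · simp (disch := decide) only [f2, f1]; omega
    · simp (disch := decide) only [eval_sub, eval_read, eval_var, eval_ofNat, ht, hc, f2, f1,
        h23 i hi]
      omega

/-! Array `30` holds the first separating vertex, array `36` the number of vertices of the forest,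
and the arrays `37`, `38`, `39` their list, their sides and their parents. The arrays `31` to `35`
hold the numbers of vertices of degree one and of degree at least two that have been used, the number
of children to come at the current vertex, its side, and its number. -/

/-- Finds the separating vertices. -/
def sepCmd : Cmd := .block [
  .write 30 0 (Expr.ite (var 29 - 1) (var 28) (var 26)),
  .write 31 0 (Expr.ite (var 29 - 1) 0 2),
  .emits 60 (1 - (var 29 - 1)) 7 8 9 1 (var 26) (read 26 1),
  .write 36 0 (var 25 + (var 27 - var 31))]

/-- Adds a vertex to the forest. -/
def growCmd : Cmd := .branch (var 33)
  (.branch (2 - var 33 - (1 - (var 25 - var 32)))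
    (.block [
      .write 37 (var 60) (read 24 (var 32)),
      .write 38 (var 60) (1 - var 34),
      .write 39 (var 60) (var 35),
      .write 34 0 (1 - var 34),
      .write 35 0 (var 60),
      .write 33 0 (read 23 (read 24 (var 32)) - 1),
      .write 32 0 (var 32 + 1)])
    (.block [
      .write 37 (var 60) (read 26 (var 31)),
      .write 38 (var 60) (1 - var 34),
      .write 39 (var 60) (var 35),
      .write 33 0 (var 33 - 1),
      .write 31 0 (var 31 + 1)]))
  (.branch (var 25 - var 32)
    (.block [
      .write 37 (var 60) (read 24 (var 32)),
      .write 38 (var 60) (var 34),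
      .write 39 (var 60) (var 60),
      .write 35 0 (var 60),
      .write 33 0 (read 23 (read 24 (var 32))),
      .write 32 0 (var 32 + 1)])
    (.block [
      .write 37 (var 60) (read 26 (var 31)),
      .write 38 (var 60) (var 34),
      .write 39 (var 60) (var 60),
      .write 35 0 (var 60),
      .write 33 0 (read 23 (read 26 (var 31))),
      .write 31 0 (var 31 + 1)]))

/-- Builds the forest. -/
def forestCmd : Cmd := .block [
  .write 32 0 0,
  .write 33 0 0,
  .write 34 0 0,
  .write 35 0 0,
  .loop 60 (var 36) growCmd]

/-- The memory holds the separating vertices and the size of the forest. -/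
structure SepStored (n : ℕ) (d : ℕ → ℕ) (s : State) : Prop extends ClassesStored n d s where
  sepFirst : s 30 0 = sepFirst n d
  size : s 36 0 = (forestVertices n d).length
  pageOne : pairs s 4 5 6 = []

theorem ClassesStored.congr {n : ℕ} {d : ℕ → ℕ} {s t : State} (S : ClassesStored n d s)
    (h : ∀ a ∈ [0, 1, 13, 14, 16, 17, 18, 19, 47, 22, 23, 24, 25, 26, 27, 28, 29], t a = s a) :
    ClassesStored n d t :=
  ⟨S.toSharesStored.congr fun a ha => h a (by revert a; decide),
    by simp (disch := decide) only [entries, h]; exact S.bigs,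
    by simp (disch := decide) only [entries, h]; exact S.leaves,
    by simp (disch := decide) only [entries, h]; exact S.zeros⟩

theorem sepCmd_spec {n : ℕ} {d : ℕ → ℕ} {s : State} (H : Feasible n d)
    (S : ClassesStored n d s) (h4 : s 4 0 = 0) (h7 : s 7 0 = 0) :
    sepCmd.Ensures s fun t => SepStored n d t ∧ t 31 0 = skipped n d ∧
      pairs t 7 8 9 = sepEdges n d := by
  have hn := H.n_pos
  have hz := entries_count S.zeros
  have hcore := H.good.core_add
  have hle := H.sep_spec.1.1
  -- The program tests for at least two zeros by `zeros - 1 ≠ 0`.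
  have hif : ∀ x y : ℕ, (if (zeros n d).length - 1 ≠ 0 then x else y) =
      if 2 ≤ (zeros n d).length then x else y := fun x y => by
    refine if_congr ?_ rfl rfl
    omega
  have hz0 : 2 ≤ (zeros n d).length → s 28 0 = _root_.sepFirst n d := fun h => by
    rw [entries_apply S.zeros (by omega), _root_.sepFirst, sepList, if_pos h,
      List.getD_eq_getElem _ _ (by omega)]
  have hl : ¬ 2 ≤ (zeros n d).length → s 26 0 = _root_.sepFirst n d ∧ s 26 1 = sepSecond n d :=
    fun h => by
      have hl4 := H.forest_balance.2 (by omega)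
      rw [entries_apply S.leaves (i := 0) (by omega), entries_apply S.leaves (i := 1) (by omega),
        _root_.sepFirst, sepSecond, sepList, if_neg h, List.getD_eq_getElem _ _ (by omega),
        List.getD_eq_getElem _ _ (by omega)]
      exact ⟨rfl, rfl⟩
  refine .write fun s1 f1 e1 _ => ?_
  have g30 : s1 30 0 = _root_.sepFirst n d := by
    rw [eval_ofNat] at e1
    rw [e1, eval_ite S.ite_zero S.ite_one]
    · simp only [eval_sub, eval_var, eval_ofNat, hz, hif]
      split_ifs with h
      · exact hz0 h
      · exact (hl h).1
    · intro h
      simp only [eval_sub, eval_var, eval_ofNat, hz] at h ⊢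
      rw [hz0 (by omega)]
      omega
    · intro h
      simp only [eval_sub, eval_var, eval_ofNat, hz] at h ⊢
      rw [(hl (by omega)).1]
      omega
  refine .write fun s2 f2 e2 _ => ?_
  have g31 : s2 31 0 = skipped n d := by
    rw [eval_ofNat] at e2
    rw [e2, eval_ite (B := 6 * n) (by simp (disch := decide) only [f1, S.ite_zero])
      (by simp (disch := decide) only [f1, S.ite_one])]
    · simp (disch := decide) only [eval_sub, eval_var, eval_ofNat, f1, hz, hif]
      rfl
    · intro
      simp
    · intro
      simp only [eval_ofNat]
      omega
  refine .cons fun s3 f3 e3 => ?_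
  have g7 : pairs s3 7 8 9 = sepEdges n d := by
    -- The loop serves as a conditional: it runs once if there are fewer than two zeros, and not at
    -- all otherwise.
    rw [e3, Cmd.emits_spec (m := 1 - ((zeros n d).length - 1)) (p := fun _ => True)
      (f := fun _ => (_root_.sepFirst n d, sepSecond n d)) (by decide)]
    · simp (disch := decide) only [pairs, f2, f1, h7, sepEdges]
      by_cases h : 2 ≤ (zeros n d).length
      · rw [if_pos h, show 1 - ((zeros n d).length - 1) = 0 by omega]
        rfl
      · rw [if_neg h, show 1 - ((zeros n d).length - 1) = 1 by omega]
        rfl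
    · simp (disch := decide) only [eval_sub, eval_var, eval_ofNat, f2, f1, hz]
    · simp (disch := decide) only [f2, f1, S.length]
      omega
    · intro i hi t ht hc
      obtain ⟨h1, h2⟩ := hl (by omega)
      simp (disch := decide) [ht, f2, f1, h1, h2]
  refine .write fun s4 f4 e4 _ => .nil ⟨⟨S.congr ?_, ?_, ?_, ?_⟩, ?_, ?_⟩
  · simp (disch := decide) only [List.forall_mem_cons, f4, f3, f2, f1]
    simp
  · simp (disch := decide) only [f4, f3, f2, g30]
  · simp (disch := decide) only [eval_add, eval_sub, eval_var, eval_ofNat, f3, f2, f1, g31,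
      entries_count S.bigs, entries_count S.leaves] at e4
    rw [e4, forestVertices, List.length_append, List.length_drop]
  · simp (disch := decide) only [pairs, f4, f3, f2, f1, h4]
    rfl
  · simp (disch := decide) only [f4, f3, g31]
  · rw [← g7]
    simp (disch := decide) only [pairs, f4]

/-- The state of the construction of the forest. -/
def ForestStored (n : ℕ) (d : ℕ → ℕ) (T : ℕ) (s : State) : Prop :=
  ForestState (forestDegree n d) (forestVertices n d) T (s 33 0) (s 34 0) (s 35 0)
    ((bigs n d).drop (s 32 0)) ((leaves n d).drop (s 31 0)) (s 37) (s 38) (s 39)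

/-- The four branches are: last child while big vertices remain, any other child, a big root, a leaf
root. The inner test `2 - ρ - (1 - rest)` is nonzero for `ρ ≠ 0` exactly if `ρ = 1` and big vertices
are left. -/
theorem growCmd_spec {n : ℕ} {d : ℕ → ℕ} {s : State} {T : ℕ} (H : Feasible n d)
    (S : ClassesStored n d s) (hT : T < (forestVertices n d).length) (h60 : s 60 0 = T)
    (h : ForestStored n d T s) : growCmd.Ensures s (ForestStored n d (T + 1)) := by
  have hn := H.good.core_add
  have hb := entries_count S.bigs
  have hl := entries_count S.leaves
  have hτ : ∀ v < (params n d).core, s 23 v = forestDegree n d v :=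
    fun v hv => S.forestDegree v (by omega)
  have hbig : ∀ i (hi : i < (bigs n d).length), s 24 i = (bigs n d)[i] ∧
      s 23 (bigs n d)[i] = forestDegree n d (bigs n d)[i] := fun i hi =>
    ⟨entries_apply S.bigs hi, hτ _ (by
      have := List.getElem_mem hi
      simp only [bigs, List.mem_filter, List.mem_range] at this
      exact this.1)⟩
  have hleaf : ∀ i (hi : i < (leaves n d).length), s 26 i = (leaves n d)[i] ∧
      s 23 (leaves n d)[i] = forestDegree n d (leaves n d)[i] := fun i hi =>
    ⟨entries_apply S.leaves hi, hτ _ (by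
      have := List.getElem_mem hi
      simp only [leaves, List.mem_filter, List.mem_range] at this
      exact this.1)⟩
  have hlen := h.perm.length_eq
  simp only [List.length_append, List.length_map, List.length_range] at hlen
  obtain ⟨x, hbal⟩ := h.balance
  refine .branch (fun hρ => .branch (fun hc => ?_) fun hc => ?_) fun hρ => .branch (fun hc => ?_)
    fun hc => ?_ <;> simp only [eval_sub, eval_ofNat, eval_var, hb] at hρ hc
  · obtain ⟨hv, hv'⟩ := hbig (s 32 0) (by omega)
    have h1 : s 33 0 = 1 := by omega
    unfold ForestStored at h
    rw [List.drop_eq_getElem_cons (i := s 32 0) (by omega), h1] at h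
    refine .store fun s1 f1 e1 => .store fun s2 f2 e2 => .store fun s3 f3 e3 =>
      .store fun s4 f4 e4 => .store fun s5 f5 e5 => .store fun s6 f6 e6 => .store fun s7 f7 e7 =>
      .nil ?_
    have g37 : s7 37 = s1 37 := by simp (disch := decide) only [f7, f6, f5, f4, f3, f2]
    have g38 : s7 38 = s2 38 := by simp (disch := decide) only [f7, f6, f5, f4, f3]
    have g39 : s7 39 = s3 39 := by simp (disch := decide) only [f7, f6, f5, f4]
    simp (disch := decide) only [eval_add, eval_sub, eval_ofNat, eval_var, eval_read, f6, f5, f4,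
      f3, f2, f1, h60, hv, hv'] at e1 e2 e3 e4 e5 e6 e7
    have := h.bigChild (ch' := s7 37) (sd' := s7 38) (par' := s7 39)
      (fun t => by rw [g37, e1]) (fun t => by rw [g38, e2]) (fun t => by rw [g39, e3])
    unfold ForestStored
    simp (disch := decide) only [f7, f6, f5, e4, e5, e6, e7, if_true]
    simp (disch := decide) only [f7, f6, f5, f4, f3, f2, f1] at this ⊢
    exact this
  · have hne : s 33 0 = 1 → (bigs n d).drop (s 32 0) = [] := fun h1 =>
      List.drop_eq_nil_of_le (by omega)
    -- A child is still to come, so the balance guarantees a remaining leaf.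
    have hlt : s 31 0 < (leaves n d).length := by
      rw [if_neg (by simp [hρ]), List.length_drop] at hbal
      omega
    obtain ⟨hv, -⟩ := hleaf (s 31 0) hlt
    unfold ForestStored at h
    obtain ⟨ρ, h1⟩ : ∃ ρ, s 33 0 = ρ + 1 := ⟨s 33 0 - 1, by omega⟩
    rw [List.drop_eq_getElem_cons hlt, h1] at h
    refine .store fun s1 f1 e1 => .store fun s2 f2 e2 => .store fun s3 f3 e3 =>
      .store fun s4 f4 e4 => .store fun s5 f5 e5 => .nil ?_
    have g37 : s5 37 = s1 37 := by simp (disch := decide) only [f5, f4, f3, f2]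
    have g38 : s5 38 = s2 38 := by simp (disch := decide) only [f5, f4, f3]
    have g39 : s5 39 = s3 39 := by simp (disch := decide) only [f5, f4]
    simp (disch := decide) only [eval_add, eval_sub, eval_ofNat, eval_var, eval_read, f4, f3, f2,
      f1, h60, hv, h1] at e1 e2 e3 e4 e5
    have := h.leafChild (ch' := s5 37) (sd' := s5 38) (par' := s5 39)
      (fun h2 => hne (by omega)) (fun t => by rw [g37, e1]) (fun t => by rw [g38, e2])
      (fun t => by rw [g39, e3])
    unfold ForestStored
    simp (disch := decide) only [f5, e4, e5, if_true]
    simp (disch := decide) only [f5, f4, f3, f2, f1] at this ⊢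
    exact this
  · have hlt : s 32 0 < (bigs n d).length := by omega
    obtain ⟨hv, hv'⟩ := hbig (s 32 0) hlt
    unfold ForestStored at h
    rw [hρ] at h
    have hdrop := List.drop_eq_getElem_cons hlt
    have h2 := h.big (bigs n d)[s 32 0] (by rw [hdrop]; exact List.mem_cons_self)
    rw [hρ, if_pos ⟨rfl, by rw [hdrop]; exact List.cons_ne_nil _ _⟩, hdrop, List.map_cons, List.sum_cons] at hbal
    refine .store fun s1 f1 e1 => .store fun s2 f2 e2 => .store fun s3 f3 e3 =>
      .store fun s4 f4 e4 => .store fun s5 f5 e5 => .store fun s6 f6 e6 => .nil ?_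
    have g37 : s6 37 = s1 37 := by simp (disch := decide) only [f6, f5, f4, f3, f2]
    have g38 : s6 38 = s2 38 := by simp (disch := decide) only [f6, f5, f4, f3]
    have g39 : s6 39 = s3 39 := by simp (disch := decide) only [f6, f5, f4]
    simp (disch := decide) only [eval_add, eval_ofNat, eval_var, eval_read, f5, f4, f3, f2, f1, h60,
      hv, hv'] at e1 e2 e3 e4 e5 e6
    have := h.root (v := (bigs n d)[s 32 0]) (rb' := (bigs n d).drop (s 32 0 + 1))
      (rl' := (leaves n d).drop (s 31 0)) (ch' := s6 37) (sd' := s6 38) (par' := s6 39)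
      (by rw [hdrop]; rfl) (fun y hy => by rw [hdrop]; exact List.mem_cons_of_mem _ hy)
      (fun y hy => hy) ⟨x, by omega⟩ (by omega)
      (fun t => by rw [g37, e1]) (fun t => by rw [g38, e2]) (fun t => by rw [g39, e3])
    unfold ForestStored
    simp (disch := decide) only [f6, f5, e4, e5, e6, if_true]
    simp (disch := decide) only [f6, f5, f4, f3, f2, f1] at this ⊢
    exact this
  · have hnil : (bigs n d).drop (s 32 0) = [] := List.drop_eq_nil_of_le (by omega)
    rw [hnil, List.length_nil, List.length_drop] at hlen
    have hlt : s 31 0 < (leaves n d).length := by omega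
    obtain ⟨hv, hv'⟩ := hleaf (s 31 0) hlt
    unfold ForestStored at h
    rw [hρ, hnil] at h
    have hdrop := List.drop_eq_getElem_cons hlt
    have h2 := h.leaf (leaves n d)[s 31 0] (by rw [hdrop]; exact List.mem_cons_self)
    rw [hρ, hnil, if_neg (by simp), hdrop, List.map_nil, List.sum_nil, List.length_cons] at hbal
    refine .store fun s1 f1 e1 => .store fun s2 f2 e2 => .store fun s3 f3 e3 =>
      .store fun s4 f4 e4 => .store fun s5 f5 e5 => .store fun s6 f6 e6 => .nil ?_
    have g37 : s6 37 = s1 37 := by simp (disch := decide) only [f6, f5, f4, f3, f2]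
    have g38 : s6 38 = s2 38 := by simp (disch := decide) only [f6, f5, f4, f3]
    have g39 : s6 39 = s3 39 := by simp (disch := decide) only [f6, f5, f4]
    simp (disch := decide) only [eval_add, eval_ofNat, eval_var, eval_read, f5, f4, f3, f2, f1, h60,
      hv, hv'] at e1 e2 e3 e4 e5 e6
    have := h.root (v := (leaves n d)[s 31 0]) (rb' := [])
      (rl' := (leaves n d).drop (s 31 0 + 1)) (ch' := s6 37) (sd' := s6 38) (par' := s6 39)
      (by rw [hdrop]; rfl) (fun y hy => hy)
      (fun y hy => by rw [hdrop]; exact List.mem_cons_of_mem _ hy)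
      -- A leaf as root starts a component that is a single edge and uses up two leaves: itself and
      -- the child to come.
      ⟨x - 1, by rw [List.map_nil, List.sum_nil]; omega⟩ (by omega)
      (fun t => by rw [g37, e1]) (fun t => by rw [g38, e2]) (fun t => by rw [g39, e3])
    unfold ForestStored
    simp (disch := decide) only [f6, f5, e4, e5, e6, if_true]
    simp (disch := decide) only [f6, f5, f4, f3, f2, f1, hnil] at this ⊢
    exact this

theorem forestCmd_spec {n : ℕ} {d : ℕ → ℕ} {s : State} (H : Feasible n d)
    (S : ClassesStored n d s) (h31 : s 31 0 = skipped n d)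
    (h36 : s 36 0 = (forestVertices n d).length) :
    forestCmd.Ensures s fun t =>
      IsForest (forestDegree n d) (forestVertices n d) (t 37) (t 38) (t 39) := by
  have hn := H.good.core_add
  have hlen := length_forestVertices_le n d
  refine .write fun s1 f1 e1 _ => .write fun s2 f2 e2 _ => .write fun s3 f3 e3 _ =>
    .write fun s4 f4 e4 _ => .cons fun s5 f5 e5 => .nil ?_
  simp only [eval_ofNat] at e1 e2 e3 e4
  rw [e5]
  refine ForestState.isForest (Cmd.loop_induction (forestVertices n d).length ?_ ?_
    (ForestStored n d) ?_ (fun T hT t ht h => ?_) fun t h => ?_)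
  · simp (disch := decide) [f4, f3, f2, f1, h36]
  · simp (disch := decide) only [f4, f3, f2, f1, S.length]
    omega
  · unfold ForestStored
    simp (disch := decide) only [f4, f3, f2, f1, e1, e2, e3, e4, h31, List.drop_zero]
    obtain ⟨⟨x, hx⟩, -⟩ := H.forest_balance
    refine ⟨by simp [forestVertices], fun v hv => ?_, fun v hv => ?_, ⟨x, ?_⟩, by simp, by simp,
      by simp, by simp, by simp, by simp, by simp⟩
    · simpa [bigs] using (List.mem_filter.1 hv).2
    · simpa [leaves] using (List.mem_filter.1 (List.mem_of_mem_drop hv)).2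
    · rw [← hx]
      by_cases hb : bigs n d = [] <;> simp [hb]
  · refine growCmd_spec H (S.congr fun a ha => ?_) hT (by simp [State.set_apply]) ?_
    · have h1 : a ≠ 60 := by revert a; decide
      have h2 : a ∉ 60 :: growCmd.writes := by revert a; decide
      have h3 : a ∉ [35, 34, 33, 32] := by revert a; decide
      simp only [List.mem_cons, not_or] at h3
      rw [State.set_of_ne _ _ _ h1, ht a h2, f4 a (by simp [h3]), f3 a (by simp [h3]),
        f2 a (by simp [h3]), f1 a (by simp [h3])]
    · unfold ForestStored at h ⊢
      simp (disch := decide) only [State.set_of_ne]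
      exact h
  · unfold ForestStored at h ⊢
    simp (disch := decide) only [State.set_of_ne]
    exact h

end RAM

/-! ### The programs for the order of the core vertices, the forest and cycle edges, and the blocks
-/

namespace RAM

open RAM.Expr

theorem SepStored.congr {n : ℕ} {d : ℕ → ℕ} {s t : State} (S : SepStored n d s)
    (h : ∀ a ∈ [0, 1, 13, 14, 16, 17, 18, 19, 47, 22, 23, 24, 25, 26, 27, 28, 29, 30, 36, 4, 5, 6],
      t a = s a) : SepStored n d t :=
  ⟨S.toClassesStored.congr fun a ha => h a (by revert a; decide),
    by rw [h 30 (by decide)]; exact S.sepFirst, by rw [h 36 (by decide)]; exact S.size,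
    (pairs_congr (h 4 (by decide)) (h 5 (by decide)) (h 6 (by decide))).trans S.pageOne⟩

theorem rank_eq_sum (n : ℕ) (key : ℕ → ℕ) (v : ℕ) :
    rank n key v = ∑ u ∈ Finset.range n, (1 - (1 - (key v - key u))) := by
  rw [rank, Finset.card_filter]
  refine Finset.sum_congr rfl fun u _ => ?_
  split_ifs <;> omega

/-! Array `40` holds the keys of the core vertices, array `41` their ranks, and array `42` the
vertices in the order of the ranks. -/

/-- Computes the keys for the order of the core vertices. -/
def coreKeyCmd : Cmd := .block [
  .tabulate 60 (var 0) 40 (Expr.ite (var 18 - var 60) (var 0 + 1 + var 60)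
    (var 0 + var 0 + (var 0 + var 0) + var 60)),
  .write 40 (var 30) 0,
  .scatter 60 (var 36) 40 (read 37 (var 60))
    (Expr.ite (read 38 (var 60)) (var 0 + var 0 + var 0 - var 60) (1 + var 60))]

/-- All vertices first receive the key of a vertex outside the forest; the entries of `sepFirst` and
of the forest vertices are then overwritten. The latter are distinct and do not include `sepFirst`.
-/
theorem coreKeyCmd_spec {n : ℕ} {d : ℕ → ℕ} {s : State} (H : Feasible n d) (S : SepStored n d s)
    (F : IsForest (forestDegree n d) (forestVertices n d) (s 37) (s 38) (s 39)) :
    coreKeyCmd.Ensures s fun t => CoreKeys n d (t 37) (t 38) (t 40) := by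
  have hn := H.good.core_add
  have hlen := length_forestVertices_le n d
  have hn0 := H.n_pos
  refine .cons fun s1 f1 e1 => ?_
  have g1 : ∀ v < n, s1 40 v = if v < (params n d).core then n + 1 + v else 4 * n + v := by
    rw [e1]
    refine Cmd.tabulate_spec (by decide) (by simp [S.length]) (by rw [S.length]; omega)
      fun i hi t ht hc => ?_
    rw [eval_ite (B := 6 * n) (by simp (disch := decide) only [ht, S.ite_zero])
      (by simp (disch := decide) only [ht, S.ite_one])]
    · simp (disch := decide) only [eval_add, eval_sub, eval_var, eval_ofNat, ht, hc, S.core,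
        S.length]
      split_ifs <;> omega
    · intro _
      simp (disch := decide) only [eval_add, eval_var, eval_ofNat, ht, hc, S.length]
      omega
    · intro _
      simp (disch := decide) only [eval_add, eval_var, ht, hc, S.length]
      omega
  refine .store fun s2 f2 e2 => .cons fun s3 f3 e3 => .nil ?_
  simp (disch := decide) only [eval_var, eval_ofNat, f1, S.sepFirst] at e2
  have key := Cmd.scatter_spec (c := 60) (a := 40) (b := var 36) (s := s2)
    (idx := read 37 (var 60))
    (e := Expr.ite (read 38 (var 60)) (var 0 + var 0 + var 0 - var 60) (1 + var 60))
    (m := (forestVertices n d).length) (g := s 37)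
    (f := fun t => if s 38 t = 0 then 1 + t else 3 * n - t) (by decide)
    (by simp (disch := decide) [f2, f1, S.size])
    (by simp (disch := decide) only [f2, f1, S.length]; omega)
    (fun i hi t ht hc => ⟨by simp (disch := decide) [ht, hc, f2, f1], by
      rw [eval_ite (B := 6 * n) (by simp (disch := decide) only [ht, f2, f1, S.ite_zero])
        (by simp (disch := decide) only [ht, f2, f1, S.ite_one])]
      · simp (disch := decide) only [eval_add, eval_sub, eval_var, eval_ofNat, eval_read, ht, hc,
          f2, f1, S.length]
        split_ifs <;> omega
      · intro _
        simp (disch := decide) only [eval_add, eval_sub, eval_var, ht, hc, f2, f1, S.length]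
        omega
      · intro _
        simp (disch := decide) only [eval_add, eval_var, eval_ofNat, hc]
        omega⟩)
    (fun i hi j hj h => F.ch_inj (nodup_forestVertices n d) hi hj h)
  rw [Cmd.scatter] at e3 key
  rw [← e3] at key
  refine ⟨fun t ht => ?_, fun v hv hv' => ?_⟩
  · simp (disch := decide) only [f3, f2, f1]
    exact key.1 t ht
  · rw [key.2 v (fun i hi h => hv' (h ▸ F.ch_mem hi)), e2 v, g1 v hv]

/-- Computes the order of the core vertices. -/
def orderCmd : Cmd := .block [
  .sumTable 60 (var 0) 61 (var 0) 41 (1 - (1 - (read 40 (var 60) - read 40 (var 61)))),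
  .scatter 60 (var 0) 42 (read 41 (var 60)) (var 60)]

theorem orderCmd_spec {n : ℕ} {s : State} (h0 : s 0 0 = n)
    (hinj : ∀ u < n, ∀ v < n, s 40 u = s 40 v → u = v) :
    orderCmd.Ensures s fun t => ∀ v < n, t 42 (rank n (t 40) v) = v := by
  refine .cons fun s1 f1 e1 => ?_
  have g1 : ∀ v < n, s1 41 v = rank n (s 40) v := by
    intro v hv
    rw [e1, rank_eq_sum]
    refine Cmd.sumTable_spec (m' := fun _ => n) (f := fun v u => 1 - (1 - (s 40 v - s 40 u)))
      (by decide) (by simp [h0]) (by omega) (fun i hi => ⟨by omega, fun t ht hc => ?_⟩)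
      (fun i hi j hj t ht hc hc' => ?_) v hv
    · simp (disch := decide) [ht, h0]
    · simp (disch := decide) [ht, hc, hc']
  refine .cons fun s2 f2 e2 => .nil ?_
  intro v hv
  simp (disch := decide) only [f2, f1]
  rw [e2]
  refine (Cmd.scatter_spec (m := n) (g := rank n (s 40)) (f := id) (by decide) ?_ ?_ ?_ ?_).1 v hv
  · simp (disch := decide) [f1, h0]
  · simp (disch := decide) only [f1]; omega
  · intro i hi t ht hc
    simp (disch := decide) [ht, hc, g1 i hi]
  · exact fun u hu v hv h => rank_inj hinj hu hv h

/-- Lists the edges of the forest. -/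
def forestEdgesCmd : Cmd :=
  .emits 60 (var 36) 4 5 6 (var 60 - read 39 (var 60))
    (read 37 (Expr.ite (read 38 (var 60)) (read 39 (var 60)) (var 60)))
    (read 37 (Expr.ite (read 38 (var 60)) (var 60) (read 39 (var 60))))

theorem forestEdgesCmd_spec {n : ℕ} {d : ℕ → ℕ} {s : State} (H : Feasible n d)
    (S : SepStored n d s)
    (F : IsForest (forestDegree n d) (forestVertices n d) (s 37) (s 38) (s 39)) :
    forestEdgesCmd.Ensures s fun t =>
      pairs t 4 5 6 = forestEdges (s 37) (s 38) (s 39) (forestVertices n d).length := by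
  have hn := H.good.core_add
  have hlen := length_forestVertices_le n d
  refine (Cmd.emits_spec (m := (forestVertices n d).length) (p := fun t => s 39 t ≠ t)
    (f := fun t => if s 38 t = 0 then (s 37 t, s 37 (s 39 t)) else (s 37 (s 39 t), s 37 t))
    (by decide) (by simp [S.size])
    (by rw [S.length]; omega) fun i hi t ht hc => ?_).trans ?_
  · have hp := F.par_le i hi
    refine ⟨?_, fun _ => ?_⟩
    · simp (disch := decide) only [eval_sub, eval_var, eval_read, ht, hc]
      omega
    · simp only [eval_read]
      rw [eval_ite (B := 6 * n) (by simp (disch := decide) only [ht, S.ite_zero])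
        (by simp (disch := decide) only [ht, S.ite_one]),
        eval_ite (B := 6 * n) (by simp (disch := decide) only [ht, S.ite_zero])
        (by simp (disch := decide) only [ht, S.ite_one])]
      · simp (disch := decide) only [eval_var, eval_read, ht, hc]
        by_cases hs : s 38 i = 0 <;> simp [hs]
      all_goals
        intro _
        simp (disch := decide) only [eval_var, eval_read, ht, hc]
        omega
  · rw [S.pageOne]
    rfl

/-! Array `43` holds the ends of the blocks of half-edges, array `44` the owners of the half-edges,
and the arrays `45`, `46` the position and the length of the middle block. -/

/-- Computes the blocks of half-edges. -/
def blocksCmd : Cmd := .block [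
  .sumTable 60 (var 18 + 1) 61 (var 60) 43 (read 22 (read 42 (var 61))),
  .sumTable 60 (var 17 + var 17) 61 (var 18) 44 (1 - (read 43 (var 61 + 1) - var 60)),
  .write 45 0 (read 43 (read 44 (var 17 - 1))),
  .write 46 0 (read 43 (read 44 (var 17 - 1) + 1) - var 45)]

/-- The memory holds the order of the core vertices and the blocks of half-edges. -/
structure BlocksStored (n : ℕ) (d : ℕ → ℕ) (s : State) : Prop extends ParamsStored n d s where
  order : CoreOrder n d (s 37) (s 38) (s 39) (s 40) (s 42) (s 43)
  owner : ∀ j < 2 * (params n d).tokens, s 44 j = owner (params n d).core (s 43) j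
  midStart : 0 < (params n d).tokens →
    s 45 0 = midStart (params n d).core (params n d).tokens (s 43)
  midLength : 0 < (params n d).tokens →
    s 46 0 = midLength (params n d).core (params n d).tokens (s 43)

theorem blocksCmd_spec {n : ℕ} {d : ℕ → ℕ} {s : State} (H : Feasible n d) (S : SharesStored n d s)
    (F : IsForest (forestDegree n d) (forestVertices n d) (s 37) (s 38) (s 39))
    (C : CoreKeys n d (s 37) (s 38) (s 40)) (hco : ∀ v < n, s 42 (rank n (s 40) v) = v) :
    blocksCmd.Ensures s (BlocksStored n d) := by
  have hn := H.good.core_add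
  have hn0 := H.n_pos
  -- The contents of array `42` are used as indices into the table of shares, which is specified
  -- only below `n`.
  have hlt : ∀ k < n, s 42 k < n := fun k hk => by
    obtain ⟨v, hv, rfl⟩ := exists_rank_eq (C.inj H F) hk
    rwa [hco v hv]
  refine .cons fun s1 f1 e1 => ?_
  have g1 : ∀ k < (params n d).core + 1, s1 43 k = ∑ j ∈ Finset.range k, share n d (s 42 j) := by
    rw [e1]
    refine Cmd.sumTable_spec (m' := id) (f := fun _ j => share n d (s 42 j)) (by decide)
      (by simp [S.core]) (by rw [S.length]; omega) (fun i hi => ⟨?_, fun t ht hc => hc⟩)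
      fun i hi j hj t ht hc hc' => ?_
    · rw [S.length, id]
      omega
    · simp only [id] at hj
      simp (disch := decide) only [eval_read, eval_var, ht, hc']
      exact S.share _ (hlt j (by omega))
  refine .cons fun s2 f2 e2 => ?_
  have g2 : ∀ j < 2 * (params n d).tokens, s2 44 j = _root_.owner (params n d).core (s1 43) j := by
    rw [e2]
    refine Cmd.sumTable_spec (m' := fun _ => (params n d).core)
      (f := fun j k => 1 - (s1 43 (k + 1) - j)) (by decide) ?_ ?_ (fun i hi => ⟨?_, fun t ht hc => ?_⟩)
      fun i hi j hj t ht hc hc' => ?_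
    · simp (disch := decide) [f1, S.tokens, two_mul]
    · simp (disch := decide) only [f1, S.length]; omega
    · simp (disch := decide) only [f1, S.length]; omega
    · simp (disch := decide) [ht, f1, S.core]
    · simp (disch := decide) [ht, hc, hc']
  refine .write fun s3 f3 e3 _ => .write fun s4 f4 e4 _ => .nil ?_
  simp (disch := decide) only [eval_add, eval_sub, eval_var, eval_ofNat, eval_read, f3, f2, f1,
    S.tokens] at e3 e4
  rw [e3] at e4
  have h43 : s4 43 = s1 43 := by simp (disch := decide) only [f4, f3, f2]
  refine ⟨S.toParamsStored.congr ?_, ?_, fun j hj => ?_, fun hK => ?_, fun hK => ?_⟩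
  · simp (disch := decide) only [List.forall_mem_cons, f4, f3, f2, f1]
    simp
  · rw [h43]
    simp (disch := decide) only [f4, f3, f2, f1]
    refine ⟨H, F, C, hco, g1 0 (by omega), fun k hk => ?_⟩
    rw [g1 _ (by omega), g1 _ (by omega), Finset.sum_range_succ]
  · rw [h43]
    simp (disch := decide) only [f4, f3]
    exact g2 j hj
  · rw [h43]
    simp (disch := decide) only [f4]
    rw [e3, g2 _ (by omega)]
    rfl
  · rw [h43, e4, g2 _ (by omega)]
    rfl

/-- Lists the edges of the cycle. -/
def cycleCmd : Cmd := .block [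
  .emits 60 (var 18 - 1) 4 5 6 1 (read 42 (var 60)) (read 42 (var 60 + 1)),
  .emit 4 5 6 (read 42 0) (read 42 (var 18 - 1))]

theorem cycleCmd_spec {n : ℕ} {d : ℕ → ℕ} {s : State} (H : Feasible n d) (S : ParamsStored n d s) :
    cycleCmd.Ensures s fun t =>
      pairs t 4 5 6 = pairs s 4 5 6 ++ cycleEdges (params n d).core (s 42) := by
  have hn := H.good.core_add
  refine .cons fun s1 f1 e1 => .cons fun s2 f2 e2 => .nil ?_
  rw [e2, Cmd.emit_spec (a := s 42 0) (b := s 42 ((params n d).core - 1)) (by decide), e1,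
    Cmd.emits_spec (m := (params n d).core - 1) (p := fun _ => True)
    (f := fun k => (s 42 k, s 42 (k + 1))) (by decide)]
  · simp [cycleEdges]
  · simp [S.core]
  · rw [S.length]
    omega
  · intro i hi t ht hc
    simp (disch := decide) [ht, hc]
  · simp (disch := decide) [f1]
  · intro t ht
    simp (disch := decide) [ht, f1, S.core]

end RAM

/-! ### The programs for the tokens, the final keys and the answer -/

namespace RAM

open RAM.Expr

/-! The arrays `48` and `49` hold the half-edges of the tokens, array `50` the tokens, and array `51`
the keys of all vertices. -/

/-- Computes the tokens and their half-edges. -/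
def tokensCmd : Cmd := .block [
  .tabulate 60 (var 17) 48 (Expr.ite (var 17 - (var 60 + var 46)) (var 60)
    (Expr.ite (var 17 + var 17 - (var 60 + var 45 + var 46))
      (var 45 + var 45 + (var 46 + var 46) + var 60 - (var 17 + var 17))
      (var 60 + var 45 - var 17))),
  .tabulate 60 (var 17) 49 (Expr.ite (var 17 + var 17 - (var 60 + var 45 + var 46))
    (var 17 + var 17 - 1 - var 60) (var 45 + var 17 - 1 - var 60)),
  .tabulate 60 (var 17) 50 (Expr.ite (var 14 - var 60) (var 18 + var 16 + var 60)
    (var 18 + (var 60 - var 14)))]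

/-- The memory holds the tokens and their half-edges. -/
structure TokensStored (n : ℕ) (d : ℕ → ℕ) (s : State) : Prop extends BlocksStored n d s where
  low : ∀ i < (params n d).tokens, s 48 i = tokenLow (params n d).tokens
    (_root_.midStart (params n d).core (params n d).tokens (s 43))
    (_root_.midLength (params n d).core (params n d).tokens (s 43)) i
  high : ∀ i < (params n d).tokens, s 49 i = tokenHigh (params n d).tokens
    (_root_.midStart (params n d).core (params n d).tokens (s 43))
    (_root_.midLength (params n d).core (params n d).tokens (s 43)) i
  id : ∀ i < (params n d).tokens, s 50 i = tokenId (params n d) i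

theorem BlocksStored.congr {n : ℕ} {d : ℕ → ℕ} {s t : State} (S : BlocksStored n d s)
    (h : ∀ a ∈ [0, 1, 13, 14, 16, 17, 18, 19, 47, 37, 38, 39, 40, 42, 43, 44, 45, 46], t a = s a) :
    BlocksStored n d t := by
  refine ⟨S.toParamsStored.congr fun a ha => h a (by revert a; decide), ?_, ?_, ?_, ?_⟩ <;>
    simp (disch := decide) only [h]
  · exact S.order
  · exact S.owner
  · exact S.midStart
  · exact S.midLength

theorem tokensCmd_spec {n : ℕ} {d : ℕ → ℕ} {s : State} (H : Feasible n d)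
    (S : BlocksStored n d s) : tokensCmd.Ensures s (TokensStored n d) := by
  have hn := H.good.core_add
  have hK := H.good.tokens_eq
  have hmid := S.order.tokenData.mid
  refine .cons fun s1 f1 e1 => ?_
  have g1 : ∀ i < (params n d).tokens, s1 48 i = tokenLow (params n d).tokens
      (_root_.midStart (params n d).core (params n d).tokens (s 43))
      (_root_.midLength (params n d).core (params n d).tokens (s 43)) i := by
    rw [e1]
    refine Cmd.tabulate_spec (by decide) (by simp [S.tokens]) (by rw [S.length]; omega)
      fun i hi t ht hc => ?_
    have h1 := S.midStart (by omega)
    have h2 := S.midLength (by omega)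
    obtain ⟨m1, m2, m3, -⟩ := hmid (by omega)
    have z0 : t 47 0 = 0 := by simp (disch := decide) only [ht, S.ite_zero]
    have z1 : t 47 1 = 6 * n := by simp (disch := decide) only [ht, S.ite_one]
    have inner := eval_ite (e := var 17 + var 17 - (var 60 + var 45 + var 46))
      (x := var 45 + var 45 + (var 46 + var 46) + var 60 - (var 17 + var 17))
      (y := var 60 + var 45 - var 17) z0 z1
    simp (disch := decide) only [eval_add, eval_sub, eval_var, ht, hc, h1, h2, S.tokens] at inner
    -- Conditional expressions work only for values up to `6 * n`; the position of the middle block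
    -- provides these bounds.
    specialize inner (by intro _; omega) (by intro _; omega)
    rw [eval_ite z0 z1, inner]
    · simp (disch := decide) only [eval_add, eval_sub, eval_var, ht, hc, h2, S.tokens]
      unfold tokenLow
      split_ifs <;> omega
    · intro _
      simp only [eval_var, hc]
      omega
    · intro _
      rw [inner]
      split_ifs <;> omega
  refine .cons fun s2 f2 e2 => ?_
  have g2 : ∀ i < (params n d).tokens, s2 49 i = tokenHigh (params n d).tokens
      (_root_.midStart (params n d).core (params n d).tokens (s 43))
      (_root_.midLength (params n d).core (params n d).tokens (s 43)) i := by
    rw [e2]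
    refine Cmd.tabulate_spec (by decide) ?_ ?_ fun i hi t ht hc => ?_
    · simp (disch := decide) [f1, S.tokens]
    · simp (disch := decide) only [f1, S.length]; omega
    have h1 := S.midStart (by omega)
    have h2 := S.midLength (by omega)
    obtain ⟨m1, m2, m3, -⟩ := hmid (by omega)
    rw [eval_ite (B := 6 * n) (by simp (disch := decide) only [ht, f1, S.ite_zero])
      (by simp (disch := decide) only [ht, f1, S.ite_one])]
    · simp (disch := decide) only [eval_add, eval_sub, eval_var, eval_ofNat, ht, hc, f1, h1, h2,
        S.tokens]
      unfold tokenHigh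
      split_ifs <;> omega
    all_goals
      intro _
      simp (disch := decide) only [eval_add, eval_sub, eval_var, eval_ofNat, ht, hc, f1, h1,
        S.tokens]
      omega
  refine .cons fun s3 f3 e3 => .nil ⟨S.congr ?_, ?_, ?_, ?_⟩
  · simp (disch := decide) only [List.forall_mem_cons, f3, f2, f1]
    simp
  · simp (disch := decide) only [f3, f2]
    simp (disch := decide) only [f1]
    exact g1
  · simp (disch := decide) only [f3]
    simp (disch := decide) only [f2, f1]
    exact g2
  · rw [e3]
    refine Cmd.tabulate_spec (by decide) ?_ ?_ fun i hi t ht hc => ?_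
    · simp (disch := decide) [f2, f1, S.tokens]
    · simp (disch := decide) only [f2, f1, S.length]; omega
    rw [eval_ite (B := 6 * n) (by simp (disch := decide) only [ht, f2, f1, S.ite_zero])
      (by simp (disch := decide) only [ht, f2, f1, S.ite_one])]
    · simp (disch := decide) only [eval_add, eval_sub, eval_var, ht, hc, f2, f1, S.pend, S.core,
        S.doubled]
      unfold tokenId
      split_ifs <;> omega
    all_goals
      intro _
      simp (disch := decide) only [eval_add, eval_sub, eval_var, ht, hc, f2, f1, S.pend, S.core,
        S.doubled]
      omega

/-- Computes the keys of all vertices. -/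
def keysCmd : Cmd := .block [
  .scatter 60 (var 18) 51 (read 42 (var 60)) (var 60 + read 43 (var 60)),
  .scatter 60 (var 17) 51 (read 50 (var 60))
    (read 48 (var 60) + read 44 (read 48 (var 60)) + 1)]

theorem TokensStored.low_lt {n : ℕ} {d : ℕ → ℕ} {s : State} (S : TokensStored n d s) {i : ℕ}
    (hi : i < (params n d).tokens) : s 48 i < 2 * (params n d).tokens ∧
      s 49 i < 2 * (params n d).tokens := by
  obtain ⟨m1, m2, m3, -⟩ := S.order.tokenData.mid (by omega)
  rw [S.low i hi, S.high i hi]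
  refine ⟨?_, tokenHigh_lt m1 hi⟩
  unfold tokenLow
  split_ifs <;> omega

theorem keysCmd_spec {n : ℕ} {d : ℕ → ℕ} {s : State} (H : Feasible n d)
    (S : TokensStored n d s) : keysCmd.Ensures s fun t =>
      Drawing n d (s 37) (s 38) (s 39) (s 40) (s 42) (s 43) (t 51) := by
  have hn := H.good.core_add
  refine .cons fun s1 f1 e1 => ?_
  have g1 : ∀ k < (params n d).core, s1 51 (s 42 k) = k + s 43 k := by
    rw [e1]
    refine (Cmd.scatter_spec (by decide) (by simp [S.core]) (by rw [S.length]; omega)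
      (fun i hi t ht hc => ?_) fun i hi j hj h => S.order.co_inj hi hj h).1
    simp (disch := decide) [ht, hc]
  refine .cons fun s2 f2 e2 => .nil ?_
  have key := Cmd.scatter_spec (c := 60) (a := 51) (b := var 17) (s := s1)
    (idx := read 50 (var 60)) (e := read 48 (var 60) + read 44 (read 48 (var 60)) + 1)
    (m := (params n d).tokens) (g := tokenId (params n d))
    (f := fun i => tokenLow (params n d).tokens
      (_root_.midStart (params n d).core (params n d).tokens (s 43))
      (_root_.midLength (params n d).core (params n d).tokens (s 43)) i +
      lowBlock (params n d) (s 43) i + 1) (by decide)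
    (by simp (disch := decide) [f1, S.tokens])
    (by simp (disch := decide) only [f1, S.length]; omega)
    (fun i hi t ht hc => ⟨by simp (disch := decide) [ht, hc, f1, S.id i hi], by
      simp (disch := decide) only [eval_add, eval_read, eval_var, eval_ofNat, ht, hc, f1]
      rw [S.owner _ (S.low_lt hi).1, S.low i hi]
      rfl⟩)
    (fun i hi j hj h => Drawing.tokenId_inj H hi hj h)
  rw [Cmd.scatter] at e2 key
  rw [← e2] at key
  refine ⟨S.order, fun k hk => ?_, key.1⟩
  rw [key.2, g1 k hk]
  -- Storing the token keys leaves the core keys intact, since tokens lie outside the core.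
  intro i hi h
  have h1 := (Drawing.tokenId_spec H hi).1
  have h2 := (S.order.co_spec hk).1
  omega

/-- Lists the edges at the tokens. -/
def tokenEdgesCmd : Cmd := .block [
  .emits 60 (var 17) 4 5 6 1 (read 42 (read 44 (read 48 (var 60)))) (read 50 (var 60)),
  .emits 60 (var 0) 4 5 6 (var 13 - (var 60 + var 60 + 1)) (var 18 + var 16 + (var 60 + var 60))
    (var 18 + var 16 + (var 60 + var 60 + 1)),
  .emits 60 (var 17) 7 8 9 (var 60 + 1 - var 14) (read 50 (var 60))
    (read 42 (read 44 (read 49 (var 60))))]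

theorem tokenEdgesCmd_spec {n : ℕ} {d : ℕ → ℕ} {s : State} (H : Feasible n d)
    (S : TokensStored n d s) : tokenEdgesCmd.Ensures s fun t =>
      pairs t 4 5 6 = pairs s 4 5 6 ++ lowEdges (params n d) (s 42) (s 43) ++
        pseudoEdges n (params n d) ∧
      pairs t 7 8 9 = pairs s 7 8 9 ++ highEdges (params n d) (s 42) (s 43) := by
  have hn := H.good.core_add
  refine .cons fun s1 f1 e1 => .cons fun s2 f2 e2 => .cons fun s3 f3 e3 => .nil ⟨?_, ?_⟩
  · rw [pairs_congr (f3 4 (by decide)) (f3 5 (by decide)) (f3 6 (by decide)), e2,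
      Cmd.emits_spec (m := n) (p := fun i => 2 * i + 1 < (params n d).pseudo)
        (f := fun i => ((params n d).core + (params n d).doubled + 2 * i,
          (params n d).core + (params n d).doubled + (2 * i + 1))) (by decide), e1,
      Cmd.emits_spec (m := (params n d).tokens) (p := fun _ => True)
        (f := fun i => (s 42 (lowBlock (params n d) (s 43) i), tokenId (params n d) i)) (by decide)]
    · simp [lowEdges, pseudoEdges]
    · simp [S.tokens]
    · rw [S.length]
      omega
    · intro i hi t ht hc
      simp (disch := decide) only [eval_read, eval_var, eval_ofNat, ht, hc]
      rw [S.owner _ (S.low_lt hi).1, S.low i hi, S.id i hi]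
      exact ⟨by simp, fun _ => ⟨rfl, rfl⟩⟩
    · simp (disch := decide) [f1, S.length]
    · simp (disch := decide) only [f1, S.length]
      omega
    · intro i hi t ht hc
      simp (disch := decide) only [eval_add, eval_sub, eval_var, eval_ofNat, ht, hc, f1, S.pseudo,
        S.core, S.doubled]
      omega
  · rw [e3, Cmd.emits_spec (m := (params n d).tokens) (p := fun i => (params n d).pend ≤ i)
        (f := fun i => (tokenId (params n d) i, s 42 (highBlock (params n d) (s 43) i)))
        (by decide), pairs_congr (s := s) (t := s2)]
    · rfl
    all_goals try simp (disch := decide) only [f2, f1]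
    · simp (disch := decide) [f2, f1, S.tokens]
    · rw [S.length]
      omega
    · intro i hi t ht hc
      simp (disch := decide) only [eval_add, eval_sub, eval_read, eval_var, eval_ofNat, ht, hc, f2,
        f1, S.pend]
      rw [S.owner _ (S.low_lt hi).2, S.high i hi, S.id i hi]
      exact ⟨by omega, fun _ => ⟨rfl, rfl⟩⟩

/-- Computes the positions of the vertices and gives a positive answer. -/
def answerCmd : Cmd := .block [
  .sumTable 60 (var 0) 61 (var 0) 3 (1 - (1 - (read 51 (var 60) - read 51 (var 61)))),
  .write 2 0 1]

theorem answerCmd_spec {n : ℕ} {s : State} (h0 : s 0 0 = n) :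
    answerCmd.Ensures s fun t => (∀ v < n, t 3 v = rank n (s 51) v) ∧ t 2 0 = 1 := by
  refine .cons fun s1 f1 e1 => .write fun s2 f2 e2 _ => .nil ⟨fun v hv => ?_, e2⟩
  rw [f2 3 (by decide), e1, rank_eq_sum]
  refine Cmd.sumTable_spec (m' := fun _ => n) (f := fun v u => 1 - (1 - (s 51 v - s 51 u)))
    (by decide) (by simp [h0]) (by omega) (fun i hi => ⟨by omega, fun t ht hc => ?_⟩)
    (fun i hi j hj t ht hc hc' => ?_) v hv
  · simp (disch := decide) [ht, h0]
  · simp (disch := decide) [ht, hc, hc']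

/-- Constructs a realization with a 2-page book embedding. -/
def drawCmd : Cmd := .block [paramsCmd, shareCmd, classifyCmd, sepCmd, forestCmd, coreKeyCmd,
  orderCmd, forestEdgesCmd, blocksCmd, cycleCmd, tokensCmd, keysCmd, tokenEdgesCmd, answerCmd]

theorem drawCmd_spec {n : ℕ} {d : ℕ → ℕ} {s : State} (H : Feasible n d) (h0 : s 0 0 = n)
    (h1 : s 1 = d) (h4 : s 4 0 = 0) (h7 : s 7 0 = 0) :
    drawCmd.Ensures s fun t => t 2 0 = 1 ∧ ∃ ch sd par ck co E key,
      Drawing n d ch sd par ck co E key ∧ (∀ v < n, t 3 v = rank n key v) ∧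
      pairs t 4 5 6 = pageOne n d ch sd par co E ∧ pairs t 7 8 9 = pageTwo n d co E := by
  refine .cons fun s1 f1 e1 => ?_
  have g1 : ParamsStored n d s1 := by rw [e1]; exact paramsCmd_spec H h0 h1
  refine .cons fun s2 f2 e2 => ?_
  have g2 : SharesStored n d s2 := by rw [e2]; exact shareCmd_spec g1
  refine .cons fun s3 f3 e3 => ?_
  have g3 : ClassesStored n d s3 := by rw [e3]; exact classifyCmd_spec H g2
  refine .cons fun s4 f4 e4 => ?_
  obtain ⟨g4, g31, p4⟩ : SepStored n d s4 ∧ s4 31 0 = skipped n d ∧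
      pairs s4 7 8 9 = sepEdges n d := by
    rw [e4]
    exact sepCmd_spec H g3 (by simp (disch := decide) only [f3, f2, f1, h4])
      (by simp (disch := decide) only [f3, f2, f1, h7])
  refine .cons fun s5 f5 e5 => ?_
  have F5 : IsForest (forestDegree n d) (forestVertices n d) (s5 37) (s5 38) (s5 39) := by
    rw [e5]
    exact forestCmd_spec H g4.toClassesStored g31 g4.size
  have g5 : SepStored n d s5 := g4.congr fun a ha => f5 a (by revert a; decide)
  refine .cons fun s6 f6 e6 => ?_
  have C6 : CoreKeys n d (s6 37) (s6 38) (s6 40) := by rw [e6]; exact coreKeyCmd_spec H g5 F5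
  have g6 : SepStored n d s6 := g5.congr fun a ha => f6 a (by revert a; decide)
  rw [← f6 37 (by decide), ← f6 38 (by decide), ← f6 39 (by decide)] at F5
  refine .cons fun s7 f7 e7 => ?_
  have O7 : ∀ v < n, s7 42 (rank n (s7 40) v) = v := by
    rw [e7]
    exact orderCmd_spec g6.length (C6.inj H F5)
  have g7 : SepStored n d s7 := g6.congr fun a ha => f7 a (by revert a; decide)
  rw [← f7 37 (by decide), ← f7 38 (by decide), ← f7 39 (by decide)] at F5
  rw [← f7 37 (by decide), ← f7 38 (by decide), ← f7 40 (by decide)] at C6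
  refine .cons fun s8 f8 e8 => ?_
  have p8 : pairs s8 4 5 6 =
      forestEdges (s7 37) (s7 38) (s7 39) (forestVertices n d).length := by
    rw [e8]
    exact forestEdgesCmd_spec H g7 F5
  have g8 : SharesStored n d s8 := g7.toSharesStored.congr fun a ha => f8 a (by revert a; decide)
  refine .cons fun s9 f9 e9 => ?_
  have g9 : BlocksStored n d s9 := by
    rw [e9]
    refine blocksCmd_spec H g8 ?_ ?_ ?_ <;> simp (disch := decide) only [f8]
    · exact F5
    · exact C6
    · exact O7
  refine .cons fun s10 f10 e10 => ?_
  have p10 : pairs s10 4 5 6 = pairs s9 4 5 6 ++ cycleEdges (params n d).core (s9 42) := by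
    rw [e10]
    exact cycleCmd_spec H g9.toParamsStored
  have g10 : BlocksStored n d s10 := g9.congr fun a ha => f10 a (by revert a; decide)
  refine .cons fun s11 f11 e11 => ?_
  have g11 : TokensStored n d s11 := by rw [e11]; exact tokensCmd_spec H g10
  refine .cons fun s12 f12 e12 => ?_
  have D12 : Drawing n d (s11 37) (s11 38) (s11 39) (s11 40) (s11 42) (s11 43) (s12 51) := by
    rw [e12]
    exact keysCmd_spec H g11
  have g12 : TokensStored n d s12 := by
    refine ⟨g11.toBlocksStored.congr fun a ha => f12 a (by revert a; decide), ?_, ?_, ?_⟩ <;>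
      simp (disch := decide) only [f12]
    · exact g11.low
    · exact g11.high
    · exact g11.id
  refine .cons fun s13 f13 e13 => ?_
  obtain ⟨p13, q13⟩ : pairs s13 4 5 6 = pairs s12 4 5 6 ++
      lowEdges (params n d) (s12 42) (s12 43) ++ pseudoEdges n (params n d) ∧
      pairs s13 7 8 9 = pairs s12 7 8 9 ++ highEdges (params n d) (s12 42) (s12 43) := by
    rw [e13]
    exact tokenEdgesCmd_spec H g12
  refine .cons fun s14 f14 e14 => .nil ?_
  obtain ⟨a1, a2⟩ : (∀ v < n, s14 3 v = rank n (s13 51) v) ∧ s14 2 0 = 1 := by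
    rw [e14]
    exact answerCmd_spec (by rw [f13 0 (by decide)]; exact g12.length)
  rw [f13 51 (by decide)] at a1
  refine ⟨a2, _, _, _, _, _, _, _, D12, a1, ?_, ?_⟩
  · simp (disch := decide) only [pairs, f14, f12, f11, f9] at p8 p10 p13 ⊢
    rw [p13, p10, p8]
    simp (disch := decide) only [pageOne, f10, f9, f8, List.append_assoc]
  · simp (disch := decide) only [pairs, f14, f12, f11, f10, f9, f8, f7, f6, f5] at p4 q13 ⊢
    rw [q13, p4]
    rfl

end RAM

/-! ### Determinism, correctness of the whole program, and the theorem -/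

namespace RAM

/-- The machine is deterministic. -/
theorem Exec.unique {p : Prog} {s s₁ s₂ : State} {t₁ t₂ : ℕ} (h₁ : Exec p s t₁ s₁)
    (h₂ : Exec p s t₂ s₂) : s₁ = s₂ := by
  induction h₁ generalizing t₂ s₂ with
  | skip => cases h₂; rfl
  | write => cases h₂; rfl
  | seq _ _ ih ih' =>
    cases h₂ with
    | seq h h' =>
      cases ih h
      exact ih' h'
  | branch_true h _ ih =>
    cases h₂ with
    | branch_true _ h' => exact ih h'
    | branch_false h' _ => exact absurd h' h
  | branch_false h _ ih =>
    cases h₂ with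
    | branch_true h' _ => exact absurd h h'
    | branch_false _ h' => exact ih h'
  | loop_done h =>
    cases h₂ with
    | loop_done _ => rfl
    | loop_step h' _ _ => exact absurd h h'
  | loop_step h _ _ ih ih' =>
    cases h₂ with
    | loop_done h' => exact absurd h' h
    | loop_step _ h1 h2 =>
      cases ih h1
      exact ih' h2

/-- The program: it rejects `d` if the largest entry is not smaller than the length. -/
def mainCmd : Cmd := .branch (Expr.var 0 - Expr.var 1) drawCmd .skip

theorem listsEdges_graphOfList {n : ℕ} {s : State} {c a b : ℕ} {l : List (ℕ × ℕ)} {key : ℕ → ℕ}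
    (h : pairs s c a b = l) (hl : ∀ x ∈ l, (x.1 < n ∧ x.2 < n) ∧ key x.1 < key x.2) :
    ListsEdges s c a b (graphOfList n l) := by
  have hadj := graphOfList_adj (n := n) (l := l) (key := key) fun x hx => (hl x hx).2
  have hmem : ∀ x, x ∈ l ↔ ∃ k < s c 0, (s a k, s b k) = x := fun x => by
    simp [← h, pairs]
  refine ⟨fun k hk => ?_, fun u v huv => ?_⟩
  · have hx := (hmem _).2 ⟨k, hk, rfl⟩
    have hb := (hl _ hx).1
    exact ⟨⟨_, hb.1⟩, ⟨_, hb.2⟩, (hadj _ _).2 (.inl hx), rfl, rfl⟩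
  · rcases (hadj u v).1 huv with hx | hx <;> obtain ⟨k, hk, e⟩ := (hmem _).1 hx <;>
      simp only [Prod.mk.injEq] at e
    · exact ⟨k, hk, .inl e⟩
    · exact ⟨k, hk, .inr e⟩

end RAM

theorem feasible_of_mem_familyD {n : ℕ} {d : Fin n → ℕ} (h : d ∈ familyD n)
    (htop : RAM.input d 1 0 < n) : Feasible n (RAM.input d 1) := by
  obtain ⟨anti, pos, even, lower, upper⟩ := h
  have hd : ∀ i (hi : i < n), RAM.input d 1 i = d ⟨i, hi⟩ := fun i hi => by simp [RAM.input, hi]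
  have hsum : ∑ i ∈ Finset.range n, RAM.input d 1 i = ∑ i, d i := by
    rw [Finset.sum_range]
    exact Finset.sum_congr rfl fun i _ => hd i i.2
  have hones : ∑ i ∈ Finset.range n, (1 - (RAM.input d 1 i - 1)) = multiplicity_in d 1 := by
    rw [Finset.sum_range, multiplicity_in, Finset.card_filter]
    refine Finset.sum_congr rfl fun i _ => ?_
    have := pos i
    rw [hd i i.2]
    change 1 - (d i - 1) = _
    split_ifs <;> omega
  refine ⟨fun i j hij hj => ?_, fun i hi => ?_, by rwa [hsum], by rwa [hsum],
    by rwa [hsum, hones], htop⟩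
  · rw [hd i (by omega), hd j hj]
    exact anti hij
  · rw [hd i hi]
    exact pos _

/-- A vertex is not its own neighbour. This is the only reason for a rejection. -/
theorem lt_of_realizes {n : ℕ} {d : Fin n → ℕ} {G : SimpleGraph (Fin n)} (h : Realizes G d)
    (v : Fin n) : d v < n := by
  rw [← h v]
  calc (G.neighborSet v).ncard < (Set.univ : Set (Fin n)).ncard :=
        Set.ncard_lt_ncard (Set.ssubset_univ_iff.2 fun e => by
          have : v ∈ G.neighborSet v := e ▸ Set.mem_univ v
          exact G.irrefl this)
    _ = n := by rw [Set.ncard_univ, Nat.card_fin]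

theorem RAM.mainCmd_spec {n : ℕ} {d : Fin n → ℕ} (hd : d ∈ familyD n) :
    RAM.mainCmd.Ensures (RAM.input d) fun s =>
      (RAM.AnswersNo s ∧ ¬ IsOuterplanaric d) ∨ RAM.Returns2PBE s d := by
  have h0 : RAM.input d 0 0 = n := by simp [RAM.input]
  refine .branch (fun h => .inr ?_) fun h => .inl ⟨by simp [RAM.AnswersNo, RAM.input, Cmd.run], ?_⟩
    <;> simp only [Expr.eval_sub, Expr.eval_var, h0] at h
  · have H := feasible_of_mem_familyD hd (by omega)
    obtain ⟨h2, ch, sd, par, ck, co, E, key, D, h3, p1, p2⟩ :=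
      RAM.drawCmd_spec H h0 rfl (by simp [RAM.input]) (by simp [RAM.input])
    obtain ⟨pos, hpos, hr⟩ := D.isTwoPageRealization (δ := d) fun v => by simp [RAM.input]
    exact ⟨by rw [h2]; exact one_ne_zero, pos, _, _,
      fun v => (h3 v v.2).trans (hpos v).symm,
      RAM.listsEdges_graphOfList p1 fun x hx => D.lt_and_key_lt (List.mem_append_left _ hx),
      RAM.listsEdges_graphOfList p2 fun x hx => D.lt_and_key_lt (List.mem_append_right _ hx), hr⟩
  -- No simple graph has these degrees, so outerplanarity of `G` is irrelevant.
  · rintro ⟨G, -, hG⟩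
    have hn : 0 < n := by
      have := hd.2.2.2.2
      omega
    have := lt_of_realizes hG ⟨0, hn⟩
    have e : RAM.input d 1 0 = d ⟨0, hn⟩ := by simp [RAM.input, hn]
    omega

theorem mainTheorem1 :
    ∃ (P : RAM.Prog) (p : Polynomial ℕ),
      (∀ (n : ℕ), ∀ d ∈ familyD n, ∃ (t : ℕ) (s : RAM.State),
        RAM.Exec P (RAM.input d) t s ∧ t ≤ p.eval n ∧
          ((RAM.AnswersNo s ∧ ¬ IsOuterplanaric d) ∨ RAM.Returns2PBE s d)) ∧
      (∀ n : ℕ,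
        familyD n = familyNOP P n ∪ family2PBE P n ∧
        Disjoint (familyNOP P n) (family2PBE P n) ∧
        (∀ d ∈ familyNOP P n, ¬ IsOuterplanaric d) ∧
        (∀ d ∈ family2PBE P n, ∃ pos G₁ G₂, IsTwoPageRealization d pos G₁ G₂) ∧
        (∀ d ∈ familyD n, IsOuterplanaric d → d ∈ family2PBE P n)) := by
  have main : ∀ (n : ℕ), ∀ d ∈ familyD n, ∃ (t : ℕ) (s : RAM.State),
      RAM.Exec RAM.mainCmd.compile (RAM.input d) t s ∧ t ≤ RAM.mainCmd.time.eval n ∧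
        ((RAM.AnswersNo s ∧ ¬ IsOuterplanaric d) ∨ RAM.Returns2PBE s d) := fun n d hd => by
    obtain ⟨t, ht, ex⟩ := RAM.mainCmd.exec_compile (by decide) (RAM.input d)
    exact ⟨t, _, ex, by simpa [RAM.input] using ht, RAM.mainCmd_spec hd⟩
  refine ⟨RAM.mainCmd.compile, RAM.mainCmd.time, main, fun n => ⟨?_, ?_, ?_, ?_, ?_⟩⟩
  · refine Set.Subset.antisymm (fun d hd => ?_) (Set.union_subset (fun d h => h.1) fun d h => h.1)
    obtain ⟨t, s, ex, -, ⟨h, -⟩ | h⟩ := main n d hd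
    · exact .inl ⟨hd, t, s, ex, h⟩
    · exact .inr ⟨hd, t, s, ex, h⟩
  · refine Set.disjoint_left.2 ?_
    rintro d ⟨-, t, s, ex, h⟩ ⟨-, t', s', ex', h', -⟩
    -- The families speak of some halting run; determinism identifies it with any other run on the
    -- same input, so that the two answers exclude each other.
    exact h' (ex.unique ex' ▸ h)
  · rintro d ⟨hd, t, s, ex, h⟩
    obtain ⟨t', s', ex', -, ⟨-, h'⟩ | ⟨h', -⟩⟩ := main n d hd
    · exact h'
    · exact absurd (ex.unique ex' ▸ h) h'
  · rintro d ⟨-, t, s, -, -, pos, G₁, G₂, -, -, -, h⟩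
    exact ⟨pos, G₁, G₂, h⟩
  · intro d hd ho
    obtain ⟨t, s, ex, -, ⟨-, h⟩ | h⟩ := main n d hd
    · exact absurd ho h
    · exact ⟨hd, t, s, ex, h⟩
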